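/- **Theorem 2.1 (Error estimates for the metric problem).** Let $(\Omega,\mathcal F,\mathbb P)$ be a probability space with a group $(\tau_y)_{y\in\mathbb R^d}$ of measurable, measure-preserving transformations of $\Omega$ ($\tau_{x+y}=\tau_x\circ\tau_y$), and let $H=H(p,y,\omega):\mathbb R^d\times\mathbb R^d\times\Omega\to\mathbb R$ be jointly measurable and stationary, $H(p,y,\tau_z\omega)=H(p,y+z,\omega)$. Write $B_R=\{p\in\mathbb R^d:|p|<R\}$ and, for Borel $V\subseteq\mathbb R^d$, let $\mathcal G(V)$ be the $\sigma$-algebra generated by the random variables $\omega\mapsto H(p,x,\omega)$, $p\in\mathbb R^d$, $x\in V$. Assume: 1. (finite range of dependence) for all Borel $V,W\subseteq\mathbb R^d$ with $\operatorname{dist}(V,W)\ge 1$, the $\sigma$-algebras $\mathcal G(V)$ and $\mathcal G(W)$ are independent; 2. (regularity) for every $R>0$, the family $\{H(\cdot,\cdot,\omega):\omega\in\Omega\}$ is precompact in $C(B_R\times\mathbb R^d)$ for the topology of locally uniform convergence, and $\{H(\cdot,x,\omega):\omega\in\Omega,\ x\in\mathbb R^d\}$ is bounded in $C^{0,1}(B_R)$;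 3. (coercivity) $\lim_{|p|\to\infty}\operatorname{ess\,inf}_{\omega}H(p,0,\omega)=+\infty$; 4. (level-set convexity) there is $\Lambda:\mathbb R\times\mathbb R\to\mathbb R$, nondecreasing in each variable, with $\Lambda(\mu,\nu)\le\max\{\mu,\nu\}$ for all $\mu,\nu$, with strict inequality if $\mu\ne\nu$, such that $H(\tfrac12(p+q),y,\omega)\le\Lambda(H(p,y,\omega),H(q,y,\omega))$ for all $p,q,y,\omega$; 5. $H(p,y,\omega)\ge H(0,y,\omega)$ for all $p,y,\omega$, and $\operatorname{ess\,sup}_\omega H(0,0,\omega)=0$. For $\mu>0$ and $x,z\in\mathbb R^d$ let $$m_\mu(z,x,\omega)=\sup\{w(z)-w(x):\ w:\mathbb R^d\to\mathbb R\text{ Lipschitz},\ H(Dw,y,\omega)\le\mu\text{ in }\mathbb R^d\text{ in the viscosity sense}\}.$$ Then for every $\mu>0$ there is a deterministic function $\overline m_\mu:\mathbb R^d\to\mathbb R$ such that, for every $y\in\mathbb R^d$, $\lim_{t\to\infty}t^{-1}m_\mu(ty,0,\omega)=\overline m_\mu(y)$ for $\mathbb P$-almost every $\omega$. Moreover, for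 every $K>0$ there is a constant $C>0$, depending only on $K$ and $H$, such that for every $0<\mu\le K$, $\lambda>0$ and $y\in\mathbb R^d$ with $|y|>1$, $$\mathbb P\big[m_\mu(y,0,\cdot)-\overline m_\mu(y)\le-\lambda\big]\le\exp\Big(-\frac{\mu\lambda^2}{C|y|}\Big),$$ and, if $$\lambda\ge C\Big(\frac{|y|^{1/2}}{\mu^{3/2}}+\frac{|y|^{2/3}}{\mu}\Big)\Big(\log\Big(1+\frac{|y|}{\mu}\Big)\Big)^{1/2},$$ then $$\mathbb P\big[m_\mu(y,0,\cdot)-\overline m_\mu(y)\ge\lambda\big]\le\exp\Big(-\frac{\mu\lambda^2}{C|y|}\Big).$$ -/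

import Mathlib

open MeasureTheory ProbabilityTheory Filter Topology
open scoped NNReal

namespace HJ

/-- The Euclidean space `ℝ^d`. -/
abbrev Space (d : ℕ) : Type := EuclideanSpace ℝ (Fin d)

/-- The σ-algebra `𝒢(V)` on `Ω` generated by the random variables `ω ↦ H(p,x,ω)`
with `p ∈ ℝ^d` and `x ∈ V`. -/
abbrev sigmaAlg {d : ℕ} {Ω : Type*} (H : Space d → Space d → Ω → ℝ) (V : Set (Space d)) :
    MeasurableSpace Ω :=
  ⨆ (p : Space d) (x : Space d) (_ : x ∈ V), MeasurableSpace.comap (H p x) (borel ℝ)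

/-- The standing hypotheses on the translations `τ` of the probability space `(Ω, P)` and on the
random Hamiltonian `H = H(p,y,ω)`. -/
structure StandingAssumptions {d : ℕ} {Ω : Type*} [MeasurableSpace Ω] (P : Measure Ω)
    (τ : Space d → Ω → Ω) (H : Space d → Space d → Ω → ℝ) : Prop where
  /-- `τ` is a group of measure-preserving transformations. -/
  measurePreserving : ∀ y, MeasurePreserving (τ y) P P
  translation_zero : τ 0 = id
  translation_add : ∀ x y, τ (x + y) = τ x ∘ τ y
  /-- `H` is jointly measurable. -/
  measurable : Measurable fun z : Space d × Space d × Ω => H z.1 z.2.1 z.2.2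
  /-- `H` is stationary. -/
  stationary : ∀ p y z ω, H p y (τ z ω) = H p (y + z) ω
  /-- Finite range of dependence: `dist(V,W) ≥ 1` implies that `𝒢(V)` and `𝒢(W)` are
  independent. -/
  finiteRange : ∀ V W : Set (Space d), MeasurableSet V → MeasurableSet W →
    (∀ x ∈ V, ∀ y ∈ W, 1 ≤ dist x y) → Indep (sigmaAlg H V) (sigmaAlg H W) P
  /-- The family `H(·,·,ω)`, `ω ∈ Ω`, is precompact in `C(B_R × ℝ^d)`, where `C(B_R × ℝ^d)` carries
  the topology of locally uniform convergence. -/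
  precompact : ∀ R : ℝ, 0 < R → ∃ f : Ω → C(Metric.ball (0 : Space d) R × Space d, ℝ),
    (∀ ω z, f ω z = H z.1 z.2 ω) ∧ IsCompact (closure (Set.range f))
  /-- The family `H(·,x,ω)`, `x ∈ ℝ^d`, `ω ∈ Ω`, is bounded in `C^{0,1}(B_R)`. -/
  lipschitz : ∀ R : ℝ, 0 < R → ∃ M : ℝ≥0, ∀ x ω,
    (∀ p ∈ Metric.ball (0 : Space d) R, |H p x ω| ≤ M) ∧
      LipschitzOnWith M (fun p => H p x ω) (Metric.ball 0 R)
  /-- Uniform coercivity. -/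
  coercive : Tendsto (fun p => essInf (H p 0) P) (cocompact (Space d)) atTop
  /-- Strengthened level-set convexity. -/
  levelSetConvex : ∃ Λ : ℝ → ℝ → ℝ,
    (∀ ν, Monotone fun μ => Λ μ ν) ∧ (∀ μ, Monotone fun ν => Λ μ ν) ∧
    (∀ μ ν, Λ μ ν ≤ max μ ν) ∧ (∀ μ ν, ν ≠ μ → Λ μ ν < max μ ν) ∧
    ∀ p q y ω, H ((1 / 2 : ℝ) • (p + q)) y ω ≤ Λ (H p y ω) (H q y ω)
  /-- Every `H(·,y,ω)` is minimal at `p = 0`. -/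
  zero_le : ∀ p y ω, H 0 y ω ≤ H p y ω
  essSup_zero : essSup (H 0 0) P = 0

/-- The continuous function `w` satisfies `F(Dw,y) ≤ μ` in `ℝ^d` in the viscosity sense. -/
def IsViscositySubsolution {d : ℕ} (F : Space d → Space d → ℝ) (μ : ℝ) (w : Space d → ℝ) :
    Prop :=
  ∀ φ : Space d → ℝ, ContDiff ℝ 1 φ → ∀ y, IsLocalMax (fun x => w x - φ x) y →
    F (gradient φ y) y ≤ μ

/-- The solution of the metric problem (the maximal subsolution)
`m_μ(z,x,ω) = sup { w(z) - w(x) : w Lipschitz on ℝ^d, H(Dw,y,ω) ≤ μ in ℝ^d }`. -/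
noncomputable def metricSol {d : ℕ} {Ω : Type*} (H : Space d → Space d → Ω → ℝ) (μ : ℝ)
    (z x : Space d) (ω : Ω) : ℝ :=
  sSup {r | ∃ w : Space d → ℝ, (∃ L : ℝ≥0, LipschitzWith L w) ∧
    IsViscositySubsolution (fun p y => H p y ω) μ w ∧ r = w z - w x}

/-- `mbar` is the deterministic limit of the metric problem at level `μ`:
`lim_{t → ∞} t⁻¹ m_μ(ty,0,ω) = mbar(y)` almost surely. -/
def IsEffectiveMetric {d : ℕ} {Ω : Type*} [MeasurableSpace Ω] (P : Measure Ω)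
    (H : Space d → Space d → Ω → ℝ) (μ : ℝ) (mbar : Space d → ℝ) : Prop :=
  ∀ y, ∀ᵐ ω ∂P, Tendsto (fun t : ℝ => t⁻¹ * metricSol H μ (t • y) 0 ω) atTop (𝓝 (mbar y))

end HJ

/-! The maximal subsolution is a first passage metric. Its local cost in the direction `v` at `u` is
the support function of the sublevel set `{p | H p u ω ≤ μ}`, and the theorem is the fluctuation and
bias estimate of first passage percolation with a finite range of dependence.

Representation (`sSup_subsolution_eq`, `exists_metricSol_eq`). The metric is built from polygonal
chains, where a segment is charged the maximum of the cost along it; short segments make this as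
good as an integral. All cost bounds are strict, hence open conditions: vertices can be moved to a
countable dense set, and the event that a chain inside `V` is cheap depends on `H` in `V` only.
Almost surely the sublevel sets contain a ball of radius `l = μ / M` and lie in a ball of radius
`L`; the truncation `costField` makes this hold for every `ω`.

Concentration (`hasSubgaussianMGF_chainDist`). Explore the region reached from the origin at cost
less than `t = 0, l, 2l, …`, recorded as a finite union of unit balls. The event that this region
equals a given `A` is decided by `H` inside `A`, so the region behaves as a stopping time. The cost
of going from the region to `y`, ignoring the medium within distance one of it, is independent of
the explored medium. Hence the truncated cost plus the mean of that remaining cost tracks the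
conditional expectation of the passage cost up to a multiple of `L`, and changes by at most a
multiple of `L` per step. There are about `L‖y‖ / l` steps, and Azuma's inequality gives Gaussian
tails of variance of order `‖y‖ / μ`.

Bias (`sub_limit_le`). By concentration and a union bound over a net, the mean cost `f` is almost
superadditive across hyperplanes (`crossing`): a cheap chain to a point beyond a doubled half-space
must cross the middle, and both halves cost nearly their means. If `y` were not nearly a convex
combination of points where `f` is at most slightly above the limit `mb y`, a separating hyperplane
and repeated doubling would make the limit exceed itself. So `N • y` is almost a sum of such points,
which bounds `f (N • y) - mb (N • y)`; optimizing `N` gives the power `2/3`.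

The lower tail needs no bias estimate, since subadditivity gives `mb ≤ f`. For the upper tail the
condition on `λ` makes the bias at most `λ / 2`. -/

namespace HJ

/-! ### Polygonal chains and the chain metric of a set-valued field -/

section Chain

variable {E : Type*} [NormedAddCommGroup E] [InnerProductSpace ℝ E]

/-- The cost of the segment from `x` to `y`, for the set-valued field `C`, is less than `b`. -/
def SegLt (C : E → Set E) (x y : E) (b : ℝ) : Prop :=
  ∀ u ∈ segment ℝ x y, ∀ p ∈ C u, inner ℝ p (y - x) < b

/-- `Reach C V x z b`: a polygonal chain inside `V` leads from `x` to `z` at cost less than `b`. -/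
inductive Reach (C : E → Set E) (V : Set E) (x : E) : E → ℝ → Prop
  | refl {b : ℝ} (hx : x ∈ V) (hb : 0 < b) : Reach C V x x b
  | step {y z : E} {a b : ℝ} (h : Reach C V x y a) (hV : segment ℝ y z ⊆ V)
      (hs : SegLt C y z b) : Reach C V x z (a + b)

/-- A field of sets containing the origin, contained in the ball of radius `L`, of closed graph. -/
structure IsCostField (C : E → Set E) (L : ℝ) : Prop where
  zero_mem : ∀ u, 0 ∈ C u
  norm_le : ∀ u, ∀ p ∈ C u, ‖p‖ ≤ L
  isClosed_graph : IsClosed {z : E × E | z.2 ∈ C z.1}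

variable {C C' : E → Set E} {V W : Set E} {x y z : E} {a b L l : ℝ}

omit [InnerProductSpace ℝ E] in
theorem IsCostField.nonneg (hC : IsCostField C L) : 0 ≤ L :=
  (norm_nonneg _).trans (hC.norm_le 0 0 (hC.zero_mem 0))

theorem SegLt.mono (h : SegLt C x y a) (hab : a ≤ b) : SegLt C x y b :=
  fun u hu p hp => (h u hu p hp).trans_le hab

theorem SegLt.pos (hC : ∀ u, 0 ∈ C u) (h : SegLt C x y b) : 0 < b := by
  simpa using h x (left_mem_segment ℝ x y) 0 (hC x)

theorem segLt_of_norm (hC : ∀ u, ∀ p ∈ C u, ‖p‖ ≤ L) (h : L * ‖y - x‖ < b) : SegLt C x y b :=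
  fun u _ p hp => ((real_inner_le_norm p (y - x)).trans
    (mul_le_mul_of_nonneg_right (hC u p hp) (norm_nonneg _))).trans_lt h

theorem SegLt.norm_lt (hl : 0 ≤ l) (hC : ∀ u p, ‖p‖ ≤ l → p ∈ C u) (h : SegLt C x y b) :
    l * ‖y - x‖ < b := by
  have hx := left_mem_segment ℝ x y
  by_cases hxy : y - x = 0
  · simpa [hxy] using h x hx 0 (hC x 0 (by simpa using hl))
  · have hn : ‖y - x‖ ≠ 0 := norm_ne_zero_iff.2 hxy
    have := h x hx ((l / ‖y - x‖) • (y - x)) (hC _ _ (by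
      rw [norm_smul, norm_div, norm_norm, div_mul_cancel₀ _ hn, Real.norm_of_nonneg hl]))
    rw [real_inner_smul_left, real_inner_self_eq_norm_sq] at this
    calc l * ‖y - x‖ = l / ‖y - x‖ * ‖y - x‖ ^ 2 := by field_simp
      _ < b := this

theorem SegLt.left {s : ℝ} (h : SegLt C x y b) (hs : 0 < s) (hs1 : s ≤ 1) :
    SegLt C x (AffineMap.lineMap x y s) (s * b) := by
  intro u hu p hp
  have hmem : AffineMap.lineMap x y s ∈ segment ℝ x y := by
    rw [segment_eq_image_lineMap]; exact ⟨s, ⟨hs.le, hs1⟩, rfl⟩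
  have := h u ((convex_segment x y).segment_subset (left_mem_segment ℝ x y) hmem hu) p hp
  have e : AffineMap.lineMap x y s - x = s • (y - x) := by
    simp [AffineMap.lineMap_apply]
  rw [e, real_inner_smul_right]
  exact mul_lt_mul_of_pos_left this hs

theorem SegLt.right {s : ℝ} (h : SegLt C x y b) (hs : 0 ≤ s) (hs1 : s < 1) :
    SegLt C (AffineMap.lineMap x y s) y ((1 - s) * b) := by
  intro u hu p hp
  have hmem : AffineMap.lineMap x y s ∈ segment ℝ x y := by
    rw [segment_eq_image_lineMap]; exact ⟨s, ⟨hs, hs1.le⟩, rfl⟩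
  have := h u ((convex_segment x y).segment_subset hmem (right_mem_segment ℝ x y) hu) p hp
  have e : y - AffineMap.lineMap x y s = (1 - s) • (y - x) := by
    rw [AffineMap.lineMap_apply, vsub_eq_sub, vadd_eq_add]; module
  rw [e, real_inner_smul_right]
  exact mul_lt_mul_of_pos_left this (by linarith)

theorem SegLt.mono_field (h : SegLt C x y b) (hV : segment ℝ x y ⊆ V)
    (hC : ∀ u ∈ V, C' u ⊆ C u) : SegLt C' x y b :=
  fun u hu p hp => h u hu p (hC u (hV hu) hp)

/-- Strict segment costs are an open condition. -/
theorem isOpen_segLt [ProperSpace E] (hC : IsCostField C L) (b : ℝ) :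
    IsOpen {q : E × E | SegLt C q.1 q.2 b} := by
  rw [← isClosed_compl_iff]
  let K := {k : ℝ × E | k ∈ Set.Icc (0 : ℝ) 1 ×ˢ Metric.closedBall (0 : E) L}
  have hK : IsCompact K := isCompact_Icc.prod (isCompact_closedBall 0 L)
  have : CompactSpace K := isCompact_iff_compactSpace.1 hK
  -- The pairs of endpoints at which the bound fails form the projection of a closed set along the
  -- compact set of parameters and momenta, so they are closed.
  let T : Set ((E × E) × K) := {q | q.2.1.2 ∈ C (q.1.1 + q.2.1.1 • (q.1.2 - q.1.1)) ∧
    b ≤ inner ℝ q.2.1.2 (q.1.2 - q.1.1)}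
  have hT : IsClosed T := by
    refine IsClosed.inter ?_ ?_
    · have : Continuous fun q : (E × E) × K =>
          (q.1.1 + q.2.1.1 • (q.1.2 - q.1.1), q.2.1.2) := by fun_prop
      exact hC.isClosed_graph.preimage this
    · have : Continuous fun q : (E × E) × K => inner ℝ q.2.1.2 (q.1.2 - q.1.1) := by fun_prop
      exact isClosed_le continuous_const this
  have := isClosedMap_fst_of_compactSpace (X := E × E) (Y := K) T hT
  convert this using 1
  ext ⟨x, y⟩
  simp only [Set.mem_compl_iff, Set.mem_ofPred_eq, SegLt, not_forall, not_lt, Set.mem_image,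
    Prod.exists, Subtype.exists, exists_and_right, exists_eq_right]
  constructor
  · rintro ⟨u, hu, p, hp, hb⟩
    rw [segment_eq_image'] at hu
    obtain ⟨s, hs, rfl⟩ := hu
    exact ⟨s, p, ⟨hs, by simpa using hC.norm_le _ p hp⟩, hp, hb⟩
  · rintro ⟨s, p, hK, hp, hb⟩
    refine ⟨x + s • (y - x), ?_, p, hp, hb⟩
    rw [segment_eq_image']
    exact ⟨s, hK.1, rfl⟩

theorem Reach.target_mem (h : Reach C V x z b) : z ∈ V := by
  cases h with
  | refl hx _ => exact hx
  | step _ hV _ => exact hV (right_mem_segment ℝ _ _)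

theorem Reach.pos (hC : ∀ u, 0 ∈ C u) (h : Reach C V x z b) : 0 < b := by
  induction h with
  | refl _ hb => exact hb
  | step _ _ hs ih => exact add_pos ih (hs.pos hC)

theorem Reach.mono (h : Reach C V x z a) (hab : a ≤ b) : Reach C V x z b := by
  cases h with
  | refl hx hb => exact .refl hx (hb.trans_le hab)
  | @step y _ a' b' h hV hs =>
    have := Reach.step h hV (hs.mono (show b' ≤ b - a' by linarith))
    rwa [add_sub_cancel] at this

theorem Reach.mono_set (h : Reach C V x z a) (hVW : V ⊆ W) : Reach C W x z a := by
  induction h with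
  | refl hx hb => exact .refl (hVW hx) hb
  | step _ hV hs ih => exact .step ih (hV.trans hVW) hs

theorem Reach.mono_field (h : Reach C V x z a) (hC : ∀ u ∈ V, C' u ⊆ C u) :
    Reach C' V x z a := by
  induction h with
  | refl hx hb => exact .refl hx hb
  | step _ hV hs ih => exact .step ih hV (hs.mono_field hV hC)

theorem Reach.trans (h : Reach C V x y a) (h' : Reach C V y z b) : Reach C V x z (a + b) := by
  induction h' with
  | refl _ hb => exact h.mono (by linarith)
  | step _ hV hs ih => rw [← add_assoc]; exact .step ih hV hs

theorem Reach.prefix_segment (hC : ∀ u, 0 ∈ C u) (h : Reach C V x y a) (hs : SegLt C y z b) {u : E}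
    (hu : u ∈ segment ℝ y z) (hV : segment ℝ y u ⊆ V) : Reach C V x u (a + b) := by
  rw [segment_eq_image_lineMap] at hu
  obtain ⟨s, hs01, rfl⟩ := hu
  have hb := hs.pos hC
  rcases hs01.1.eq_or_lt with rfl | h0
  · simpa using h.mono (by linarith)
  · exact (Reach.step h hV (hs.left h0 hs01.2)).mono (by nlinarith [hs01.2])

theorem reach_of_norm (hC : ∀ u, ∀ p ∈ C u, ‖p‖ ≤ L) (hL : 0 ≤ L) (hV : segment ℝ x z ⊆ V)
    (h : L * ‖z - x‖ < b) : Reach C V x z b := by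
  obtain ⟨c, hc, hcb⟩ := exists_between h
  have h0 : 0 ≤ L * ‖z - x‖ := by positivity
  have := Reach.step (.refl (hV (left_mem_segment ℝ x z)) (sub_pos.2 hcb)) hV
    (segLt_of_norm hC hc)
  simpa using this

theorem Reach.norm_lt (hl : 0 ≤ l) (hC : ∀ u p, ‖p‖ ≤ l → p ∈ C u) (h : Reach C V x z b) :
    l * ‖z - x‖ < b := by
  induction h with
  | refl _ hb => simpa using hb
  | @step y z a b _ _ hs ih =>
    have h1 := hs.norm_lt hl hC
    have h2 : ‖z - x‖ ≤ ‖y - x‖ + ‖z - y‖ := by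
      rw [add_comm]; exact norm_sub_le_norm_sub_add_norm_sub z y x
    nlinarith

/-- A chain that ends outside the closed set `F` splits at its last visit to `F`. -/
theorem Reach.lastExit {F : Set E} (hF : IsClosed F) (hx : x ∈ F)
    (h : Reach C V x z b) (hz : z ∉ F) {ε : ℝ} (hε : 0 < ε) :
    ∃ u ∈ F, u ∈ closure Fᶜ ∧ ∃ a₁ a₂, a₁ + a₂ ≤ b + ε ∧ Reach C V x u a₁ ∧
      Reach C (V ∩ closure Fᶜ) u z a₂ := by
  induction h with
  | refl _ _ => exact absurd hx hz
  | @step y z a b h hV hs ih =>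
    by_cases hseg : ∀ w ∈ segment ℝ y z, w ∉ F
    · obtain ⟨u, hu, huc, a₁, a₂, hab, h1, h2⟩ := ih (hseg y (left_mem_segment ℝ y z))
      refine ⟨u, hu, huc, a₁, a₂ + b, by linarith, h1, .step h2 ?_ hs⟩
      exact fun w hw => ⟨hV hw, subset_closure (hseg w hw)⟩
    · push Not at hseg
      obtain ⟨w, hw, hwF⟩ := hseg
      rw [segment_eq_image_lineMap] at hw
      obtain ⟨s₀, hs₀, rfl⟩ := hw
      have hcont : Continuous fun s : ℝ => (AffineMap.lineMap y z s : E) :=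
        AffineMap.lineMap_continuous
      have hcomp : IsCompact (Set.Icc (0 : ℝ) 1 ∩ (fun s => AffineMap.lineMap y z s) ⁻¹' F) :=
        isCompact_Icc.inter_right (hF.preimage hcont)
      -- The last visit to `F` on the final segment. Beyond this parameter the segment lies in the
      -- complement, so the whole remaining piece lies in its closure.
      obtain ⟨s, ⟨hs01, hsF⟩, hmax⟩ := hcomp.exists_isGreatest ⟨s₀, hs₀, hwF⟩
      have hs1 : s < 1 := by
        refine lt_of_le_of_ne hs01.2 ?_
        rintro rfl
        exact hz (by simpa using hsF)
      have hgt : ∀ r ∈ Set.Ioc s 1, (AffineMap.lineMap y z r : E) ∈ Fᶜ := fun r hr hrF =>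
        absurd (hmax ⟨⟨hs01.1.trans hr.1.le, hr.2⟩, hrF⟩) (not_le.2 hr.1)
      have hIcc : ∀ r ∈ Set.Icc s 1, (AffineMap.lineMap y z r : E) ∈ closure Fᶜ := by
        intro r hr
        have : Set.Icc s 1 ⊆ (fun r : ℝ => (AffineMap.lineMap y z r : E)) ⁻¹' closure Fᶜ := by
          rw [← closure_Ioc hs1.ne]
          exact closure_minimal (fun r hr => subset_closure (hgt r hr))
            (isClosed_closure.preimage hcont)
        exact this hr
      have hsub : segment ℝ (AffineMap.lineMap y z s : E) z ⊆ V ∩ closure Fᶜ := by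
        have e : segment ℝ (AffineMap.lineMap y z s : E) z =
            (fun r : ℝ => (AffineMap.lineMap y z r : E)) '' Set.Icc s 1 := by
          have := image_segment (𝕜 := ℝ) (AffineMap.lineMap y z : ℝ →ᵃ[ℝ] E) s 1
          rw [segment_eq_Icc hs1.le, AffineMap.lineMap_apply_one] at this
          exact this.symm
        rw [e]
        rintro _ ⟨r, hr, rfl⟩
        refine ⟨hV ?_, hIcc r hr⟩
        rw [segment_eq_image_lineMap]
        exact ⟨r, ⟨hs01.1.trans hr.1, hr.2⟩, rfl⟩
      -- A chain must start with a positive cost; the allowance `ε` pays for starting the second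
      -- chain.
      have hlast : Reach C (V ∩ closure Fᶜ) (AffineMap.lineMap y z s) z (ε + (1 - s) * b) :=
        .step (.refl (hsub (left_mem_segment ℝ _ _)) hε) hsub (hs.right hs01.1 hs1)
      -- For `s = 0` the initial piece is degenerate and its strict cost bound would read `0 < 0`,
      -- so the first chain simply ends at `y`.
      rcases hs01.1.eq_or_lt with rfl | hs0
      · refine ⟨_, hsF, hIcc _ ⟨le_rfl, hs1.le⟩, a, _, by linarith, ?_, hlast⟩
        simpa using h
      · refine ⟨_, hsF, hIcc _ ⟨le_rfl, hs1.le⟩, a + s * b, _, by linarith, ?_, hlast⟩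
        refine .step h (Set.Subset.trans ?_ hV) (hs.left hs0 hs1.le)
        refine (convex_segment y z).segment_subset (left_mem_segment ℝ y z) ?_
        rw [segment_eq_image_lineMap]
        exact ⟨s, hs01, rfl⟩

/-- The chain metric of the field `C`. -/
noncomputable def chainDist (C : E → Set E) (x z : E) : ℝ :=
  sInf {b | Reach C Set.univ x z b}

theorem bddBelow_reach (hC : ∀ u, 0 ∈ C u) : BddBelow {b | Reach C V x z b} :=
  ⟨0, fun _ h => (Reach.pos hC h).le⟩

namespace IsCostField

variable (hC : IsCostField C L)
include hC

theorem reach_nonempty (x z : E) : {b | Reach C Set.univ x z b}.Nonempty :=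
  ⟨_, reach_of_norm hC.norm_le hC.nonneg (Set.subset_univ _) (lt_add_one _)⟩

theorem chainDist_le (h : Reach C Set.univ x z b) : chainDist C x z ≤ b :=
  csInf_le (bddBelow_reach hC.zero_mem) h

theorem reach_of_chainDist_lt (h : chainDist C x z < b) : Reach C Set.univ x z b := by
  obtain ⟨a, ha, hab⟩ := exists_lt_of_csInf_lt (hC.reach_nonempty x z) h
  exact Reach.mono ha hab.le

theorem chainDist_lt_iff : chainDist C x z < b ↔ ∃ a < b, Reach C Set.univ x z a := by
  constructor
  · intro h
    obtain ⟨a, ha, hab⟩ := exists_lt_of_csInf_lt (hC.reach_nonempty x z) h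
    exact ⟨a, hab, ha⟩
  · rintro ⟨a, ha, h⟩
    exact (hC.chainDist_le h).trans_lt ha

theorem chainDist_nonneg (x z : E) : 0 ≤ chainDist C x z :=
  le_csInf (hC.reach_nonempty x z) fun _ h => (Reach.pos hC.zero_mem h).le

theorem chainDist_le_norm (x z : E) : chainDist C x z ≤ L * ‖z - x‖ :=
  le_of_forall_gt fun _ h =>
    lt_of_lt_of_le (hC.chainDist_lt_iff.2 (by
      obtain ⟨c, hc, hcb⟩ := exists_between h
      exact ⟨c, hcb, reach_of_norm hC.norm_le hC.nonneg (Set.subset_univ _) hc⟩)) le_rfl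

theorem chainDist_self (x : E) : chainDist C x x = 0 :=
  le_antisymm (by simpa using hC.chainDist_le_norm x x) (hC.chainDist_nonneg x x)

theorem chainDist_triangle (x y z : E) :
    chainDist C x z ≤ chainDist C x y + chainDist C y z := by
  refine le_of_forall_pos_le_add fun ε hε => ?_
  have h1 := hC.reach_of_chainDist_lt (lt_add_of_pos_right (chainDist C x y) (half_pos hε))
  have h2 := hC.reach_of_chainDist_lt (lt_add_of_pos_right (chainDist C y z) (half_pos hε))
  have := hC.chainDist_le (h1.trans h2)
  linarith

theorem norm_le_chainDist (hl : 0 ≤ l) (hCl : ∀ u p, ‖p‖ ≤ l → p ∈ C u) (x z : E) :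
    l * ‖z - x‖ ≤ chainDist C x z :=
  le_csInf (hC.reach_nonempty x z) fun _ h => (Reach.norm_lt hl hCl h).le

theorem lipschitz_chainDist (x : E) : LipschitzWith L.toNNReal (chainDist C x) := by
  refine LipschitzWith.of_le_add_mul _ fun y z => ?_
  rw [Real.coe_toNNReal _ hC.nonneg, dist_eq_norm]
  have := hC.chainDist_triangle x z y
  have := hC.chainDist_le_norm z y
  linarith

theorem continuous_chainDist (x : E) : Continuous (chainDist C x) :=
  (hC.lipschitz_chainDist x).continuous

end IsCostField

end Chain

/-! ### The maximal subsolution is the chain metric -/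

section Representation

/-- Upper semicontinuity of the support function in the base point: the graph is closed and the
momenta stay in a compact ball, so the points where the bound fails are a closed projection. -/
theorem isOpen_forall_inner_lt {E : Type*} [NormedAddCommGroup E] [InnerProductSpace ℝ E]
    [ProperSpace E] {C : E → Set E} {L : ℝ} (hC : IsCostField C L) (v : E) (b : ℝ) :
    IsOpen {u | ∀ p ∈ C u, inner ℝ v p < b} := by
  rw [← isClosed_compl_iff]
  let K := {k : E | k ∈ Metric.closedBall (0 : E) L}
  have hK : IsCompact K := isCompact_closedBall 0 L
  have : CompactSpace K := isCompact_iff_compactSpace.1 hK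
  let T : Set (E × K) := {q | q.2.1 ∈ C q.1 ∧ b ≤ inner ℝ v q.2.1}
  have hT : IsClosed T := by
    refine IsClosed.inter ?_ ?_
    · have : Continuous fun q : E × K => (q.1, q.2.1) := by fun_prop
      exact hC.isClosed_graph.preimage this
    · have : Continuous fun q : E × K => inner ℝ v q.2.1 := by fun_prop
      exact isClosed_le continuous_const this
  have := isClosedMap_fst_of_compactSpace (X := E) (Y := K) T hT
  convert this using 1
  ext u
  simp only [Set.mem_compl_iff, Set.mem_ofPred_eq, not_forall, not_lt, Set.mem_image,
    Prod.exists, Subtype.exists, exists_and_right, exists_eq_right]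
  constructor
  · rintro ⟨p, hp, hb⟩
    exact ⟨p, by simpa [K] using hC.norm_le _ p hp, hp, hb⟩
  · rintro ⟨p, _, hp, hb⟩
    exact ⟨p, hp, hb⟩

variable {d : ℕ} {C : Space d → Set (Space d)} {L μ : ℝ} {F : Space d → Space d → ℝ}

theorem contDiff_quadratic (a : Space d) (c : ℝ) : ContDiff ℝ 1 fun y => c * ‖y - a‖ ^ 2 :=
  contDiff_const.mul ((contDiff_id.sub contDiff_const).norm_sq ℝ)

theorem gradient_quadratic (a y : Space d) (c : ℝ) :
    gradient (fun y => c * ‖y - a‖ ^ 2) y = (2 * c) • (y - a) := by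
  refine HasGradientAt.gradient ?_
  rw [hasGradientAt_iff_hasFDerivAt]
  have h := (((hasFDerivAt_id y).sub_const a).norm_sq).const_mul c
  have e : InnerProductSpace.toDual ℝ (Space d) ((2 * c) • (y - a)) =
      c • 2 • (innerSL ℝ) (id y - a) ∘SL ContinuousLinearMap.id ℝ (Space d) := by
    ext v
    simp only [map_smul, smul_apply, InnerProductSpace.toDual_apply_apply,
      ContinuousLinearMap.comp_id, innerSL_apply_apply, id, smul_eq_mul, nsmul_eq_mul]
    push_cast
    ring
  rw [e]
  exact h

/-- Doubling of variables along a segment: a maximum point of the penalized function. -/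
theorem exists_penalized_max {w : Space d → ℝ} {A : ℝ≥0} (hw : LipschitzWith A w) (x v : Space d)
    {b ε : ℝ} (hb : 0 ≤ b) (hε : 0 < ε) :
    ∃ y : Space d, ∃ s ∈ Set.Icc (0 : ℝ) 1, ∀ y' : Space d, ∀ s' ∈ Set.Icc (0 : ℝ) 1,
      w y' - (2 * ε)⁻¹ * ‖y' - (x + s' • v)‖ ^ 2 - b * s' ≤
        w y - (2 * ε)⁻¹ * ‖y - (x + s • v)‖ ^ 2 - b * s := by
  set Φ : Space d × ℝ → ℝ := fun q => w q.1 - (2 * ε)⁻¹ * ‖q.1 - (x + q.2 • v)‖ ^ 2 - b * q.2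
  have hΦ : Continuous Φ := by
    have := hw.continuous
    fun_prop
  -- Outside the ball of this radius the quadratic penalty exceeds the Lipschitz growth of `w`, so
  -- the value there is below the value at `(x, 0)`.
  set R : ℝ := 2 * ‖v‖ + 4 * ε * A + 1
  have hR : 0 ≤ R := by positivity
  have hcomp : IsCompact (Metric.closedBall x R ×ˢ Set.Icc (0 : ℝ) 1) :=
    (isCompact_closedBall x R).prod isCompact_Icc
  obtain ⟨⟨y, s⟩, ⟨hy, hs⟩, hmax⟩ := hcomp.exists_isMaxOn
    ⟨(x, 0), Metric.mem_closedBall_self hR, by simp⟩ hΦ.continuousOn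
  refine ⟨y, s, hs, fun y' s' hs' => ?_⟩
  by_cases hy' : y' ∈ Metric.closedBall x R
  · exact hmax (Set.mk_mem_prod hy' hs')
  · have h0 : Φ (x, 0) ≤ Φ (y, s) := hmax
      (Set.mk_mem_prod (Metric.mem_closedBall_self hR) (by simp))
    refine le_trans ?_ h0
    simp only [Φ, zero_smul, add_zero, sub_self, norm_zero, mul_zero, sub_zero]
    rw [Metric.mem_closedBall, not_le, dist_eq_norm] at hy'
    have h1 : w y' - w x ≤ A * ‖y' - x‖ := by
      have := hw.dist_le_mul y' x
      rw [Real.dist_eq, dist_eq_norm] at this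
      exact (le_abs_self _).trans this
    have h2 : ‖y' - x‖ - ‖v‖ ≤ ‖y' - (x + s' • v)‖ := by
      have e : y' - x = (y' - (x + s' • v)) + s' • v := by abel
      have : ‖y' - x‖ ≤ ‖y' - (x + s' • v)‖ + ‖s' • v‖ := by
        rw [e]; exact norm_add_le _ _
      have h3 : ‖s' • v‖ ≤ ‖v‖ := by
        rw [norm_smul, Real.norm_of_nonneg hs'.1]
        exact mul_le_of_le_one_left (norm_nonneg _) hs'.2
      linarith
    set q := ‖y' - x‖ - ‖v‖ with hq
    have hA : (0 : ℝ) ≤ A := A.2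
    have hqv : ‖v‖ + 4 * ε * A < q := by simp only [hq]; linarith
    have hq0 : 0 < q := lt_of_le_of_lt (by positivity) hqv
    have hsq : q ^ 2 ≤ ‖y' - (x + s' • v)‖ ^ 2 := pow_le_pow_left₀ hq0.le h2 2
    have h4 : A * ‖y' - x‖ ≤ (2 * ε)⁻¹ * q ^ 2 := by
      rw [inv_mul_eq_div, le_div_iff₀ (by positivity)]
      have e : ‖y' - x‖ = q + ‖v‖ := by simp [hq]
      have hv := norm_nonneg v
      rw [e]
      have h5 : 4 * ε * A * q ≤ q * q :=
        mul_le_mul_of_nonneg_right (by linarith) hq0.le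
      have h6 : ε * A * ‖v‖ ≤ ε * A * q := mul_le_mul_of_nonneg_left
        (by have : 0 ≤ 4 * ε * A := by positivity
            linarith) (by positivity)
      nlinarith
    have h5 : (2 * ε)⁻¹ * q ^ 2 ≤ (2 * ε)⁻¹ * ‖y' - (x + s' • v)‖ ^ 2 :=
      mul_le_mul_of_nonneg_left hsq (by positivity)
    have h6 := mul_nonneg hb hs'.1
    linarith

/-- A Lipschitz subsolution grows at most by the cost along a segment. -/
theorem IsViscositySubsolution.sub_le (hC : IsCostField C L) (hF : ∀ u p, F p u ≤ μ → p ∈ C u)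
    {w : Space d → ℝ} {A : ℝ≥0} (hw : LipschitzWith A w) (hsub : IsViscositySubsolution F μ w)
    {x z : Space d} {b : ℝ} (h : SegLt C x z b) : w z - w x ≤ b := by
  by_contra! hcon
  have hb := h.pos hC.zero_mem
  set v := z - x with hv
  have hL := hC.nonneg
  -- At a maximum point `(y, s)` the momentum is `p = (y - (x + s • v)) / ε`. The subsolution
  -- property puts it in `C y`, and optimality in `s` gives `b ≤ ⟪p, v⟫`. Letting `ε → 0`
  -- contradicts the strict cost bound on the segment.
  have key : ∀ ε : ℝ, 0 < ε → A * L * ε < w z - w x - b →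
      ∃ s ∈ Set.Icc (0 : ℝ) 1, ∃ p ∈ C (x + s • v + ε • p), b ≤ inner ℝ p v := by
    intro ε hε hεb
    obtain ⟨y, s, hs, hmax⟩ := exists_penalized_max hw x v hb.le hε
    set e := y - (x + s • v) with he
    have hp : ε⁻¹ • e ∈ C y := by
      apply hF
      have := hsub (fun y' => (2 * ε)⁻¹ * ‖y' - (x + s • v)‖ ^ 2) (contDiff_quadratic _ _) y
        (Eventually.of_forall fun y' => by
          have := hmax y' s hs
          simp only at this ⊢
          linarith)
      rw [gradient_quadratic] at this
      convert this using 2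
      rw [← he]
      congr 1
      field_simp
    have hyeq : x + s • v + ε • ε⁻¹ • e = y := by
      rw [smul_inv_smul₀ hε.ne', he]; abel
    refine ⟨s, hs, ε⁻¹ • e, by rwa [hyeq], ?_⟩
    -- A maximum at `s = 0` is impossible: comparing with `(z, 1)` gives `w z - b ≤ w y ≤ w x + A *
    -- L * ε`, against the choice of `ε`.
    rcases hs.1.eq_or_lt with rfl | hs0
    · exfalso
      have h1 := hmax z 1 (by simp)
      have e1 : z - (x + (1 : ℝ) • v) = 0 := by rw [hv]; module
      rw [e1] at h1
      have e2 : e = y - x := by simp [he]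
      have h2 : w y - w x ≤ A * ‖y - x‖ := by
        have := hw.dist_le_mul y x
        rw [Real.dist_eq, dist_eq_norm] at this
        exact (le_abs_self _).trans this
      have h3 : ‖y - x‖ ≤ L * ε := by
        have := hC.norm_le _ _ hp
        rw [norm_smul, norm_inv, Real.norm_of_nonneg hε.le, inv_mul_le_iff₀ hε, e2] at this
        linarith
      have h4 : (A : ℝ) * ‖y - x‖ ≤ A * (L * ε) := mul_le_mul_of_nonneg_left h3 A.2
      have h5 : 0 ≤ (2 * ε)⁻¹ * ‖e‖ ^ 2 := by positivity
      simp only [norm_zero] at h1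
      nlinarith
    -- Only decreasing `s` is always allowed, since `s = 1` may occur; the one-sided difference
    -- quotient has the required sign.
    · have hstep : ∀ t ∈ Set.Ioc (0 : ℝ) s, b ≤ inner ℝ (ε⁻¹ • e) v + t * (‖v‖ ^ 2 / (2 * ε)) := by
        intro t ht
        have h1 := hmax y (s - t) ⟨by linarith [ht.2], by linarith [hs.2, ht.1]⟩
        have e1 : y - (x + (s - t) • v) = e + t • v := by rw [he]; module
        rw [e1, norm_add_sq_real, real_inner_smul_right, norm_smul,
          Real.norm_of_nonneg ht.1.le] at h1
        rw [real_inner_smul_left]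
        have h2 : b * t ≤ (2 * ε)⁻¹ * (2 * (t * inner ℝ e v) + (t * ‖v‖) ^ 2) := by linarith
        have h3 : (2 * ε)⁻¹ * (2 * (t * inner ℝ e v) + (t * ‖v‖) ^ 2) =
            (ε⁻¹ * inner ℝ e v + t * (‖v‖ ^ 2 / (2 * ε))) * t := by
          field_simp
        rw [h3] at h2
        exact le_of_mul_le_mul_right h2 ht.1
      have hlim : Tendsto (fun t : ℝ => inner ℝ (ε⁻¹ • e) v + t * (‖v‖ ^ 2 / (2 * ε)))
          (𝓝[>] 0) (𝓝 (inner ℝ (ε⁻¹ • e) v)) := by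
        have : Continuous fun t : ℝ => inner ℝ (ε⁻¹ • e) v + t * (‖v‖ ^ 2 / (2 * ε)) := by
          fun_prop
        have h0 := (this.tendsto 0).mono_left (nhdsWithin_le_nhds (s := Set.Ioi 0))
        simpa using h0
      exact ge_of_tendsto hlim (by
        filter_upwards [Ioc_mem_nhdsGT hs0] with t ht using hstep t ht)
  have hδ : 0 < (w z - w x - b) / (A * L + 1) := div_pos (by linarith) (by positivity)
  set δ := (w z - w x - b) / (A * L + 1) with hδdef
  have hε : ∀ n : ℕ, ∃ sp : ℝ × Space d, sp ∈ Set.Icc (0 : ℝ) 1 ×ˢ Metric.closedBall 0 L ∧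
      sp.2 ∈ C (x + sp.1 • v + (δ * (1 / ((n : ℝ) + 1))) • sp.2) ∧ b ≤ inner ℝ sp.2 v := by
    intro n
    have h1 : (1 : ℝ) / ((n : ℝ) + 1) ≤ 1 := by
      rw [div_le_one (by positivity)]; linarith [(Nat.cast_nonneg n : (0 : ℝ) ≤ n)]
    have h2 : (0 : ℝ) < 1 / ((n : ℝ) + 1) := by positivity
    obtain ⟨s, hs, p, hp, hpb⟩ := key (δ * (1 / ((n : ℝ) + 1))) (by positivity) (by
      have h3 : δ * (A * L + 1) = w z - w x - b := by
        rw [hδdef]; field_simp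
      have h4 : (A : ℝ) * L * (δ * (1 / ((n : ℝ) + 1))) ≤ A * L * δ := by
        refine mul_le_mul_of_nonneg_left ?_ (by positivity)
        nlinarith
      nlinarith)
    exact ⟨(s, p), ⟨hs, by simpa using hC.norm_le _ _ hp⟩, hp, hpb⟩
  choose sp hspK hspC hspb using hε
  obtain ⟨⟨s, p⟩, hK, φ, hφ, hlim⟩ :=
    (isCompact_Icc.prod (isCompact_closedBall (0 : Space d) L)).tendsto_subseq hspK
  have hs : Tendsto (fun n => (sp (φ n)).1) atTop (𝓝 s) := (continuous_fst.tendsto _).comp hlim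
  have hp : Tendsto (fun n => (sp (φ n)).2) atTop (𝓝 p) := (continuous_snd.tendsto _).comp hlim
  have hz : Tendsto (fun n => δ * (1 / (((φ n : ℕ) : ℝ) + 1))) atTop (𝓝 0) := by
    simpa using ((tendsto_one_div_add_atTop_nhds_zero_nat (𝕜 := ℝ)).comp
      hφ.tendsto_atTop).const_mul δ
  have hmem : p ∈ C (x + s • v) := by
    have h1 : Tendsto (fun n => (x + (sp (φ n)).1 • v +
        (δ * (1 / (((φ n : ℕ) : ℝ) + 1))) • (sp (φ n)).2, (sp (φ n)).2)) atTop
        (𝓝 (x + s • v, p)) := by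
      have := ((tendsto_const_nhds (x := x)).add (hs.smul_const v)).add (hz.smul hp)
      rw [zero_smul, add_zero] at this
      exact this.prodMk_nhds hp
    exact hC.isClosed_graph.mem_of_tendsto h1 (Eventually.of_forall fun n => hspC (φ n))
  have hpb : b ≤ inner ℝ p v :=
    ge_of_tendsto (hp.inner tendsto_const_nhds) (Eventually.of_forall fun n => hspb (φ n))
  exact absurd (h (x + s • v) (by rw [segment_eq_image']; exact ⟨s, hK.1, rfl⟩) p hmem)
    (not_lt.2 hpb)

theorem IsViscositySubsolution.sub_le_of_reach (hC : IsCostField C L)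
    (hF : ∀ u p, F p u ≤ μ → p ∈ C u) {w : Space d → ℝ} {A : ℝ≥0} (hw : LipschitzWith A w)
    (hsub : IsViscositySubsolution F μ w) {V : Set (Space d)} {x z : Space d} {b : ℝ}
    (h : Reach C V x z b) : w z - w x ≤ b := by
  induction h with
  | refl _ hb => simpa using hb.le
  | step _ _ hs ih =>
    have := hsub.sub_le hC hF hw hs
    linarith

/-- The chain metric is a subsolution in its endpoint. -/
theorem isViscositySubsolution_chainDist (hC : IsCostField C L) (hconv : ∀ u, Convex ℝ (C u))
    (hF : ∀ u, ∀ p ∈ C u, F p u ≤ μ) (x : Space d) :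
    IsViscositySubsolution F μ (chainDist C x) := by
  intro φ hφ y hy
  apply hF
  by_contra hmem
  have hclosed : IsClosed (C y) := by
    have : Continuous fun p : Space d => (y, p) := by fun_prop
    exact hC.isClosed_graph.preimage this
  -- If the gradient of the test function is outside `C y`, a direction `v` separates it. By
  -- semicontinuity, moving from `y - t • v` to `y` costs less than `t * u` for small `t`, while the
  -- local maximum forces `φ` to grow no faster than the metric. Hence `⟪v, ∇φ⟫ ≤ u`, contrary to
  -- the separation.
  obtain ⟨f, u, hfu, huf⟩ := geometric_hahn_banach_closed_point (hconv y) hclosed hmem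
  set v := (InnerProductSpace.toDual ℝ (Space d)).symm f with hv
  have hfv : ∀ p, f p = inner ℝ v p := fun p => by
    rw [hv, InnerProductSpace.toDual_symm_apply]
  have hopen := isOpen_forall_inner_lt hC v u
  have hyo : y ∈ {u' | ∀ p ∈ C u', inner ℝ v p < u} := fun p hp => by
    rw [← hfv]; exact hfu p hp
  obtain ⟨r, hr, hball⟩ := Metric.isOpen_iff.1 hopen y hyo
  have hder : HasDerivAt (fun t : ℝ => φ (y - t • v)) (-(inner ℝ v (gradient φ y))) 0 := by
    have h1 : HasFDerivAt φ (fderiv ℝ φ y) (y - (0 : ℝ) • v) := by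
      simpa using (hφ.differentiable one_ne_zero y).hasFDerivAt
    have h2 : HasDerivAt (fun t : ℝ => y - t • v) (-v) 0 := by
      simpa using ((hasDerivAt_id (0 : ℝ)).smul_const v).const_sub y
    have h3 := h1.comp_hasDerivAt (0 : ℝ) h2
    have e : -(inner ℝ v (gradient φ y)) = fderiv ℝ φ y (-v) := by
      rw [map_neg, real_inner_comm, gradient, InnerProductSpace.toDual_symm_apply]
    rw [e]
    exact h3
  have hslope := hder.tendsto_slope_zero_right
  have hcont : Tendsto (fun t : ℝ => y - t • v) (𝓝[>] 0) (𝓝 y) := by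
    have : Continuous fun t : ℝ => y - t • v := by fun_prop
    simpa using (this.tendsto 0).mono_left (nhdsWithin_le_nhds (s := Set.Ioi 0))
  have hev : ∀ᶠ t : ℝ in 𝓝[>] 0, -u ≤ t⁻¹ • (φ (y - (0 + t) • v) - φ (y - (0 : ℝ) • v)) := by
    filter_upwards [hcont.eventually hy, hcont (Metric.ball_mem_nhds y hr),
      self_mem_nhdsWithin] with t ht hball' ht0
    have ht0 : 0 < t := ht0
    have hseg : SegLt C (y - t • v) y (t * u) := by
      intro u' hu' p hp
      have h1 : u' ∈ Metric.ball y r :=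
        (convex_ball y r).segment_subset hball' (Metric.mem_ball_self hr) hu'
      have h2 := hball h1 p hp
      rw [sub_sub_cancel, real_inner_smul_right, real_inner_comm]
      exact mul_lt_mul_of_pos_left h2 ht0
    have h1 : chainDist C x y ≤ chainDist C x (y - t • v) + t * u := by
      refine (hC.chainDist_triangle x (y - t • v) y).trans ?_
      gcongr
      refine le_of_forall_pos_le_add fun ε hε => ?_
      have := hC.chainDist_le (.step (.refl (Set.mem_univ _) hε) (Set.subset_univ _) hseg)
      linarith
    rw [zero_add, zero_smul, sub_zero, smul_eq_mul, ← div_eq_inv_mul, le_div_iff₀ ht0]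
    linarith
  have hle := ge_of_tendsto hslope hev
  rw [hfv] at huf
  linarith

/-- The supremum over subsolutions is the chain metric. -/
theorem sSup_subsolution_eq (hC : IsCostField C L) (hconv : ∀ u, Convex ℝ (C u))
    (hF : ∀ u p, p ∈ C u ↔ F p u ≤ μ) (x z : Space d) :
    sSup {r | ∃ w : Space d → ℝ, (∃ A : ℝ≥0, LipschitzWith A w) ∧
      IsViscositySubsolution F μ w ∧ r = w z - w x} = chainDist C x z := by
  refine IsGreatest.csSup_eq ⟨⟨chainDist C x, ⟨_, hC.lipschitz_chainDist x⟩,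
    isViscositySubsolution_chainDist hC hconv (fun u p => (hF u p).1) x, ?_⟩, ?_⟩
  · rw [hC.chainDist_self, sub_zero]
  · rintro _ ⟨w, ⟨A, hw⟩, hsub, rfl⟩
    refine le_csInf (hC.reach_nonempty x z) fun b hb => ?_
    exact hsub.sub_le_of_reach hC (fun u p => (hF u p).2) hw hb

end Representation

/-! ### Measurability of chain events by countable approximation -/

section Measurability

variable {E : Type*} [NormedAddCommGroup E] [InnerProductSpace ℝ E] {Ω : Type*}

/-- Chains with intermediate vertices in `Q` and rational intermediate costs. -/
def RatReach (C : E → Set E) (Q V : Set E) : ℕ → E → E → ℝ → Prop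
  | 0, x, z, b => segment ℝ x z ⊆ V ∧ SegLt C x z b
  | n + 1, x, z, b => ∃ y ∈ Q, ∃ c : ℚ, RatReach C Q V n x y c ∧ segment ℝ y z ⊆ V ∧
      SegLt C y z (b - c)

variable {C : E → Set E} {Q V S S' : Set E} {x z : E} {a b L : ℝ}

theorem RatReach.reach {n : ℕ} {ε : ℝ} (hε : 0 < ε) (h : RatReach C Q V n x z b) :
    Reach C V x z (b + ε) := by
  induction n generalizing z b with
  | zero =>
    rw [add_comm]
    exact .step (.refl (h.1 (left_mem_segment ℝ x z)) hε) h.1 h.2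
  | succ n ih =>
    obtain ⟨y, _, c, hy, hV, hs⟩ := h
    have := Reach.step (ih hy) hV hs
    convert this using 1
    ring

theorem eventually_segment_subset (hV : IsOpen V) (h : segment ℝ x z ⊆ V) :
    ∀ᶠ q : E × E in 𝓝 x ×ˢ 𝓝 z, segment ℝ q.1 q.2 ⊆ V := by
  have hcont : Continuous fun q : (E × E) × ℝ => (AffineMap.lineMap q.1.1 q.1.2 q.2 : E) := by
    simp only [AffineMap.lineMap_apply]; fun_prop
  have hK : ∀ s ∈ Set.Icc (0 : ℝ) 1, ∀ᶠ q : (E × E) × ℝ in 𝓝 ((x, z), s),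
      (AffineMap.lineMap q.1.1 q.1.2 q.2 : E) ∈ V := by
    intro s hs
    refine hcont.continuousAt.eventually (hV.mem_nhds (h ?_))
    rw [segment_eq_image_lineMap]
    exact ⟨s, hs, rfl⟩
  have := isCompact_Icc.eventually_forall_of_forall_eventually (x₀ := ((x, z) : E × E))
    (P := fun q s => (AffineMap.lineMap q.1 q.2 s : E) ∈ V) hK
  rw [nhds_prod_eq] at this
  filter_upwards [this] with q hq
  rw [segment_eq_image_lineMap]
  rintro _ ⟨s, hs, rfl⟩
  exact hq s hs

/-- Strict segment costs and containment in an open set are open in both endpoints. So intermediate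
vertices can be moved into `Q` one after the other, with the slack `b - a` absorbing the rounding of
the costs to rationals. -/
theorem Reach.eventually_ratReach [ProperSpace E] (hC : IsCostField C L) (hV : IsOpen V)
    (hQ : Dense Q) (hS : S ⊆ closure (S ∩ Q)) (hx : x ∈ S) (h : Reach C V x z a) (hab : a < b) :
    ∀ᶠ z' in 𝓝 z, ∃ x' ∈ S ∩ Q, ∃ n, RatReach C Q V n x' z' b := by
  induction h generalizing b with
  | @refl a hxV ha =>
    have hb : SegLt C x x b := segLt_of_norm hC.norm_le (by simpa using ha.trans hab)
    have h1 := eventually_segment_subset (x := x) (z := x) hV (by simpa using hxV)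
    have h2 : ∀ᶠ q : E × E in 𝓝 x ×ˢ 𝓝 x, SegLt C q.1 q.2 b := by
      rw [← nhds_prod_eq]
      exact (isOpen_segLt hC b).mem_nhds hb
    obtain ⟨x', hx', hx'S⟩ := ((mem_closure_iff_frequently.1 (hS hx)).and_eventually
      ((h1.and h2).curry)).exists
    filter_upwards [hx'S] with z' hz'
    exact ⟨x', hx', 0, hz'⟩
  | @step y z a c h hVseg hs ih =>
    obtain ⟨r, hr, hrb⟩ := exists_rat_btwn (show a < b - c by linarith)
    have h1 := eventually_segment_subset hV hVseg
    have h2 : ∀ᶠ q : E × E in 𝓝 y ×ˢ 𝓝 z, SegLt C q.1 q.2 (b - r) := by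
      rw [← nhds_prod_eq]
      exact (isOpen_segLt hC _).mem_nhds (hs.mono (by linarith))
    obtain ⟨y', hy'Q, ⟨x', hx', n, hn⟩, hy'⟩ := ((mem_closure_iff_frequently.1
      (hQ y)).and_eventually ((ih hr).and (h1.and h2).curry)).exists
    filter_upwards [hy'] with z' hz'
    exact ⟨x', hx', n + 1, y', hy'Q, r, hn, hz'⟩

theorem exists_reach_iff_ratReach [ProperSpace E] (hC : IsCostField C L) (hV : IsOpen V)
    (hQ : Dense Q) (hS : S ⊆ closure (S ∩ Q)) (hS' : S' ⊆ closure (S' ∩ Q)) :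
    (∃ x ∈ S, ∃ z ∈ S', ∃ a < b, Reach C V x z a) ↔
      ∃ x ∈ S ∩ Q, ∃ z ∈ S' ∩ Q, ∃ c : ℚ, (c : ℝ) < b ∧ ∃ n, RatReach C Q V n x z c := by
  constructor
  · rintro ⟨x, hx, z, hz, a, hab, h⟩
    obtain ⟨c, hac, hcb⟩ := exists_rat_btwn hab
    obtain ⟨z', hz', x', hx', n, hn⟩ := ((mem_closure_iff_frequently.1 (hS' hz)).and_eventually
      (h.eventually_ratReach hC hV hQ hS hx hac)).exists
    exact ⟨x', hx', z', hz', c, hcb, n, hn⟩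
  · rintro ⟨x, hx, z, hz, c, hcb, n, hn⟩
    obtain ⟨a, ha, hab⟩ := exists_between hcb
    refine ⟨x, hx.1, z, hz.1, a, hab, ?_⟩
    simpa using hn.reach (sub_pos.2 ha)

/-- Measurability of segment costs is required only for segments inside `V`; this is what makes the
events local. -/
theorem measurableSet_ratReach {𝒢 : MeasurableSpace Ω} {C : Ω → E → Set E} (hQ : Q.Countable)
    (hseg : ∀ y z b, segment ℝ y z ⊆ V → MeasurableSet {ω | SegLt (C ω) y z b}) (n : ℕ)
    (x z : E) (b : ℝ) : MeasurableSet {ω | RatReach (C ω) Q V n x z b} := by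
  have hseg' : ∀ y z b, MeasurableSet {ω | segment ℝ y z ⊆ V ∧ SegLt (C ω) y z b} := by
    intro y z b
    by_cases h : segment ℝ y z ⊆ V
    · simpa [h] using hseg y z b h
    · simp [h]
  induction n generalizing z b with
  | zero => exact hseg' x z b
  | succ n ih =>
    have : {ω | RatReach (C ω) Q V (n + 1) x z b} = ⋃ y ∈ Q, ⋃ c : ℚ,
        {ω | RatReach (C ω) Q V n x y c} ∩ {ω | segment ℝ y z ⊆ V ∧ SegLt (C ω) y z (b - c)} := by
      ext ω
      simp [RatReach]
    rw [this]
    exact MeasurableSet.biUnion hQ fun y _ => MeasurableSet.iUnion fun c =>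
      (ih y c).inter (hseg' y z _)

theorem measurableSet_exists_reach [ProperSpace E] {𝒢 : MeasurableSpace Ω} {C : Ω → E → Set E}
    (hC : ∀ ω, IsCostField (C ω) L) (hV : IsOpen V)
    (hseg : ∀ y z b, segment ℝ y z ⊆ V → MeasurableSet {ω | SegLt (C ω) y z b})
    (S S' : Set E) (b : ℝ) :
    MeasurableSet {ω | ∃ x ∈ S, ∃ z ∈ S', ∃ a < b, Reach (C ω) V x z a} := by
  obtain ⟨D, hDc, hD⟩ := TopologicalSpace.exists_countable_dense E
  obtain ⟨D₁, hD₁, hD₁c, hS⟩ := (TopologicalSpace.IsSeparable.of_separableSpace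
    S).exists_countable_dense_subset
  obtain ⟨D₂, hD₂, hD₂c, hS'⟩ := (TopologicalSpace.IsSeparable.of_separableSpace
    S').exists_countable_dense_subset
  have hQc : (D ∪ (D₁ ∪ D₂)).Countable := hDc.union (hD₁c.union hD₂c)
  have hQ : Dense (D ∪ (D₁ ∪ D₂)) := hD.mono Set.subset_union_left
  have h1 : S ⊆ closure (S ∩ (D ∪ (D₁ ∪ D₂))) := hS.trans (closure_mono fun x hx =>
    ⟨hD₁ hx, Or.inr (Or.inl hx)⟩)
  have h2 : S' ⊆ closure (S' ∩ (D ∪ (D₁ ∪ D₂))) := hS'.trans (closure_mono fun x hx =>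
    ⟨hD₂ hx, Or.inr (Or.inr hx)⟩)
  generalize D ∪ (D₁ ∪ D₂) = Q at *
  have : {ω | ∃ x ∈ S, ∃ z ∈ S', ∃ a < b, Reach (C ω) V x z a} = ⋃ x ∈ S ∩ Q, ⋃ z ∈ S' ∩ Q,
      ⋃ c : ℚ, ⋃ n : ℕ, {ω | (c : ℝ) < b ∧ RatReach (C ω) Q V n x z c} := by
    ext ω
    rw [Set.mem_ofPred_eq, exists_reach_iff_ratReach (hC ω) hV hQ h1 h2]
    simp only [Set.mem_iUnion, Set.mem_ofPred_eq, exists_prop, exists_and_left]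
  rw [this]
  refine MeasurableSet.biUnion (hQc.mono Set.inter_subset_right) fun x _ =>
    MeasurableSet.biUnion (hQc.mono Set.inter_subset_right) fun z _ =>
    MeasurableSet.iUnion fun c => MeasurableSet.iUnion fun n => ?_
  by_cases h : (c : ℝ) < b
  · simpa [h] using measurableSet_ratReach hQc hseg n x z c
  · simp [h]

/-- On a compact set a continuous strict inequality holds with a uniform margin `1 / (n + 1)`, and
the inequality with margin is closed, so a countable dense subset decides it. -/
theorem measurableSet_forall_lt {X : Type*} [PseudoMetricSpace X] {𝒢 : MeasurableSpace Ω}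
    {K : Set X} (hK : IsCompact K) {g : X → Ω → ℝ} (hg : ∀ s ∈ K, Measurable (g s))
    (hcont : ∀ ω, Continuous fun s => g s ω) (μ : ℝ) :
    MeasurableSet {ω | ∀ s ∈ K, μ < g s ω} := by
  obtain ⟨D, hDK, hDc, hKD⟩ := hK.isSeparable.exists_countable_dense_subset
  have : {ω | ∀ s ∈ K, μ < g s ω} =
      ⋃ n : ℕ, ⋂ s ∈ D, {ω | μ + 1 / ((n : ℝ) + 1) ≤ g s ω} := by
    ext ω
    simp only [Set.mem_ofPred_eq, Set.mem_iUnion, Set.mem_iInter]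
    constructor
    · intro h
      rcases K.eq_empty_or_nonempty with rfl | hne
      · exact ⟨0, fun s hs => absurd (hDK hs) (Set.notMem_empty s)⟩
      · obtain ⟨s₀, hs₀, hmin⟩ := hK.exists_isMinOn hne (hcont ω).continuousOn
        obtain ⟨n, hn⟩ := exists_nat_one_div_lt (sub_pos.2 (h s₀ hs₀))
        refine ⟨n, fun s hs => ?_⟩
        have : g s₀ ω ≤ g s ω := hmin (hDK hs)
        linarith
    · rintro ⟨n, hn⟩ s hs
      have hcl : closure D ⊆ {s | μ + 1 / ((n : ℝ) + 1) ≤ g s ω} :=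
        closure_minimal hn (isClosed_le continuous_const (hcont ω))
      have h1 : μ + 1 / ((n : ℝ) + 1) ≤ g s ω := hcl (hKD hs)
      have h2 : (0 : ℝ) < 1 / ((n : ℝ) + 1) := by positivity
      linarith
  rw [this]
  exact MeasurableSet.iUnion fun n => MeasurableSet.biInter hDc fun s hs =>
    measurableSet_le measurable_const (hg s (hDK hs))

end Measurability

/-! ### The truncated sublevel sets and the σ-algebras that see them -/

section CostField

variable {d : ℕ} {Ω : Type*} {H : Space d → Space d → Ω → ℝ} {μ l L : ℝ} {W : Set (Space d)}

/-- The sublevel sets of `H`, truncated to norms between `l` and `L` on `W` and trivial off `W`. -/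
def costField (H : Space d → Space d → Ω → ℝ) (μ l L : ℝ) (W : Set (Space d)) (ω : Ω)
    (u : Space d) : Set (Space d) :=
  {p | p = 0 ∨ (u ∈ W ∧ (‖p‖ ≤ l ∨ (‖p‖ ≤ L ∧ H p u ω ≤ μ)))}

theorem isCostField_costField (hcont : ∀ ω, Continuous fun z : Space d × Space d => H z.1 z.2 ω)
    (hl : 0 ≤ l) (hlL : l ≤ L) (hW : IsClosed W) (ω : Ω) :
    IsCostField (costField H μ l L W ω) L where
  zero_mem u := Or.inl rfl
  norm_le u p hp := by
    rcases hp with rfl | ⟨_, hp | hp⟩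
    · simpa using hl.trans hlL
    · exact hp.trans hlL
    · exact hp.1
  isClosed_graph := by
    have h1 : IsClosed {z : Space d × Space d | z.2 = 0} :=
      isClosed_eq continuous_snd continuous_const
    have h2 : IsClosed {z : Space d × Space d | z.1 ∈ W} := hW.preimage continuous_fst
    have h3 : IsClosed {z : Space d × Space d | ‖z.2‖ ≤ l} :=
      isClosed_le continuous_snd.norm continuous_const
    have h4 : IsClosed {z : Space d × Space d | ‖z.2‖ ≤ L} :=
      isClosed_le continuous_snd.norm continuous_const
    have h5 : IsClosed {z : Space d × Space d | H z.2 z.1 ω ≤ μ} :=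
      isClosed_le ((hcont ω).comp continuous_swap) continuous_const
    exact h1.union (h2.inter (h3.union (h4.inter h5)))

theorem costField_mono {W W' : Set (Space d)} (h : W ⊆ W') (ω : Ω) (u : Space d) :
    costField H μ l L W ω u ⊆ costField H μ l L W' ω u := by
  rintro p (hp | ⟨hu, hp⟩)
  · exact Or.inl hp
  · exact Or.inr ⟨h hu, hp⟩

theorem costField_subset_of_mem {W W' : Set (Space d)} (ω : Ω) {u : Space d} (hu : u ∈ W') :
    costField H μ l L W ω u ⊆ costField H μ l L W' ω u := by
  rintro p (hp | ⟨_, hp⟩)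
  · exact Or.inl hp
  · exact Or.inr ⟨hu, hp⟩

theorem mem_costField_of_norm_le (ω : Ω) (u p : Space d) (hp : ‖p‖ ≤ l) :
    p ∈ costField H μ l L Set.univ ω u :=
  Or.inr ⟨Set.mem_univ u, Or.inl hp⟩

theorem measurable_sigmaAlg {V : Set (Space d)} {u : Space d} (hu : u ∈ V) (p : Space d) :
    Measurable[sigmaAlg H V] (H p u) := by
  have h : MeasurableSpace.comap (H p u) (borel ℝ) ≤ sigmaAlg H V :=
    le_iSup_of_le p (le_iSup_of_le u (le_iSup_of_le hu le_rfl))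
  refine Measurable.mono (ma := MeasurableSpace.comap (H p u) (borel ℝ)) ?_ h le_rfl
  rw [← BorelSpace.measurable_eq (α := ℝ)]
  exact comap_measurable _

theorem sigmaAlg_mono {V V' : Set (Space d)} (h : V ⊆ V') : sigmaAlg H V ≤ sigmaAlg H V' :=
  iSup_mono fun _ => iSup_mono fun _ => iSup_mono' fun hx => ⟨h hx, le_rfl⟩

theorem sigmaAlg_le [m : MeasurableSpace Ω] (hH : ∀ p x, Measurable (H p x))
    (V : Set (Space d)) : sigmaAlg H V ≤ m := by
  refine iSup_le fun p => iSup_le fun x => iSup_le fun _ => ?_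
  rw [← BorelSpace.measurable_eq (α := ℝ)]
  exact (hH p x).comap_le

/-- Off `W` the field is `{0}`, and the momenta of norm at most `l` are deterministic. Randomness
enters only through the condition that `H > μ` on a compact set of pairs `(u, p)` with `u` in the
segment and in `W`. -/
theorem measurableSet_segLt (hcont : ∀ ω, Continuous fun z : Space d × Space d => H z.1 z.2 ω)
    (hW : IsClosed W) {V : Set (Space d)} {x y : Space d} (hV : segment ℝ x y ∩ W ⊆ V) (b : ℝ) :
    MeasurableSet[sigmaAlg H V] {ω | SegLt (costField H μ l L W ω) x y b} := by
  let K : Set (Space d × Space d) := ((segment ℝ x y ∩ W) ×ˢ Metric.closedBall 0 L) ∩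
    {z | b ≤ inner ℝ z.2 (y - x)}
  have hseg : IsCompact (segment ℝ x y) := by
    rw [segment_eq_image_lineMap]
    exact isCompact_Icc.image AffineMap.lineMap_continuous
  have hKc : IsCompact K := by
    refine ((hseg.inter_right hW).prod (isCompact_closedBall 0 L)).inter_right ?_
    have : Continuous fun z : Space d × Space d => inner ℝ z.2 (y - x) := by fun_prop
    exact isClosed_le continuous_const this
  have h1 := measurableSet_forall_lt (𝒢 := sigmaAlg H V) hKc (g := fun z ω => H z.2 z.1 ω)
    (fun z hz => measurable_sigmaAlg (hV hz.1.1) z.2)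
    (fun ω => (hcont ω).comp continuous_swap) μ
  have h2 : {ω | SegLt (costField H μ l L W ω) x y b} =
      {_ω | 0 < b ∧ ∀ u ∈ segment ℝ x y ∩ W, ∀ p : Space d, ‖p‖ ≤ l → inner ℝ p (y - x) < b} ∩
      {ω | ∀ z ∈ K, μ < H z.2 z.1 ω} := by
    ext ω
    constructor
    · refine fun h => ⟨⟨SegLt.pos (C := costField H μ l L W ω) (fun _ => Or.inl rfl) h, fun u hu p hp =>
        h u hu.1 p (Or.inr ⟨hu.2, Or.inl hp⟩)⟩, ?_⟩
      rintro ⟨u, p⟩ ⟨⟨hu, hp⟩, hb⟩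
      by_contra! hcon
      exact absurd (h u hu.1 p (Or.inr ⟨hu.2, Or.inr ⟨by simpa using hp, hcon⟩⟩)) (not_lt.2 hb)
    · rintro ⟨⟨hb, hball⟩, hK⟩ u hu p (rfl | ⟨huW, hp | ⟨hp, hpH⟩⟩)
      · simpa using hb
      · exact hball u ⟨hu, huW⟩ p hp
      · by_contra! hcon
        exact absurd (hK (u, p) ⟨⟨⟨hu, huW⟩, by simpa using hp⟩, hcon⟩) (not_lt.2 hpH)
  rw [h2]
  exact (MeasurableSet.const _).inter h1

end CostField

/-! ### Splitting a passage cost at a neighbourhood of a set -/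

section SetDist

variable {E : Type*} [NormedAddCommGroup E] [InnerProductSpace ℝ E]
  {C C₁ C₂ : E → Set E} {V V' W : Set E} {x y z : E} {a b l L r t : ℝ}

/-- The points at distance at least one from `V`. -/
def farSet (V : Set E) : Set E := {u | 1 ≤ Metric.infDist u V}

omit [InnerProductSpace ℝ E] in
theorem isClosed_farSet (V : Set E) : IsClosed (farSet V) :=
  isClosed_le continuous_const (Metric.continuous_infDist_pt V)

/-- The cost of reaching `y` from the set `V`. -/
noncomputable def setDist (C : E → Set E) (V : Set E) (y : E) : ℝ :=
  sInf {b | ∃ x ∈ V, Reach C Set.univ x y b}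

namespace IsCostField

variable (hC : IsCostField C L)
include hC

theorem bddBelow_setDist (V : Set E) (y : E) :
    BddBelow {b | ∃ x ∈ V, Reach C Set.univ x y b} :=
  ⟨0, by rintro _ ⟨x, _, h⟩; exact (Reach.pos hC.zero_mem h).le⟩

theorem setDist_nonempty (hV : V.Nonempty) (y : E) :
    {b | ∃ x ∈ V, Reach C Set.univ x y b}.Nonempty := by
  obtain ⟨x, hx⟩ := hV
  obtain ⟨b, hb⟩ := hC.reach_nonempty x y
  exact ⟨b, x, hx, hb⟩

theorem setDist_le (hx : x ∈ V) (h : Reach C Set.univ x y b) : setDist C V y ≤ b :=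
  csInf_le (hC.bddBelow_setDist V y) ⟨x, hx, h⟩

theorem setDist_nonneg (V : Set E) (y : E) : 0 ≤ setDist C V y :=
  Real.sInf_nonneg (by rintro _ ⟨x, _, h⟩; exact (Reach.pos hC.zero_mem h).le)

theorem setDist_lt_iff (hV : V.Nonempty) :
    setDist C V y < b ↔ ∃ x ∈ V, ∃ a < b, Reach C Set.univ x y a := by
  constructor
  · intro h
    obtain ⟨a, ⟨x, hx, ha⟩, hab⟩ := exists_lt_of_csInf_lt (hC.setDist_nonempty hV y) h
    exact ⟨x, hx, a, hab, ha⟩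
  · rintro ⟨x, hx, a, hab, h⟩
    exact (hC.setDist_le hx h).trans_lt hab

theorem setDist_le_of_dist (hx : x ∈ V) (h : dist y x ≤ r) : setDist C V y ≤ L * r := by
  refine le_of_forall_pos_le_add fun ε hε => hC.setDist_le hx
    (reach_of_norm hC.norm_le hC.nonneg (Set.subset_univ _) ?_)
  rw [← dist_eq_norm]
  have := mul_le_mul_of_nonneg_left h hC.nonneg
  linarith

theorem setDist_eq_zero (hy : y ∈ V) : setDist C V y = 0 :=
  le_antisymm (by simpa using hC.setDist_le_of_dist (r := 0) hy (by simp))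
    (hC.setDist_nonneg V y)

end IsCostField

/-- The splitting point is the last visit to the closed unit neighbourhood of `V`. The bound `2`
instead of `1` gives an actual nearby point of `V`, as the infimum distance need not be attained. -/
theorem Reach.exit_nhd (hx : x ∈ V) (h : Reach C Set.univ x y b) (hy : 1 < Metric.infDist y V)
    {ε : ℝ} (hε : 0 < ε) :
    ∃ u ∈ farSet V, (∃ v ∈ V, dist u v < 2) ∧ ∃ a₁ a₂, a₁ + a₂ ≤ b + ε ∧
      Reach C Set.univ x u a₁ ∧ Reach C (farSet V) u y a₂ := by
  have hF : IsClosed {u : E | Metric.infDist u V ≤ 1} :=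
    isClosed_le (Metric.continuous_infDist_pt V) continuous_const
  have hsub : closure {u : E | Metric.infDist u V ≤ 1}ᶜ ⊆ farSet V :=
    closure_minimal (fun u hu => (lt_of_not_ge (show ¬ Metric.infDist u V ≤ 1 from hu)).le)
      (isClosed_farSet V)
  obtain ⟨u, hu, huc, a₁, a₂, hab, h1, h2⟩ := h.lastExit hF (x := x)
    (by simp [Metric.infDist_zero_of_mem hx]) (not_le.2 hy) hε
  have hu1 : Metric.infDist u V < 2 := lt_of_le_of_lt hu (by norm_num)
  exact ⟨u, hsub huc, (Metric.infDist_lt_iff ⟨x, hx⟩).1 hu1, a₁, a₂, hab, h1,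
    h2.mono_set (Set.inter_subset_right.trans hsub)⟩

/-- Together with `min_add_setDist_le` this shows that the cost to `y` is, up to a multiple of `L`,
the cost spent in `V` plus the cost from `V` to `y` in a medium that ignores the neighbourhood of
`V`. Here a near-optimal chain from `V` is kept after it leaves the neighbourhood, and its exit
point is reached through a nearby point of `V`. -/
theorem chainDist_le_add_setDist (hC : IsCostField C L) (hC₁ : IsCostField C₁ L)
    (hfar : ∀ u ∈ farSet V, C u ⊆ C₁ u) (hV : V.Nonempty)
    (ht : ∀ v ∈ V, chainDist C x v ≤ t) (y : E) :
    chainDist C x y ≤ t + 2 * L + setDist C₁ V y := by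
  have hnear : ∀ u, (∃ v ∈ V, dist u v < 2) → chainDist C x u ≤ t + 2 * L := by
    rintro u ⟨v, hv, huv⟩
    have h1 := hC.chainDist_triangle x v u
    have h2 := hC.chainDist_le_norm v u
    rw [← dist_eq_norm] at h2
    have h3 := mul_le_mul_of_nonneg_left huv.le hC.nonneg
    linarith [ht v hv]
  by_cases hy : 1 < Metric.infDist y V
  · refine le_of_forall_pos_le_add fun ε hε => ?_
    obtain ⟨v, hv, b, hb, h⟩ := (hC₁.setDist_lt_iff (y := y) hV).1
      (lt_add_of_pos_right _ (half_pos hε))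
    obtain ⟨u, -, hnu, a₁, a₂, hab, h1, h2⟩ := h.exit_nhd hv hy (half_pos hε)
    have h3 := hC.chainDist_triangle x u y
    have h4 := hC.chainDist_le ((h2.mono_field hfar).mono_set (Set.subset_univ _))
    have h5 := h1.pos hC₁.zero_mem
    linarith [hnear u hnu]
  · have := hnear y ((Metric.infDist_lt_iff hV).1 (by linarith))
    linarith [hC₁.setDist_nonneg V y]

/-- The exit point lies outside `V`, so the chain has already spent `t`; the rest of the chain,
joined to `V` by a segment of length less than `2`, competes in `setDist`. When `y` is near `V` the
minimum is bounded by the cost itself. -/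
theorem min_add_setDist_le (hC : IsCostField C L) (hC₁ : IsCostField C₁ L)
    (hfar : ∀ u ∈ farSet V, C₁ u ⊆ C u) (hx : x ∈ V)
    (ht : ∀ u ∉ V, t ≤ chainDist C x u) (y : E) :
    min (chainDist C x y) t + setDist C₁ V y ≤ chainDist C x y + 2 * L := by
  by_cases hy : 1 < Metric.infDist y V
  · refine le_of_forall_pos_le_add fun ε hε => ?_
    have h := hC.reach_of_chainDist_lt (lt_add_of_pos_right (chainDist C x y)
      (show 0 < ε / 3 by linarith))
    obtain ⟨u, hu, ⟨v, hv, huv⟩, a₁, a₂, hab, h1, h2⟩ :=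
      h.exit_nhd hx hy (show 0 < ε / 3 by linarith)
    have huV : u ∉ V := fun hmem => by
      have : 1 ≤ Metric.infDist u V := hu
      rw [Metric.infDist_zero_of_mem hmem] at this
      linarith
    have h3 := (ht u huV).trans (hC.chainDist_le h1)
    have h4 : L * ‖u - v‖ < L * 2 + ε / 3 := by
      rw [← dist_eq_norm]
      have := mul_le_mul_of_nonneg_left huv.le hC.nonneg
      linarith
    have h5 := hC₁.setDist_le hv ((reach_of_norm hC₁.norm_le hC₁.nonneg (Set.subset_univ _)
      h4).trans ((h2.mono_field hfar).mono_set (Set.subset_univ _)))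
    linarith [min_le_right (chainDist C x y) t]
  · obtain ⟨v, hv, hyv⟩ := (Metric.infDist_lt_iff ⟨x, hx⟩).1
      (show Metric.infDist y V < 2 by linarith)
    have := hC₁.setDist_le_of_dist hv hyv.le
    linarith [min_le_left (chainDist C x y) t]

theorem setDist_anti (hC₁ : IsCostField C₁ L) (hC₂ : IsCostField C₂ L) (h : ∀ u, C₂ u ⊆ C₁ u)
    (hV : V.Nonempty) (hVV' : V ⊆ V') (y : E) : setDist C₂ V' y ≤ setDist C₁ V y := by
  refine le_csInf (hC₁.setDist_nonempty hV y) ?_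
  rintro b ⟨x, hx, hb⟩
  exact hC₂.setDist_le (hVV' hx) (hb.mono_field fun u _ => h u)

/-- Controls the change of the remaining cost when the explored set grows by distance `r`: the exit
point from the neighbourhood of `V'` is within `r + 2` of `V`. -/
theorem setDist_le_add (hC₁ : IsCostField C₁ L) (hC₂ : IsCostField C₂ L)
    (hfar : ∀ u ∈ farSet V', C₁ u ⊆ C₂ u) (hV' : V'.Nonempty)
    (hVV' : ∀ v' ∈ V', ∃ v ∈ V, dist v' v ≤ r) (y : E) :
    setDist C₁ V y ≤ setDist C₂ V' y + L * (r + 2) := by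
  have hnear : ∀ u, (∃ v ∈ V', dist u v < 2) → ∃ v ∈ V, dist u v ≤ r + 2 := by
    rintro u ⟨v', hv', huv⟩
    obtain ⟨v, hv, hvv⟩ := hVV' v' hv'
    exact ⟨v, hv, by linarith [dist_triangle u v' v]⟩
  by_cases hy : 1 < Metric.infDist y V'
  · refine le_of_forall_pos_le_add fun ε hε => ?_
    obtain ⟨w, hw, b, hb, h⟩ := (hC₂.setDist_lt_iff (y := y) hV').1
      (lt_add_of_pos_right _ (show 0 < ε / 3 by linarith))
    obtain ⟨u, -, hnu, a₁, a₂, hab, h1, h2⟩ := h.exit_nhd hw hy (show 0 < ε / 3 by linarith)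
    obtain ⟨v, hv, huv⟩ := hnear u hnu
    have h4 : L * ‖u - v‖ < L * (r + 2) + ε / 3 := by
      rw [← dist_eq_norm]
      have := mul_le_mul_of_nonneg_left huv hC₁.nonneg
      linarith
    have h5 := hC₁.setDist_le hv ((reach_of_norm hC₁.norm_le hC₁.nonneg (Set.subset_univ _)
      h4).trans ((h2.mono_field hfar).mono_set (Set.subset_univ _)))
    have h6 := h1.pos hC₂.zero_mem
    linarith
  · obtain ⟨v, hv, hyv⟩ := hnear y ((Metric.infDist_lt_iff hV').1 (by linarith))
    have := hC₁.setDist_le_of_dist hv hyv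
    linarith [hC₂.setDist_nonneg V' y]

end SetDist

/-! ### The explored region and its stopping property -/

section Exploration

variable {E : Type*} [NormedAddCommGroup E] [InnerProductSpace ℝ E]
  {C : E → Set E} {V : Set E} {A I : Finset E} {y z : E} {a b l L R t t' : ℝ}

/-- The union of the unit balls with centers in `A`. -/
def ballUnion (A : Finset E) : Set E := ⋃ q ∈ A, Metric.ball q 1

omit [InnerProductSpace ℝ E] in
theorem mem_ballUnion : z ∈ ballUnion A ↔ ∃ q ∈ A, z ∈ Metric.ball q 1 := by
  simp [ballUnion]

omit [InnerProductSpace ℝ E] in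
theorem isOpen_ballUnion (A : Finset E) : IsOpen (ballUnion A) :=
  isOpen_biUnion fun _ _ => Metric.isOpen_ball

omit [InnerProductSpace ℝ E] in
theorem ballUnion_mono {A' : Finset E} (h : A ⊆ A') : ballUnion A ⊆ ballUnion A' :=
  Set.biUnion_subset_biUnion_left h

omit [InnerProductSpace ℝ E] in
theorem exists_ballUnion_cover [ProperSpace E] (R : ℝ) :
    ∃ I : Finset E, Metric.closedBall 0 R ⊆ ballUnion I := by
  obtain ⟨I, -, hfin, hI⟩ := (isCompact_closedBall (0 : E) R).finite_cover_balls one_pos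
  refine ⟨hfin.toFinset, hI.trans fun z hz => ?_⟩
  rw [mem_ballUnion]
  simpa using hz

open Classical in
/-- The centers in `I` of the unit balls that are reached from the origin inside `V` at cost
less than `t`. -/
noncomputable def explored (C : E → Set E) (I : Finset E) (V : Set E) (t : ℝ) : Finset E :=
  I.filter fun q => 0 ∈ Metric.ball q 1 ∨ ∃ z ∈ Metric.ball q 1, ∃ b < t, Reach C V 0 z b

theorem mem_explored {q : E} : q ∈ explored C I V t ↔ q ∈ I ∧ (0 ∈ Metric.ball q 1 ∨
    ∃ z ∈ Metric.ball q 1, ∃ b < t, Reach C V 0 z b) := by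
  classical
  simp [explored]

theorem explored_subset : explored C I V t ⊆ I := fun _ hq => (mem_explored.1 hq).1

theorem explored_mono (h : t ≤ t') : explored C I V t ⊆ explored C I V t' := by
  intro q hq
  rw [mem_explored] at hq ⊢
  refine ⟨hq.1, hq.2.imp_right ?_⟩
  rintro ⟨z, hz, b, hb, hr⟩
  exact ⟨z, hz, b, hb.trans_le h, hr⟩

theorem explored_mono_set {V' : Set E} (h : V ⊆ V') : explored C I V t ⊆ explored C I V' t := by
  intro q hq
  rw [mem_explored] at hq ⊢
  refine ⟨hq.1, hq.2.imp_right ?_⟩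
  rintro ⟨z, hz, b, hb, hr⟩
  exact ⟨z, hz, b, hb, hr.mono_set h⟩

/-- The first alternative in `explored` serves this: the origin belongs to the region even when `t ≤
0` and no chain is cheap enough. -/
theorem zero_mem_ballUnion_explored (hR : 0 ≤ R) (hI : Metric.closedBall 0 R ⊆ ballUnion I) :
    0 ∈ ballUnion (explored C I V t) := by
  obtain ⟨q, hq, hz⟩ := mem_ballUnion.1 (hI (Metric.mem_closedBall_self hR))
  exact mem_ballUnion.2 ⟨q, mem_explored.2 ⟨hq, Or.inl hz⟩, hz⟩

section

variable (hC : IsCostField C L) (hl : 0 < l) (hCl : ∀ u p, ‖p‖ ≤ l → p ∈ C u)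
  (hI : Metric.closedBall 0 R ⊆ ballUnion I)
include hC hl hCl hI

theorem mem_ballUnion_of_chainDist_lt (htR : t ≤ l * R) (hz : chainDist C 0 z < t) :
    z ∈ ballUnion I := by
  refine hI ?_
  have h := hC.norm_le_chainDist hl.le hCl 0 z
  rw [sub_zero] at h
  rw [mem_closedBall_zero_iff]
  exact le_of_mul_le_mul_left (by linarith) hl

theorem mem_ballUnion_explored (htR : t ≤ l * R) (hz : chainDist C 0 z < t) :
    z ∈ ballUnion (explored C I Set.univ t) := by
  obtain ⟨q, hq, hzq⟩ := mem_ballUnion.1 (mem_ballUnion_of_chainDist_lt hC hl hCl hI htR hz)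
  obtain ⟨a, ha, hr⟩ := hC.chainDist_lt_iff.1 hz
  exact mem_ballUnion.2 ⟨q, mem_explored.2 ⟨hq, Or.inr ⟨z, hzq, a, ha, hr⟩⟩, hzq⟩

/-- Cost at least `l` per unit length: an additional cost `l` extends the region by a bounded
distance. The bound `4` is a displacement below `2` plus a ball diameter. -/
theorem exists_near_explored (hR : 0 ≤ R) (htR : t ≤ l * R)
    (hz : z ∈ ballUnion (explored C I Set.univ (t + l))) :
    ∃ v ∈ ballUnion (explored C I Set.univ t), dist z v ≤ 4 := by
  obtain ⟨q, hq, hzq⟩ := mem_ballUnion.1 hz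
  have h0 := zero_mem_ballUnion_explored (C := C) (V := Set.univ) (t := t) hR hI
  have hdist : ∀ w ∈ Metric.ball q 1, dist z w < 2 := fun w hw => by
    have := dist_triangle_right z w q
    rw [Metric.mem_ball] at hw hzq
    linarith
  rcases (mem_explored.1 hq).2 with h | ⟨w, hw, b, hb, hr⟩
  · exact ⟨0, h0, by linarith [hdist 0 h]⟩
  rcases lt_or_ge t l with htl | htl
  · have h1 := hr.norm_lt hl.le hCl
    rw [sub_zero] at h1
    have h2 : ‖w‖ < 2 := lt_of_mul_lt_mul_left (by linarith) hl.le
    refine ⟨0, h0, ?_⟩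
    have := dist_triangle z w 0
    rw [dist_zero_right w] at this
    linarith [hdist w hw]
  -- The level `t - l` instead of `t` puts the splitting point strictly below cost `t`, hence in the
  -- region; the remaining cost is then at most `2 * l`.
  have hF : IsClosed {u : E | chainDist C 0 u ≤ t - l} :=
    isClosed_le (hC.continuous_chainDist 0) continuous_const
  by_cases hwF : chainDist C 0 w ≤ t - l
  · exact ⟨w, mem_ballUnion_explored hC hl hCl hI htR (by linarith), by linarith [hdist w hw]⟩
  · obtain ⟨u, hu, huc, a₁, a₂, hab, h1, h2⟩ := hr.lastExit hF
      (show chainDist C 0 0 ≤ t - l by rw [hC.chainDist_self]; linarith) hwF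
      (show 0 < t + l - b by linarith)
    have hu' : t - l ≤ chainDist C 0 u := by
      have hsub : closure {u : E | chainDist C 0 u ≤ t - l}ᶜ ⊆ {u | t - l ≤ chainDist C 0 u} :=
        closure_minimal (fun u hu => (lt_of_not_ge
          (show ¬ chainDist C 0 u ≤ t - l from hu)).le) (isClosed_le continuous_const (hC.continuous_chainDist 0))
      exact hsub huc
    have h3 := hC.chainDist_le h1
    have h4 := h2.norm_lt hl.le hCl
    have h5 : ‖w - u‖ < 2 := lt_of_mul_lt_mul_left (by linarith) hl.le
    have hu : chainDist C 0 u ≤ t - l := hu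
    refine ⟨u, mem_ballUnion_explored hC hl hCl hI htR (by linarith), ?_⟩
    have := dist_triangle z w u
    rw [dist_eq_norm w u] at this
    linarith [hdist w hw]

omit hI hCl hl in
theorem chainDist_le_of_mem_explored (ht : 0 ≤ t) (hz : z ∈ ballUnion (explored C I V t)) :
    chainDist C 0 z ≤ t + 2 * L := by
  obtain ⟨q, hq, hzq⟩ := mem_ballUnion.1 hz
  have hL := hC.nonneg
  have hdist : ∀ w ∈ Metric.ball q 1, L * ‖z - w‖ ≤ 2 * L := fun w hw => by
    have := dist_triangle_right z w q
    rw [Metric.mem_ball] at hw hzq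
    rw [← dist_eq_norm]
    nlinarith
  rcases (mem_explored.1 hq).2 with h | ⟨w, hw, b, hb, hr⟩
  · linarith [hC.chainDist_le_norm 0 z, hdist 0 h]
  · linarith [hC.chainDist_le_norm w z, hdist w hw, hC.chainDist_triangle 0 w z,
      hC.chainDist_le (hr.mono_set (Set.subset_univ _))]

theorem Reach.inside_explored (hR : 0 ≤ R) (htR : t ≤ l * R) (h : Reach C Set.univ 0 z b)
    (hb : b < t) : Reach C (ballUnion (explored C I Set.univ t)) 0 z b := by
  induction h with
  | refl _ h0 => exact .refl (zero_mem_ballUnion_explored hR hI) h0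
  | @step y z a c h _ hs ih =>
    have hc := hs.pos hC.zero_mem
    refine .step (ih (by linarith)) (fun u hu => ?_) hs
    refine mem_ballUnion_explored hC hl hCl hI htR ?_
    exact (hC.chainDist_le (h.prefix_segment hC.zero_mem hs hu (Set.subset_univ _))).trans_lt hb

/-- A cheap chain cannot leave the union of the balls of `A`. Its first exit point would lie in some
ball with center `q ∈ I`, and just before exiting the chain is already in that open ball while still
inside the union; so `q` is explored, `q ∈ A`, and the exit point was not outside. -/
theorem Reach.inside_of_explored_subset (h0 : 0 ∈ ballUnion A) (htR : t ≤ l * R)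
    (hA : explored C I (ballUnion A) t ⊆ A) (h : Reach C Set.univ 0 z b) (hb : b < t) :
    Reach C (ballUnion A) 0 z b := by
  induction h with
  | refl _ hp => exact .refl h0 hp
  | @step y z a c h _ hs ih =>
    have hc := hs.pos hC.zero_mem
    have hy := ih (by linarith)
    refine .step hy ?_ hs
    by_contra hcon
    rw [Set.not_subset] at hcon
    obtain ⟨u₀, hu₀, hu₀V⟩ := hcon
    rw [segment_eq_image_lineMap] at hu₀
    obtain ⟨s₀, hs₀, rfl⟩ := hu₀
    have hcont : Continuous fun s : ℝ => (AffineMap.lineMap y z s : E) :=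
      AffineMap.lineMap_continuous
    have hcomp : IsCompact (Set.Icc (0 : ℝ) 1 ∩
        (fun s => AffineMap.lineMap y z s) ⁻¹' (ballUnion A)ᶜ) :=
      isCompact_Icc.inter_right ((isOpen_ballUnion A).isClosed_compl.preimage hcont)
    obtain ⟨s, ⟨hs01, hsV⟩, hmin⟩ := hcomp.exists_isLeast ⟨s₀, hs₀, hu₀V⟩
    have hspos : 0 < s := by
      refine lt_of_le_of_ne hs01.1 ?_
      rintro rfl
      exact hsV (by simpa using hy.target_mem)
    have hmem : ∀ r ∈ Set.Icc (0 : ℝ) 1, (AffineMap.lineMap y z r : E) ∈ segment ℝ y z :=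
      fun r hr => by rw [segment_eq_image_lineMap]; exact ⟨r, hr, rfl⟩
    have hd := (hC.chainDist_le (h.prefix_segment hC.zero_mem hs (hmem s hs01)
      (Set.subset_univ _))).trans_lt hb
    obtain ⟨q, hqI, hq⟩ := mem_ballUnion.1 (mem_ballUnion_of_chainDist_lt hC hl hCl hI htR hd)
    have hnear : ∀ᶠ r in 𝓝[<] s, (AffineMap.lineMap y z r : E) ∈ Metric.ball q 1 :=
      (hcont.continuousAt.eventually (Metric.isOpen_ball.mem_nhds hq)).filter_mono
        nhdsWithin_le_nhds
    obtain ⟨r, hrq, hr⟩ := (hnear.and (Ioo_mem_nhdsLT hspos)).exists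
    have hr01 : r ∈ Set.Icc (0 : ℝ) 1 := ⟨hr.1.le, hr.2.le.trans hs01.2⟩
    have hsub : segment ℝ y (AffineMap.lineMap y z r : E) ⊆ ballUnion A := by
      have e : segment ℝ y (AffineMap.lineMap y z r : E) =
          (fun r : ℝ => (AffineMap.lineMap y z r : E)) '' Set.Icc 0 r := by
        have := image_segment (𝕜 := ℝ) (AffineMap.lineMap y z : ℝ →ᵃ[ℝ] E) 0 r
        rw [segment_eq_Icc hr.1.le, AffineMap.lineMap_apply_zero] at this
        exact this.symm
      rw [e]
      rintro _ ⟨r', hr', rfl⟩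
      by_contra hcon
      have := hmin ⟨⟨hr'.1, hr'.2.trans hr01.2⟩, hcon⟩
      linarith [hr'.2, hr.2]
    have hreach := hy.prefix_segment hC.zero_mem hs (hmem r hr01) hsub
    have hqA : q ∈ A := hA (mem_explored.2 ⟨hqI, Or.inr ⟨_, hrq, _, hb, hreach⟩⟩)
    exact hsV (mem_ballUnion.2 ⟨q, hqA, hq⟩)

/-- The event that the explored set is `A` is decided inside `A`. -/
theorem explored_eq_iff (hR : 0 ≤ R) (htR : t ≤ l * R) :
    explored C I Set.univ t = A ↔
      0 ∈ ballUnion A ∧ explored C I (ballUnion A) t = A := by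
  constructor
  · rintro rfl
    refine ⟨zero_mem_ballUnion_explored hR hI,
      (explored_mono_set (Set.subset_univ _)).antisymm fun q hq => ?_⟩
    rw [mem_explored] at hq ⊢
    refine ⟨hq.1, hq.2.imp_right ?_⟩
    rintro ⟨z, hz, b, hb, h⟩
    exact ⟨z, hz, b, hb, h.inside_explored hC hl hCl hI hR htR hb⟩
  · rintro ⟨h0, hA⟩
    refine Finset.Subset.antisymm (fun q hq => ?_)
      (hA.symm.subset.trans (explored_mono_set (Set.subset_univ _)))
    rw [← hA]
    rw [mem_explored] at hq ⊢
    refine ⟨hq.1, hq.2.imp_right ?_⟩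
    rintro ⟨z, hz, b, hb, h⟩
    exact ⟨z, hz, b, hb, h.inside_of_explored_subset hC hl hCl hI h0 htR hA.subset hb⟩

end

end Exploration

/-! ### Azuma's inequality for a variable tracked by an adapted process -/

section Azuma

variable {Ω : Type*} {𝓕 𝓖 m : MeasurableSpace Ω} {P : Measure Ω} [IsProbabilityMeasure P]
  {X : Ω → ℝ} {B : ℝ}

omit [IsProbabilityMeasure P] in
theorem ae_abs_condExp_le (hX : ∀ ω, |X ω| ≤ B) :
    ∀ᵐ ω ∂P, |(P[X | 𝓕]) ω| ≤ B := by
  exact ae_bdd_abs_condExp_of_ae_bdd_abs (Eventually.of_forall hX)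

theorem integrable_exp_condExp (h𝓕 : 𝓕 ≤ m) (hX : ∀ ω, |X ω| ≤ B) (s : ℝ) :
    Integrable (fun ω => Real.exp (s * (P[X | 𝓕]) ω)) P := by
  refine Integrable.of_bound (C := Real.exp (|s| * B)) ?_ ?_
  · exact (Real.continuous_exp.comp_stronglyMeasurable
      (stronglyMeasurable_condExp.mono h𝓕 |>.const_mul s)).aestronglyMeasurable
  · filter_upwards [ae_abs_condExp_le (𝓕 := 𝓕) hX] with ω hω
    rw [Real.norm_of_nonneg (Real.exp_pos _).le, Real.exp_le_exp]
    calc s * (P[X | 𝓕]) ω ≤ |s * (P[X | 𝓕]) ω| := le_abs_self _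
      _ = |s| * |(P[X | 𝓕]) ω| := abs_mul _ _
      _ ≤ |s| * B := by gcongr

/-- One Hoeffding step: by convexity the exponential of a martingale increment bounded by `c` lies
below a chord. The linear term integrates to zero against an `𝓕`-measurable weight, and `cosh x ≤
exp (x ^ 2 / 2)`. -/
theorem integral_exp_condExp_le (h𝓕𝓖 : 𝓕 ≤ 𝓖) (h𝓖 : 𝓖 ≤ m) (hXm : Measurable X)
    (hX : ∀ ω, |X ω| ≤ B) {c : ℝ} (hc : 0 < c)
    (hdiff : ∀ᵐ ω ∂P, |(P[X | 𝓖]) ω - (P[X | 𝓕]) ω| ≤ c) (s : ℝ) :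
    ∫ ω, Real.exp (s * (P[X | 𝓖]) ω) ∂P ≤
      Real.exp (s ^ 2 * c ^ 2 / 2) * ∫ ω, Real.exp (s * (P[X | 𝓕]) ω) ∂P := by
  have h𝓕 := h𝓕𝓖.trans h𝓖
  set Z := P[X | 𝓕] with hZ
  set Z' := P[X | 𝓖] with hZ'
  have hXi : Integrable X P := Integrable.of_bound (C := B) hXm.aestronglyMeasurable
    (Eventually.of_forall hX)
  have hZm : StronglyMeasurable[𝓕] fun ω => Real.exp (s * Z ω) :=
    Real.continuous_exp.comp_stronglyMeasurable (stronglyMeasurable_condExp.const_mul s)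
  have hZi : Integrable (fun ω => Real.exp (s * Z ω)) P := integrable_exp_condExp h𝓕 hX s
  have hZ'i : Integrable (fun ω => Real.exp (s * Z' ω)) P := integrable_exp_condExp h𝓖 hX s
  have hDi : Integrable (Z' - Z) P := integrable_condExp.sub integrable_condExp
  have hprod : Integrable ((fun ω => Real.exp (s * Z ω)) * (Z' - Z)) P := by
    refine hZi.mul_bdd (c := c) hDi.aestronglyMeasurable ?_
    filter_upwards [hdiff] with ω hω using hω
  have hzero : ∫ ω, ((fun ω => Real.exp (s * Z ω)) * (Z' - Z)) ω ∂P = 0 := by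
    rw [← integral_condExp h𝓕]
    have h1 := condExp_mul_of_stronglyMeasurable_left hZm hprod hDi
    have h2 : P[Z' - Z | 𝓕] =ᵐ[P] 0 := by
      have h3 := condExp_sub (integrable_condExp (m := 𝓖) (f := X) (μ := P))
        (integrable_condExp (m := 𝓕) (f := X) (μ := P)) 𝓕
      have h4 : P[P[X | 𝓖] | 𝓕] =ᵐ[P] P[X | 𝓕] := condExp_condExp_of_le h𝓕𝓖 h𝓖
      have h5 : P[P[X | 𝓕] | 𝓕] =ᵐ[P] P[X | 𝓕] := condExp_condExp_of_le le_rfl h𝓕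
      filter_upwards [h3, h4, h5] with ω h3 h4 h5
      rw [hZ, hZ', h3, Pi.sub_apply, h4, h5, sub_self, Pi.zero_apply]
    rw [integral_congr_ae (g := fun _ => (0 : ℝ))]
    · simp
    · filter_upwards [h1, h2] with ω h1 h2
      rw [h1, Pi.mul_apply, h2, Pi.zero_apply, mul_zero]
  have hpt : ∀ᵐ ω ∂P, Real.exp (s * Z' ω) ≤ Real.cosh (s * c) * Real.exp (s * Z ω) +
      (Real.sinh (s * c) / c) * ((fun ω => Real.exp (s * Z ω)) * (Z' - Z)) ω := by
    filter_upwards [hdiff] with ω hω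
    have h1 : |(Z' ω - Z ω) / c| ≤ 1 := by
      rw [abs_div, abs_of_pos hc, div_le_one hc]; exact hω
    have h2 := Real.exp_mul_le_cosh_add_mul_sinh h1 (s * c)
    have h3 : (Z' ω - Z ω) / c * (s * c) = s * (Z' ω - Z ω) := by field_simp
    rw [h3] at h2
    have h4 : s * Z' ω = s * Z ω + s * (Z' ω - Z ω) := by ring
    rw [h4, Real.exp_add]
    calc _ ≤ Real.exp (s * Z ω) * (Real.cosh (s * c) + (Z' ω - Z ω) / c * Real.sinh (s * c)) :=
          mul_le_mul_of_nonneg_left h2 (Real.exp_pos _).le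
      _ = _ := by simp only [Pi.mul_apply, Pi.sub_apply]; ring
  calc _ ≤ ∫ ω, (Real.cosh (s * c) * Real.exp (s * Z ω) +
      (Real.sinh (s * c) / c) * ((fun ω => Real.exp (s * Z ω)) * (Z' - Z)) ω) ∂P :=
        integral_mono_ae hZ'i ((hZi.const_mul _).add (hprod.const_mul _)) hpt
    _ = Real.cosh (s * c) * ∫ ω, Real.exp (s * Z ω) ∂P := by
        rw [integral_add (hZi.const_mul _) (hprod.const_mul _), integral_const_mul,
          integral_const_mul, hzero, mul_zero, add_zero]
    _ ≤ _ := by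
        refine mul_le_mul_of_nonneg_right ?_ (integral_nonneg fun ω => (Real.exp_pos _).le)
        rw [← mul_pow]
        exact Real.cosh_le_exp_half_sq _

/-- A function that has almost the same integrals as `X` over `𝓕`-measurable sets is close to the
conditional expectation of `X`. -/
theorem ae_abs_condExp_sub_le (h𝓕 : 𝓕 ≤ m) (hXi : Integrable X P) {Y : Ω → ℝ}
    (hYm : Measurable[𝓕] Y) (hYi : Integrable Y P) {a : ℝ}
    (h : ∀ s, MeasurableSet[𝓕] s → |∫ ω in s, (X ω - Y ω) ∂P| ≤ a * P.real s) :
    ∀ᵐ ω ∂P, |(P[X | 𝓕]) ω - Y ω| ≤ a := by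
  set g : Ω → ℝ := fun ω => (P[X | 𝓕]) ω - Y ω
  have hgm : StronglyMeasurable[𝓕] g := stronglyMeasurable_condExp.sub hYm.stronglyMeasurable
  have hgi : Integrable g (P.trim h𝓕) :=
    (integrable_condExp.sub hYi).trim h𝓕 hgm
  have hint : ∀ s, MeasurableSet[𝓕] s →
      ∫ ω in s, g ω ∂(P.trim h𝓕) = ∫ ω in s, (X ω - Y ω) ∂P := by
    intro s hs
    rw [← setIntegral_trim h𝓕 hgm hs, integral_sub integrable_condExp.integrableOn
      hYi.integrableOn, integral_sub hXi.integrableOn hYi.integrableOn,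
      setIntegral_condExp h𝓕 hXi hs]
  have hconst : ∀ (b : ℝ) s, MeasurableSet[𝓕] s →
      ∫ _ω in s, b ∂(P.trim h𝓕) = b * P.real s := by
    intro b s hs
    rw [setIntegral_const, smul_eq_mul, mul_comm, Measure.real, trim_measurableSet_eq h𝓕 hs,
      Measure.real]
  have h1 : g ≤ᵐ[P.trim h𝓕] fun _ => a :=
    ae_le_of_forall_setIntegral_le hgi (integrable_const a) fun s hs _ => by
      rw [hint s hs, hconst a s hs]; exact (abs_le.1 (h s hs)).2
  have h2 : (fun _ => -a) ≤ᵐ[P.trim h𝓕] g :=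
    ae_le_of_forall_setIntegral_le (integrable_const (-a)) hgi fun s hs _ => by
      rw [hint s hs, hconst (-a) s hs, neg_mul]; exact (abs_le.1 (h s hs)).1
  filter_upwards [ae_of_ae_trim h𝓕 h1, ae_of_ae_trim h𝓕 h2] with ω h1 h2
  exact abs_le.2 ⟨h2, h1⟩

/-- A variable that is tracked along a filtration by an adapted process with bounded increments
is sub-Gaussian around its mean. -/
theorem hasSubgaussianMGF_of_tracking {ℱ : ℕ → MeasurableSpace Ω} (hmono : Monotone ℱ)
    (hle : ∀ k, ℱ k ≤ m) (hXm : Measurable X) (hX : ∀ ω, |X ω| ≤ B)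
    {Y : ℕ → Ω → ℝ} {N : ℕ} {a b c₀ : ℝ} (ha : 0 < a) (hb : 0 ≤ b)
    (hYm : ∀ k ≤ N, Measurable[ℱ k] (Y k)) (hYi : ∀ k ≤ N, Integrable (Y k) P)
    (htrack : ∀ k ≤ N, ∀ s, MeasurableSet[ℱ k] s →
      |∫ ω in s, (X ω - Y k ω) ∂P| ≤ a * P.real s)
    (h0 : ∀ ω, Y 0 ω = c₀) (hN : ∀ ω, Y N ω = X ω)
    (hstep : ∀ k < N, ∀ ω, |Y (k + 1) ω - Y k ω| ≤ b) :
    HasSubgaussianMGF (fun ω => X ω - P[X]) (((N : ℝ) + 2) * (2 * a + b) ^ 2).toNNReal P := by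
  have hXi : Integrable X P := Integrable.of_bound (C := B) hXm.aestronglyMeasurable
    (Eventually.of_forall hX)
  have hc : 0 < 2 * a + b := by linarith
  have hnear : ∀ k ≤ N, ∀ᵐ ω ∂P, |(P[X | ℱ k]) ω - Y k ω| ≤ a := fun k hk =>
    ae_abs_condExp_sub_le (hle k) hXi (hYm k hk) (hYi k hk) (htrack k hk)
  have hXcond : P[X | m] = X := condExp_of_stronglyMeasurable le_rfl hXm.stronglyMeasurable hXi
  -- The martingale is within `a` of the process, so its increments are at most `2 * a + b`. The
  -- exponent `k + 1` counts an extra initial increment, from the mean to `ℱ 0`.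
  have hmgf : ∀ s k, k ≤ N → ∫ ω, Real.exp (s * (P[X | ℱ k]) ω) ∂P ≤
      Real.exp (s ^ 2 * (2 * a + b) ^ 2 / 2) ^ (k + 1) * Real.exp (s * P[X]) := by
    intro s k
    induction k with
    | zero =>
      intro hk
      have hmean : |P[X] - c₀| ≤ a := by
        have := htrack 0 hk Set.univ MeasurableSet.univ
        simp only [h0, Measure.restrict_univ, probReal_univ, mul_one] at this
        rwa [integral_sub hXi (integrable_const _), integral_const, probReal_univ, one_smul]
          at this
      have h1 := integral_exp_condExp_le (P := P) (𝓕 := ⊥) (𝓖 := ℱ 0) bot_le (hle 0) hXm hX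
        hc (by
          filter_upwards [hnear 0 hk] with ω hω
          rw [h0] at hω
          rw [condExp_bot, abs_le]
          rw [abs_le] at hω hmean
          constructor <;> linarith [hω.1, hω.2, hmean.1, hmean.2]) s
      rw [condExp_bot] at h1
      simpa using h1
    | succ k ih =>
      intro hk
      have h1 := integral_exp_condExp_le (P := P) (hmono (Nat.le_succ k)) (hle (k + 1)) hXm hX
        hc (by
          filter_upwards [hnear k (by omega), hnear (k + 1) hk] with ω h1 h2
          have h3 := hstep k (by omega) ω
          rw [abs_le] at h1 h2 h3 ⊢
          constructor <;> linarith [h1.1, h1.2, h2.1, h2.2, h3.1, h3.2]) s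
      refine h1.trans ?_
      rw [pow_succ' _ (k + 1), mul_assoc]
      exact mul_le_mul_of_nonneg_left (ih (by omega)) (Real.exp_pos _).le
  have hexpX : ∀ s, Integrable (fun ω => Real.exp (s * X ω)) P := fun s => by
    have := integrable_exp_condExp (P := P) (𝓕 := m) le_rfl hX s
    rwa [hXcond] at this
  have hshift : ∀ s, (fun ω => Real.exp (s * (X ω - P[X]))) =
      fun ω => Real.exp (-(s * P[X])) * Real.exp (s * X ω) := fun s => by
    funext ω
    rw [← Real.exp_add]
    congr 1
    ring
  refine ⟨fun s => ?_, fun s => ?_⟩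
  · rw [hshift]
    exact (hexpX s).const_mul _
  · rw [mgf, hshift, integral_const_mul]
    -- The final increment, from `ℱ N` to `X` itself, is the second extra one; this explains `N +
    -- 2`.
    have h1 := integral_exp_condExp_le (P := P) (hle N) le_rfl hXm hX hc (by
      filter_upwards [hnear N le_rfl] with ω hω
      rw [hXcond, abs_sub_comm, ← hN ω]
      linarith) s
    rw [hXcond] at h1
    have h2 := h1.trans (mul_le_mul_of_nonneg_left (hmgf s N le_rfl) (Real.exp_pos _).le)
    rw [← mul_assoc, ← pow_succ', ← Real.exp_nat_mul] at h2
    refine (mul_le_mul_of_nonneg_left h2 (Real.exp_pos _).le).trans (le_of_eq ?_)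
    rw [Real.coe_toNNReal _ (by positivity), ← Real.exp_add, ← Real.exp_add]
    congr 1
    push_cast
    ring

end Azuma

/-! ### The σ-algebra of a random set with the stopping property -/

section StoppedAlgebra

variable {Ω α : Type*}

/-- The σ-algebra of the events that are decided by `G a` on the event `A = a`. -/
@[reducible]
def stoppedAlg (m : MeasurableSpace Ω) (G : α → MeasurableSpace Ω) (A : Ω → α)
    (hA : ∀ a, MeasurableSet[G a] {ω | A ω = a}) : MeasurableSpace Ω where
  -- Measurability in `m` is demanded separately because `α` may be uncountable, so that the pieces
  -- need not give it.
  MeasurableSet' s := MeasurableSet[m] s ∧ ∀ a, MeasurableSet[G a] (s ∩ {ω | A ω = a})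
  measurableSet_empty := ⟨@MeasurableSet.empty _ m, fun a => by simp⟩
  measurableSet_compl s hs := ⟨hs.1.compl, fun a => by
    have : sᶜ ∩ {ω | A ω = a} = {ω | A ω = a} \ (s ∩ {ω | A ω = a}) := by
      ext ω; by_cases h : ω ∈ s <;> simp [h]
    rw [this]
    exact (hA a).diff (hs.2 a)⟩
  measurableSet_iUnion f hf := ⟨MeasurableSet.iUnion fun i => (hf i).1, fun a => by
    rw [Set.iUnion_inter]
    exact MeasurableSet.iUnion fun i => (hf i).2 a⟩

variable {m : MeasurableSpace Ω} {G : α → MeasurableSpace Ω}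

theorem stoppedAlg_le {A : Ω → α} (hA : ∀ a, MeasurableSet[G a] {ω | A ω = a}) :
    stoppedAlg m G A hA ≤ m := fun _ hs => hs.1

/-- On `A' = a'` the smaller variable takes countably many values `a ≤ a'`, and each piece is
decided by `G a ≤ G a'`. -/
theorem stoppedAlg_mono [Preorder α] (hG : Monotone G) {A A' : Ω → α}
    (hA : ∀ a, MeasurableSet[G a] {ω | A ω = a}) (hA' : ∀ a, MeasurableSet[G a] {ω | A' ω = a})
    (hAA' : ∀ ω, A ω ≤ A' ω) {S : Set α} (hS : S.Countable) (hAS : ∀ ω, A ω ∈ S) :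
    stoppedAlg m G A hA ≤ stoppedAlg m G A' hA' := by
  intro s hs
  refine ⟨hs.1, fun a' => ?_⟩
  have : s ∩ {ω | A' ω = a'} =
      ⋃ a ∈ S ∩ Set.Iic a', (s ∩ {ω | A ω = a}) ∩ {ω | A' ω = a'} := by
    ext ω
    simp only [Set.mem_inter_iff, Set.mem_ofPred_eq, Set.mem_iUnion, Set.mem_Iic, exists_prop]
    constructor
    · rintro ⟨h1, h2⟩
      exact ⟨A ω, ⟨hAS ω, h2 ▸ hAA' ω⟩, ⟨h1, rfl⟩, h2⟩
    · rintro ⟨a, _, ⟨h1, _⟩, h2⟩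
      exact ⟨h1, h2⟩
  rw [this]
  exact MeasurableSet.biUnion (hS.mono Set.inter_subset_left) fun a ha =>
    (hG ha.2 _ (hs.2 a)).inter (hA' a')

end StoppedAlgebra

/-! ### Concentration of the passage cost around its mean -/

section Concentration

variable {d : ℕ} {Ω : Type*} {H : Space d → Space d → Ω → ℝ} {μ l L : ℝ}

theorem measurable_chainDist (hcont : ∀ ω, Continuous fun z : Space d × Space d => H z.1 z.2 ω)
    (hl : 0 ≤ l) (hlL : l ≤ L) (x y : Space d) :
    Measurable[sigmaAlg H Set.univ] fun ω => chainDist (costField H μ l L Set.univ ω) x y := by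
  refine measurable_of_Iio fun b => ?_
  have hC := fun ω => isCostField_costField (μ := μ) hcont hl hlL isClosed_univ ω
  have h := measurableSet_exists_reach (𝒢 := sigmaAlg H Set.univ) hC isOpen_univ
    (fun y z b _ => measurableSet_segLt hcont isClosed_univ (Set.subset_univ _) b) {x} {y} b
  convert h using 1
  ext ω
  simp [(hC ω).chainDist_lt_iff]

theorem measurable_setDist (hcont : ∀ ω, Continuous fun z : Space d × Space d => H z.1 z.2 ω)
    (hl : 0 ≤ l) (hlL : l ≤ L) {V : Set (Space d)} (hV : V.Nonempty) (y : Space d) :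
    Measurable[sigmaAlg H (farSet V)]
      fun ω => setDist (costField H μ l L (farSet V) ω) V y := by
  refine measurable_of_Iio fun b => ?_
  have hC := fun ω => isCostField_costField (μ := μ) hcont hl hlL (isClosed_farSet V) ω
  have h := measurableSet_exists_reach (𝒢 := sigmaAlg H (farSet V)) hC isOpen_univ
    (fun y z b _ => measurableSet_segLt hcont (isClosed_farSet V) Set.inter_subset_right b)
    V {y} b
  convert h using 1
  ext ω
  simp [(hC ω).setDist_lt_iff hV]

theorem measurableSet_exists_reach_costField
    (hcont : ∀ ω, Continuous fun z : Space d × Space d => H z.1 z.2 ω)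
    (hl : 0 ≤ l) (hlL : l ≤ L) {V : Set (Space d)} (hV : IsOpen V) (S S' : Set (Space d))
    (b : ℝ) : MeasurableSet[sigmaAlg H V] {ω | ∃ x ∈ S, ∃ z ∈ S', ∃ a < b,
      Reach (costField H μ l L Set.univ ω) V x z a} :=
  measurableSet_exists_reach (𝒢 := sigmaAlg H V)
    (fun ω => isCostField_costField hcont hl hlL isClosed_univ ω) hV
    (fun _ _ b h => measurableSet_segLt hcont isClosed_univ (Set.inter_subset_left.trans h) b)
    S S' b

/-- By `explored_eq_iff` the event can be expressed through chains that stay inside the union of the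
balls of `A`, and such chains see `H` only there. -/
theorem measurableSet_explored_eq
    (hcont : ∀ ω, Continuous fun z : Space d × Space d => H z.1 z.2 ω)
    (hl : 0 < l) (hlL : l ≤ L) {I : Finset (Space d)} {R t : ℝ} (hR : 0 ≤ R)
    (hI : Metric.closedBall 0 R ⊆ ballUnion I) (htR : t ≤ l * R) (A : Finset (Space d)) :
    MeasurableSet[sigmaAlg H (ballUnion A)]
      {ω | explored (costField H μ l L Set.univ ω) I Set.univ t = A} := by
  have hq : ∀ q, MeasurableSet[sigmaAlg H (ballUnion A)]
      {ω | q ∈ explored (costField H μ l L Set.univ ω) I (ballUnion A) t} := by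
    intro q
    have h := measurableSet_exists_reach_costField (μ := μ) hcont hl.le hlL (isOpen_ballUnion A)
      {0} (Metric.ball q 1) t
    have e : {ω | q ∈ explored (costField H μ l L Set.univ ω) I (ballUnion A) t} =
        {_ω | q ∈ I} ∩ ({_ω | 0 ∈ Metric.ball q 1} ∪ {ω | ∃ x ∈ ({0} : Set (Space d)),
          ∃ z ∈ Metric.ball q 1, ∃ a < t,
            Reach (costField H μ l L Set.univ ω) (ballUnion A) x z a}) := by
      ext ω
      simp [mem_explored]
    rw [e]
    exact (MeasurableSet.const _).inter ((MeasurableSet.const _).union h)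
  have e : {ω | explored (costField H μ l L Set.univ ω) I Set.univ t = A} =
      {_ω | 0 ∈ ballUnion A ∧ A ⊆ I} ∩ ⋂ q ∈ I,
        {ω | q ∈ explored (costField H μ l L Set.univ ω) I (ballUnion A) t ↔ q ∈ A} := by
    ext ω
    simp only [Set.mem_ofPred_eq, Set.mem_inter_iff, Set.mem_iInter]
    rw [explored_eq_iff (isCostField_costField hcont hl.le hlL isClosed_univ ω) hl
      (fun u p => mem_costField_of_norm_le ω u p) hI hR htR]
    constructor
    · rintro ⟨h0, hA⟩
      exact ⟨⟨h0, hA ▸ explored_subset⟩, fun q _ => by rw [hA]⟩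
    · rintro ⟨⟨h0, hAI⟩, h⟩
      refine ⟨h0, Finset.ext fun q => ?_⟩
      by_cases hqI : q ∈ I
      · exact h q hqI
      · exact iff_of_false (fun hq => hqI (explored_subset hq)) fun hq => hqI (hAI hq)
  rw [e]
  refine (MeasurableSet.const _).inter (MeasurableSet.biInter I.countable_toSet fun q _ => ?_)
  by_cases hqA : q ∈ A
  · simpa [hqA] using hq q
  · simp only [hqA, iff_false]
    exact (hq q).compl

theorem setIntegral_eq_of_indep {𝓕 𝓖 : MeasurableSpace Ω} {m : MeasurableSpace Ω}
    {P : Measure Ω} [IsProbabilityMeasure P] (h𝓕 : 𝓕 ≤ m) (h𝓖 : 𝓖 ≤ m)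
    (hind : Indep 𝓕 𝓖 P) {D : Ω → ℝ} (hD : Measurable[𝓖] D) (hDi : Integrable D P) {s : Set Ω}
    (hs : MeasurableSet[𝓕] s) : ∫ ω in s, D ω ∂P = P.real s * ∫ ω, D ω ∂P := by
  have h := condExp_indep_eq h𝓖 h𝓕 hD.stronglyMeasurable hind.symm
  rw [← setIntegral_condExp h𝓕 hDi hs, setIntegral_congr_ae (h𝓕 s hs)
    (g := fun _ => ∫ ω, D ω ∂P) (h.mono fun ω h _ => h), setIntegral_const, smul_eq_mul]

variable [MeasurableSpace Ω] {P : Measure Ω} [IsProbabilityMeasure P]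

/-- The passage cost from the origin to `y` is sub-Gaussian around its mean. -/
theorem hasSubgaussianMGF_chainDist (hmeas : ∀ p x, Measurable (H p x))
    (hcont : ∀ ω, Continuous fun z : Space d × Space d => H z.1 z.2 ω)
    (hfin : ∀ V W : Set (Space d), MeasurableSet V → MeasurableSet W →
      (∀ x ∈ V, ∀ y ∈ W, 1 ≤ dist x y) → Indep (sigmaAlg H V) (sigmaAlg H W) P)
    (hl : 0 < l) (hlL : l ≤ L) (y : Space d) {N : ℕ} (hN : L * ‖y‖ < N * l) :
    HasSubgaussianMGF (fun ω => chainDist (costField H μ l L Set.univ ω) 0 y -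
      ∫ ω', chainDist (costField H μ l L Set.univ ω') 0 y ∂P)
      (((N : ℝ) + 2) * (14 * L) ^ 2).toNNReal P := by
  classical
  obtain ⟨I, hI⟩ := exists_ballUnion_cover (E := Space d) N
  have hL : 0 < L := hl.trans_le hlL
  have hR : (0 : ℝ) ≤ N := Nat.cast_nonneg N
  set C : Ω → Space d → Set (Space d) := fun ω => costField H μ l L Set.univ ω with hCdef
  set X : Ω → ℝ := fun ω => chainDist (C ω) 0 y with hX
  -- The levels are frozen after step `N`, so every one stays at most `l * N`, within the range
  -- covered by the balls of `I`, while the filtration is defined for all `k`.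
  set t : ℕ → ℝ := fun k => (min k N : ℕ) * l with ht
  set Aₖ : ℕ → Ω → Finset (Space d) := fun k ω => explored (C ω) I Set.univ (t k) with hAₖ
  set D : Finset (Space d) → Ω → ℝ := fun A ω =>
    setDist (costField H μ l L (farSet (ballUnion A)) ω) (ballUnion A) y with hD
  set g : Finset (Space d) → ℝ := fun A => ∫ ω, D A ω ∂P with hg
  have hC : ∀ ω, IsCostField (C ω) L := fun ω =>
    isCostField_costField hcont hl.le hlL isClosed_univ ω
  have hCfar : ∀ (A : Finset (Space d)) ω,
      IsCostField (costField H μ l L (farSet (ballUnion A)) ω) L := fun A ω =>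
    isCostField_costField hcont hl.le hlL (isClosed_farSet _) ω
  have hCl : ∀ ω u p, ‖p‖ ≤ l → p ∈ C ω u := fun ω u p => mem_costField_of_norm_le ω u p
  have htR : ∀ k, t k ≤ l * N := fun k => by
    have h1 : ((min k N : ℕ) : ℝ) ≤ N := Nat.cast_le.2 (min_le_right k N)
    simp only [ht]
    nlinarith
  have ht0 : ∀ k, 0 ≤ t k := fun k => by simp only [ht]; positivity
  have htmono : Monotone t := fun i j hij => by
    simp only [ht]
    exact mul_le_mul_of_nonneg_right (Nat.cast_le.2 (min_le_min_right N hij)) hl.le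
  have hGle : ∀ V, sigmaAlg H V ≤ ‹MeasurableSpace Ω› := sigmaAlg_le hmeas
  have hXm : Measurable X :=
    (measurable_chainDist hcont hl.le hlL 0 y).mono (hGle _) le_rfl
  have hX0 : ∀ ω, 0 ≤ X ω := fun ω => (hC ω).chainDist_nonneg 0 y
  have hXle : ∀ ω, X ω ≤ L * ‖y‖ := fun ω => by simpa using (hC ω).chainDist_le_norm 0 y
  have hXB : ∀ ω, |X ω| ≤ L * ‖y‖ := fun ω => by rw [abs_of_nonneg (hX0 ω)]; exact hXle ω
  have hXi : Integrable X P := Integrable.of_bound (C := L * ‖y‖) hXm.aestronglyMeasurable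
    (Eventually.of_forall hXB)
  have hAev : ∀ k A, MeasurableSet[sigmaAlg H (ballUnion A)] {ω | Aₖ k ω = A} := fun k A =>
    measurableSet_explored_eq hcont hl hlL hR hI (htR k) A
  have hA0 : ∀ k ω, (0 : Space d) ∈ ballUnion (Aₖ k ω) := fun k ω =>
    zero_mem_ballUnion_explored hR hI
  have hAI : ∀ k ω, Aₖ k ω ∈ (I.powerset : Set (Finset (Space d))) := fun k ω => by
    simpa using explored_subset
  have hAmono : ∀ ω, Monotone fun k => Aₖ k ω := fun ω i j hij => explored_mono (htmono hij)
  have hD0 : ∀ A ω, 0 ≤ D A ω := fun A ω => (hCfar A ω).setDist_nonneg _ y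
  have hDle : ∀ A ω, (0 : Space d) ∈ ballUnion A → D A ω ≤ L * ‖y‖ := fun A ω h0 =>
    (hCfar A ω).setDist_le_of_dist h0 (by simp)
  have hDm : ∀ A, (0 : Space d) ∈ ballUnion A →
      Measurable[sigmaAlg H (farSet (ballUnion A))] (D A) := fun A h0 =>
    measurable_setDist hcont hl.le hlL ⟨0, h0⟩ y
  have hDi : ∀ A, (0 : Space d) ∈ ballUnion A → Integrable (D A) P := fun A h0 =>
    Integrable.of_bound (C := L * ‖y‖)
      (((hDm A h0).mono (hGle _) le_rfl).aestronglyMeasurable)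
      (Eventually.of_forall fun ω => by
        rw [Real.norm_of_nonneg (hD0 A ω)]; exact hDle A ω h0)
  set ℱ : ℕ → MeasurableSpace Ω := fun k =>
    stoppedAlg ‹MeasurableSpace Ω› (fun A => sigmaAlg H (ballUnion A)) (Aₖ k) (hAev k) with hℱ
  have hℱmono : Monotone ℱ := fun i j hij =>
    stoppedAlg_mono (fun A A' h => sigmaAlg_mono (ballUnion_mono h)) (hAev i) (hAev j)
      (fun ω => hAmono ω hij) (Finset.countable_toSet _) (hAI i)
  have hℱle : ∀ k, ℱ k ≤ ‹MeasurableSpace Ω› := fun k => stoppedAlg_le (hAev k)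
  -- The predictor of `X`: cost spent up to level `t k` plus the mean cost remaining from the
  -- explored region, averaged over a fresh medium.
  set Y : ℕ → Ω → ℝ := fun k ω => min (X ω) (t k) + g (Aₖ k ω) with hY
  have hAm : ∀ k A, MeasurableSet {ω | Aₖ k ω = A} := fun k A => hGle _ _ (hAev k A)
  have hsum : ∀ k (s : Set Ω), s = ⋃ A ∈ I.powerset, s ∩ {ω | Aₖ k ω = A} := by
    intro k s
    ext ω
    simp only [Set.mem_iUnion, Set.mem_inter_iff, Set.mem_ofPred_eq, exists_prop]
    exact ⟨fun h => ⟨Aₖ k ω, hAI k ω, h, rfl⟩, fun ⟨_, _, h, _⟩ => h⟩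
  have hYslice : ∀ k A c, MeasurableSet[sigmaAlg H (ballUnion A)]
      (Y k ⁻¹' Set.Iio c ∩ {ω | Aₖ k ω = A}) := by
    intro k A c
    -- Either the truncation makes the inequality automatic, or it reads `X < c - g A` with `c - g A
    -- ≤ t k`, and is then decided by chains that cannot leave the explored region.
    rcases lt_or_ge (t k) (c - g A) with hc | hc
    · have e : Y k ⁻¹' Set.Iio c ∩ {ω | Aₖ k ω = A} = {ω | Aₖ k ω = A} := by
        refine Set.inter_eq_right.2 fun ω hω => ?_
        have hω : Aₖ k ω = A := hω
        simp only [hY, Set.mem_preimage, Set.mem_Iio, hω]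
        linarith [min_le_right (X ω) (t k)]
      rw [e]
      exact hAev k A
    · have e : Y k ⁻¹' Set.Iio c ∩ {ω | Aₖ k ω = A} =
          {ω | ∃ x ∈ ({0} : Set (Space d)), ∃ z ∈ ({y} : Set (Space d)), ∃ a < c - g A,
            Reach (C ω) (ballUnion A) x z a} ∩ {ω | Aₖ k ω = A} := by
        ext ω
        simp only [Set.mem_inter_iff, Set.mem_preimage, Set.mem_Iio, Set.mem_ofPred_eq,
          Set.mem_singleton_iff, exists_eq_left]
        refine and_congr_left fun hω => ?_
        have h1 : Y k ω < c ↔ X ω < c - g A := by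
          simp only [hY, hω]
          rw [← lt_sub_iff_add_lt, min_lt_iff]
          exact or_iff_left (not_lt.2 hc)
        rw [h1, hX, (hC ω).chainDist_lt_iff]
        constructor
        · rintro ⟨a, ha, hr⟩
          refine ⟨a, ha, ?_⟩
          have := hr.inside_explored (hC ω) hl (hCl ω) hI hR (htR k) (ha.trans_le hc)
          rwa [show explored (C ω) I Set.univ (t k) = A from hω] at this
        · rintro ⟨a, ha, hr⟩
          exact ⟨a, ha, hr.mono_set (Set.subset_univ _)⟩
      rw [e]
      exact (measurableSet_exists_reach_costField hcont hl.le hlL (isOpen_ballUnion A) {0} {y}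
        _).inter (hAev k A)
  have hYm : ∀ k, Measurable[ℱ k] (Y k) := by
    intro k
    refine measurable_of_Iio fun c => ⟨?_, fun A => hYslice k A c⟩
    rw [hsum k (Y k ⁻¹' Set.Iio c)]
    exact MeasurableSet.biUnion (Finset.countable_toSet _) fun A _ =>
      hGle _ _ (hYslice k A c)
  have hg0 : ∀ A, 0 ≤ g A := fun A => integral_nonneg (hD0 A)
  have hgle : ∀ A, (0 : Space d) ∈ ballUnion A → g A ≤ L * ‖y‖ := fun A h0 => by
    have := integral_mono (hDi A h0) (integrable_const (L * ‖y‖)) fun ω => hDle A ω h0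
    simpa using this
  have hYi : ∀ k, Integrable (Y k) P := fun k =>
    Integrable.of_bound (C := L * ‖y‖ + L * ‖y‖)
      (((hYm k).mono (hℱle k) le_rfl).aestronglyMeasurable)
      (Eventually.of_forall fun ω => by
        have h1 : 0 ≤ min (X ω) (t k) := le_min (hX0 ω) (ht0 k)
        have h2 := hg0 (Aₖ k ω)
        rw [Real.norm_of_nonneg (add_nonneg h1 h2)]
        linarith [min_le_left (X ω) (t k), hXle ω, hgle _ (hA0 k ω)])
  have hpath : ∀ k ω, |X ω - min (X ω) (t k) - D (Aₖ k ω) ω| ≤ 4 * L := by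
    intro k ω
    have h1 := min_add_setDist_le (hC ω) (hCfar (Aₖ k ω) ω)
      (fun u _ => costField_mono (Set.subset_univ _) ω u) (hA0 k ω) (t := t k)
      (fun u hu => not_lt.1 fun h => hu (mem_ballUnion_explored (hC ω) hl (hCl ω) hI (htR k) h)) y
    have h2 := chainDist_le_add_setDist (hC ω) (hCfar (Aₖ k ω) ω)
      (fun u hu => costField_subset_of_mem ω hu) ⟨0, hA0 k ω⟩
      (fun v hv => chainDist_le_of_mem_explored (hC ω) (ht0 k) hv) y
    have h3 := hD0 (Aₖ k ω) ω
    simp only [hX, hD] at h1 h2 h3 ⊢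
    rw [abs_le]
    constructor
    · linarith
    · rcases min_choice (chainDist (C ω) 0 y) (t k) with h | h <;> rw [h] <;> linarith
  have htrack : ∀ k, ∀ s, MeasurableSet[ℱ k] s →
      |∫ ω in s, (X ω - Y k ω) ∂P| ≤ 4 * L * P.real s := by
    intro k s hs
    have hdisj : Set.PairwiseDisjoint (I.powerset : Set (Finset (Space d)))
        fun A => s ∩ {ω | Aₖ k ω = A} := fun A _ A' _ hne =>
      Set.disjoint_left.2 fun ω h1 h2 => hne (h1.2.symm.trans h2.2)
    have hms : ∀ A ∈ I.powerset, MeasurableSet (s ∩ {ω | Aₖ k ω = A}) := fun A _ =>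
      hs.1.inter (hAm k A)
    have hpiece : ∀ A ∈ I.powerset, |∫ ω in s ∩ {ω | Aₖ k ω = A}, (X ω - Y k ω) ∂P| ≤
        4 * L * P.real (s ∩ {ω | Aₖ k ω = A}) := by
      intro A hA
      set s' := s ∩ {ω | Aₖ k ω = A} with hs'
      rcases s'.eq_empty_or_nonempty with he | ⟨ω₀, hω₀⟩
      · simp [he]
      have h0 : (0 : Space d) ∈ ballUnion A := by
        have := hA0 k ω₀
        rwa [show Aₖ k ω₀ = A from hω₀.2] at this
      have hind := hfin (ballUnion A) (farSet (ballUnion A)) (isOpen_ballUnion A).measurableSet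
        (isClosed_farSet _).measurableSet (fun x hx z hz => by
          rw [dist_comm]
          exact le_trans hz (Metric.infDist_le_dist_of_mem hx))
      have h1 := setIntegral_eq_of_indep (hGle _) (hGle _) hind (hDm A h0) (hDi A h0) (hs.2 A)
      -- On this slice the mean `g A` may be replaced by the random `D A`: the slice belongs to the
      -- σ-algebra of the explored balls, and `D A` depends on `H` at distance at least one from
      -- them.
      have h2 : ∫ ω in s', (X ω - Y k ω) ∂P =
          ∫ ω in s', (X ω - min (X ω) (t k) - D A ω) ∂P := by
        have hmi : Integrable (fun ω => X ω - min (X ω) (t k)) P :=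
          hXi.sub (hXi.inf (integrable_const (t k)))
        have h3 : ∫ ω in s', (X ω - Y k ω) ∂P =
            ∫ ω in s', ((X ω - min (X ω) (t k)) - g A) ∂P := by
          refine setIntegral_congr_fun (hms A hA) fun ω hω => ?_
          simp only [hY, show Aₖ k ω = A from hω.2]
          ring
        rw [h3, integral_sub hmi.integrableOn (integrable_const _),
          integral_sub hmi.integrableOn (hDi A h0).integrableOn, h1, setIntegral_const,
          smul_eq_mul]
      rw [h2, ← Real.norm_eq_abs]
      refine norm_setIntegral_le_of_norm_le_const (measure_lt_top _ _) fun ω hω => ?_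
      have := hpath k ω
      rw [show Aₖ k ω = A from hω.2] at this
      exact this
    have hXY : Integrable (fun ω => X ω - Y k ω) P := hXi.sub (hYi k)
    calc |∫ ω in s, (X ω - Y k ω) ∂P|
        = |∑ A ∈ I.powerset, ∫ ω in s ∩ {ω | Aₖ k ω = A}, (X ω - Y k ω) ∂P| := by
          rw [← integral_biUnion_finset _ hms hdisj fun A _ => hXY.integrableOn, ← hsum k s]
      _ ≤ ∑ A ∈ I.powerset, 4 * L * P.real (s ∩ {ω | Aₖ k ω = A}) :=
          (Finset.abs_sum_le_sum_abs _ _).trans (Finset.sum_le_sum hpiece)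
      _ = 4 * L * P.real s := by
          rw [← Finset.mul_sum, ← measureReal_biUnion_finset hdisj hms, ← hsum k s]
  -- The truncated cost rises by at most `l ≤ L`; the mean remaining cost drops by at most `L * (4 +
  -- 2)`, as the region grows by distance at most `4`. The two changes have opposite signs.
  have hstep : ∀ k < N, ∀ ω, |Y (k + 1) ω - Y k ω| ≤ 6 * L := by
    intro k hk ω
    have htk : t (k + 1) = t k + l := by
      simp only [ht]
      rw [min_eq_left hk, min_eq_left hk.le]
      push_cast
      ring
    have hsub : Aₖ k ω ⊆ Aₖ (k + 1) ω := hAmono ω (Nat.le_succ k)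
    have h1 : g (Aₖ (k + 1) ω) ≤ g (Aₖ k ω) :=
      integral_mono (hDi _ (hA0 _ ω)) (hDi _ (hA0 _ ω)) fun ω' =>
        setDist_anti (hCfar _ ω') (hCfar _ ω') (fun u => costField_mono (fun v hv => by
          have hv : 1 ≤ Metric.infDist v (ballUnion (Aₖ (k + 1) ω)) := hv
          exact hv.trans (Metric.infDist_le_infDist_of_subset (ballUnion_mono hsub)
            ⟨0, hA0 k ω⟩)) ω' u) ⟨0, hA0 k ω⟩ (ballUnion_mono hsub) y
    have h2 : g (Aₖ k ω) ≤ g (Aₖ (k + 1) ω) + L * (4 + 2) := by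
      have h3 := integral_mono (hDi _ (hA0 k ω))
        ((hDi _ (hA0 (k + 1) ω)).add (integrable_const (L * (4 + 2)))) fun ω' =>
        setDist_le_add (r := 4) (hCfar (Aₖ k ω) ω') (hCfar (Aₖ (k + 1) ω) ω')
          (fun u hu => costField_subset_of_mem ω' hu) ⟨0, hA0 (k + 1) ω⟩ (fun v' hv' => by
            refine exists_near_explored (hC ω) hl (hCl ω) hI hR (htR k) ?_
            rw [← htk]
            exact hv') y
      rw [integral_add' (hDi _ (hA0 (k + 1) ω)) (integrable_const _)] at h3
      simpa using h3
    have h4 : min (X ω) (t k) ≤ min (X ω) (t (k + 1)) :=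
      min_le_min_left _ (htmono (Nat.le_succ k))
    have h5 : min (X ω) (t (k + 1)) ≤ min (X ω) (t k) + l := by
      rw [htk, ← min_add_add_right]
      exact min_le_min_right _ (by linarith)
    simp only [hY]
    rw [abs_le]
    constructor <;> linarith
  have htN : ∀ ω, X ω < t N := fun ω => by
    simp only [ht, min_self]
    exact (hXle ω).trans_lt hN
  -- At level `N * l > L * ‖y‖` the target has been explored, so nothing remains to be paid.
  have hYN : ∀ ω, Y N ω = X ω := by
    intro ω
    have hmem := mem_ballUnion_explored (hC ω) hl (hCl ω) hI (htR N) (htN ω)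
    have : g (Aₖ N ω) = 0 := by
      have h0 : D (Aₖ N ω) = fun _ => 0 := by
        funext ω'
        exact (hCfar _ ω').setDist_eq_zero hmem
      simp [hg, h0]
    simp only [hY, this, add_zero]
    exact min_eq_left (htN ω).le
  have hY0 : ∀ ω, Y 0 ω = g (I.filter fun q => (0 : Space d) ∈ Metric.ball q 1) := by
    intro ω
    have h1 : t 0 = 0 := by simp [ht]
    have h2 : Aₖ 0 ω = I.filter fun q => (0 : Space d) ∈ Metric.ball q 1 := by
      ext q
      rw [hAₖ, mem_explored, Finset.mem_filter, h1]
      refine and_congr_right fun _ => or_iff_left ?_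
      rintro ⟨z, -, b, hb, hr⟩
      exact absurd (hr.pos (hC ω).zero_mem) (not_lt.2 hb.le)
    simp only [hY]
    rw [h2, h1, min_eq_right (hX0 ω), zero_add]
  -- With tracking error `4 * L` and step `6 * L`, the martingale increments are bounded by `2 * (4
  -- * L) + 6 * L = 14 * L`.
  have := hasSubgaussianMGF_of_tracking hℱmono hℱle hXm hXB (N := N)
    (show 0 < 4 * L by positivity) (show 0 ≤ 6 * L by positivity) (fun k _ => hYm k)
    (fun k _ => hYi k) (fun k _ => htrack k) hY0 hYN hstep
  convert this using 3
  ring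

/-- Concentration of the passage cost from the origin, in both directions. -/
theorem chainDist_concentration (hmeas : ∀ p x, Measurable (H p x))
    (hcont : ∀ ω, Continuous fun z : Space d × Space d => H z.1 z.2 ω)
    (hfin : ∀ V W : Set (Space d), MeasurableSet V → MeasurableSet W →
      (∀ x ∈ V, ∀ y ∈ W, 1 ≤ dist x y) → Indep (sigmaAlg H V) (sigmaAlg H W) P)
    (hl : 0 < l) (hlL : l ≤ L) {y : Space d} {R : ℝ} (hR : 1 ≤ R) (hy : ‖y‖ ≤ R) {r : ℝ}
    (hr : 0 ≤ r) :
    P.real {ω | r ≤ chainDist (costField H μ l L Set.univ ω) 0 y -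
        ∫ ω', chainDist (costField H μ l L Set.univ ω') 0 y ∂P} ≤
      Real.exp (-(l * r ^ 2 / (1568 * L ^ 3 * R))) ∧
    P.real {ω | chainDist (costField H μ l L Set.univ ω) 0 y -
        ∫ ω', chainDist (costField H μ l L Set.univ ω') 0 y ∂P ≤ -r} ≤
      Real.exp (-(l * r ^ 2 / (1568 * L ^ 3 * R))) := by
  have hL : 0 < L := hl.trans_le hlL
  set N : ℕ := ⌊L * R / l⌋₊ + 1 with hNdef
  have hq : 1 ≤ L * R / l := by
    rw [le_div_iff₀ hl]
    nlinarith
  have hN : L * ‖y‖ < N * l := by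
    have h1 : L * R / l < N := by
      rw [hNdef]; push_cast; exact Nat.lt_floor_add_one _
    rw [div_lt_iff₀ hl] at h1
    exact (mul_le_mul_of_nonneg_left hy hL.le).trans_lt h1
  have hsub := hasSubgaussianMGF_chainDist (μ := μ) (P := P) hmeas hcont hfin hl hlL y hN
  have hNle : (N : ℝ) + 2 ≤ 4 * (L * R / l) := by
    have h1 : ((⌊L * R / l⌋₊ : ℕ) : ℝ) ≤ L * R / l := Nat.floor_le (by positivity)
    rw [hNdef]
    push_cast
    linarith
  -- The constant is `1568 = 2 * 4 * 14 ^ 2`, the factor `4` coming from `N + 2 ≤ 4 * (L * R / l)`.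
  have hexp : Real.exp (-r ^ 2 / (2 * ((((N : ℝ) + 2) * (14 * L) ^ 2).toNNReal : ℝ))) ≤
      Real.exp (-(l * r ^ 2 / (1568 * L ^ 3 * R))) := by
    rw [Real.coe_toNNReal _ (by positivity), Real.exp_le_exp, neg_div, neg_le_neg_iff,
      div_le_div_iff₀ (by positivity) (by positivity)]
    have h1 : ((N : ℝ) + 2) * l ≤ 4 * (L * R) := by
      have := mul_le_mul_of_nonneg_right hNle hl.le
      rwa [mul_assoc, div_mul_cancel₀ _ hl.ne'] at this
    calc l * r ^ 2 * (2 * (((N : ℝ) + 2) * (14 * L) ^ 2))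
        = (((N : ℝ) + 2) * l) * (392 * L ^ 2 * r ^ 2) := by ring
      _ ≤ (4 * (L * R)) * (392 * L ^ 2 * r ^ 2) :=
          mul_le_mul_of_nonneg_right h1 (by positivity)
      _ = r ^ 2 * (1568 * L ^ 3 * R) := by ring
  refine ⟨(hsub.measure_ge_le hr).trans hexp, ?_⟩
  refine le_trans (le_of_eq ?_) ((hsub.neg.measure_ge_le hr).trans hexp)
  congr 1
  ext ω
  simp only [Set.mem_ofPred_eq, Pi.neg_apply]
  exact le_neg

end Concentration

/-! ### The bias: mean passage cost against its limit -/

section Bias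

variable {d : ℕ}

/-- A subadditive function comparable with the norm. -/
structure IsSubadditiveNormLike (f : Space d → ℝ) (l L : ℝ) : Prop where
  add_le : ∀ x y, f (x + y) ≤ f x + f y
  lower : ∀ x, l * ‖x‖ ≤ f x
  upper : ∀ x, f x ≤ L * ‖x‖

/-- The size of the fluctuations at distance `v`. -/
noncomputable def fluctScale (μ v : ℝ) : ℝ := √(v * Real.log (1 + v / μ)) / μ

theorem fluctScale_pos {μ v : ℝ} (hμ : 0 < μ) (hv : 0 < v) : 0 < fluctScale μ v := by
  have h : 0 < Real.log (1 + v / μ) := Real.log_pos (by linarith [div_pos hv hμ])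
  unfold fluctScale
  positivity

/-- A positive lower bound for the logarithm, depending on `K` only; it lets constants be absorbed
into logarithmic factors uniformly in `μ ≤ K`. -/
theorem log_inv_le {μ K v : ℝ} (hμ : 0 < μ) (hK : μ ≤ K) (hv : 1 ≤ v) :
    Real.log (1 + 1 / K) ≤ Real.log (1 + v / μ) := by
  have hK0 : 0 < K := hμ.trans_le hK
  refine Real.log_le_log (by positivity) ?_
  gcongr

theorem log_one_add_inv_pos {K : ℝ} (hK : 0 < K) : 0 < Real.log (1 + 1 / K) :=
  Real.log_pos (by linarith [one_div_pos.2 hK])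

/-- Doubling the distance multiplies the fluctuations by about `√2` only; relative to `2 ^ j` they
decay geometrically up to a linear factor, so the errors of all dyadic scales are summable. -/
theorem fluctScale_two_pow_le {μ K v : ℝ} (hμ : 0 < μ) (hK : μ ≤ K) (hv : 1 ≤ v) (j : ℕ) :
    fluctScale μ (2 ^ j * v) ≤
      √2 ^ j * (1 + j / Real.log (1 + 1 / K)) * fluctScale μ v := by
  have hK0 : 0 < K := hμ.trans_le hK
  have hv0 : 0 < v := one_pos.trans_le hv
  have hκ := log_one_add_inv_pos hK0
  have hκℓ := log_inv_le hμ hK hv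
  set κ := Real.log (1 + 1 / K)
  set ℓ := Real.log (1 + v / μ)
  have h1 : Real.log (1 + 2 ^ j * v / μ) ≤ (1 + j / κ) * ℓ := by
    have h2 : 1 + 2 ^ j * v / μ ≤ 2 ^ j * (1 + v / μ) := by
      have : (1 : ℝ) ≤ 2 ^ j := one_le_pow₀ one_le_two
      rw [mul_add, mul_one, mul_div_assoc]
      linarith
    refine (Real.log_le_log (by positivity) h2).trans ?_
    rw [Real.log_mul (by positivity) (by positivity), Real.log_pow]
    have h3 : (j : ℝ) ≤ j / κ * ℓ := by
      rw [div_mul_eq_mul_div, le_div_iff₀ hκ]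
      exact mul_le_mul_of_nonneg_left hκℓ (Nat.cast_nonneg j)
    have h4 : (j : ℝ) * Real.log 2 ≤ j := by
      have := Real.log_two_lt_d9
      have hj : (0 : ℝ) ≤ j := Nat.cast_nonneg j
      nlinarith
    have : (1 + j / κ) * ℓ = ℓ + j / κ * ℓ := by ring
    change j * Real.log 2 + ℓ ≤ _
    linarith
  have hj1 : 0 ≤ (j : ℝ) / κ := by positivity
  unfold fluctScale
  rw [mul_div_assoc', div_le_div_iff_of_pos_right hμ]
  calc √(2 ^ j * v * Real.log (1 + 2 ^ j * v / μ))
      ≤ √(2 ^ j * (1 + j / κ) ^ 2 * (v * ℓ)) := by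
        refine Real.sqrt_le_sqrt ?_
        have hℓ : 0 < ℓ := hκ.trans_le hκℓ
        have h5 : 1 + j / κ ≤ (1 + j / κ) ^ 2 := by nlinarith
        calc 2 ^ j * v * Real.log (1 + 2 ^ j * v / μ) ≤ 2 ^ j * v * ((1 + j / κ) * ℓ) := by gcongr
          _ ≤ 2 ^ j * v * ((1 + j / κ) ^ 2 * ℓ) := by gcongr
          _ = _ := by ring
    _ = √2 ^ j * (1 + j / κ) * √(v * ℓ) := by
        rw [Real.sqrt_mul (by positivity), Real.sqrt_mul (by positivity),
          Real.sqrt_sq (by positivity)]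
        congr 2
        rw [Real.sqrt_eq_iff_mul_self_eq (by positivity) (by positivity), ← mul_pow,
          Real.mul_self_sqrt zero_le_two]

/-- The accumulated relative error over all dyadic scales. -/
noncomputable def dyadicErr (K : ℝ) : ℝ :=
  ∑' j : ℕ, (√2 / 2) ^ j * (1 + j / Real.log (1 + 1 / K))

theorem summable_dyadicErr (K : ℝ) :
    Summable fun j : ℕ => (√2 / 2) ^ j * (1 + j / Real.log (1 + 1 / K)) := by
  have hr : ‖√2 / 2‖ < 1 := by
    rw [Real.norm_of_nonneg (by positivity), div_lt_one two_pos, Real.sqrt_lt' two_pos]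
    norm_num
  have h1 := summable_geometric_of_norm_lt_one hr
  have h2 := (summable_pow_mul_geometric_of_norm_lt_one 1 hr).mul_right
    (Real.log (1 + 1 / K))⁻¹
  refine (h1.add h2).congr fun j => ?_
  rw [pow_one]
  ring

namespace IsSubadditiveNormLike

variable {f : Space d → ℝ} {l L : ℝ} (hf : IsSubadditiveNormLike f l L)
include hf

theorem map_zero : f 0 = 0 :=
  le_antisymm (by simpa using hf.upper 0) (by simpa using hf.lower 0)

theorem nonneg (hl : 0 ≤ l) (x : Space d) : 0 ≤ f x :=
  (mul_nonneg hl (norm_nonneg x)).trans (hf.lower x)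

theorem le_add_norm (x y : Space d) : f x ≤ f y + L * ‖x - y‖ := by
  have h1 := hf.add_le y (x - y)
  rw [add_sub_cancel] at h1
  linarith [hf.upper (x - y)]

theorem nsmul_le (n : ℕ) (x : Space d) : f (n • x) ≤ n * f x := by
  induction n with
  | zero => simp [hf.map_zero]
  | succ n ih =>
    rw [succ_nsmul]
    push_cast
    linarith [hf.add_le (n • x) x]

theorem sum_nsmul_le {ι : Type*} (s : Finset ι) (k : ι → ℕ) (z : ι → Space d) :
    f (∑ i ∈ s, k i • z i) ≤ ∑ i ∈ s, k i * f (z i) := by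
  classical
  induction s using Finset.induction_on with
  | empty => simp [hf.map_zero]
  | insert i s hi ih =>
    rw [Finset.sum_insert hi, Finset.sum_insert hi]
    linarith [hf.add_le (k i • z i) (∑ i ∈ s, k i • z i), hf.nsmul_le (k i) (z i)]

/-- Multiples of convex combinations of points of a sublevel set. -/
theorem nsmul_le_of_mem_convexHull (hl : 0 < l) (hlL : l ≤ L) {c : ℝ} (hc : 0 ≤ c) {x : Space d}
    (hx : x ∈ convexHull ℝ {z | f z ≤ c}) (N : ℕ) :
    f (N • x) ≤ N * c + L * ((d + 1) * (c / l)) := by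
  have hL : 0 < L := hl.trans_le hlL
  -- Carathéodory: the vertices are affinely independent, so there are at most `d + 1` of them.
  obtain ⟨ι, _, z, w, hz, hind, hw, hw1, rfl⟩ := eq_pos_convex_span_of_mem_convexHull hx
  have hzc : ∀ i, f (z i) ≤ c := fun i => hz ⟨i, rfl⟩
  have hzn : ∀ i, ‖z i‖ ≤ c / l := fun i => by
    rw [le_div_iff₀' hl]; exact (hf.lower _).trans (hzc i)
  have hcard : (Fintype.card ι : ℝ) ≤ d + 1 := by
    have h1 := hind.card_le_finrank_succ
    have h2 : Module.finrank ℝ (vectorSpan ℝ (Set.range z)) ≤ d :=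
      (Submodule.finrank_le _).trans_eq (by simp)
    exact_mod_cast h1.trans (by omega)
  -- The weights of `N • x` are rounded down to integers, where subadditivity applies; each of the
  -- at most `d + 1` fractional remainders has norm at most `c / l`.
  set k : ι → ℕ := fun i => ⌊(N : ℝ) * w i⌋₊
  have hsplit : N • ∑ i, w i • z i = ∑ i, k i • z i + ∑ i, ((N : ℝ) * w i - k i) • z i := by
    rw [← Finset.sum_add_distrib, Finset.smul_sum]
    refine Finset.sum_congr rfl fun i _ => ?_
    rw [← Nat.cast_smul_eq_nsmul ℝ N, ← Nat.cast_smul_eq_nsmul ℝ (k i), smul_smul, ← add_smul]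
    congr 1
    ring
  have h1 : ∑ i, (k i : ℝ) * f (z i) ≤ N * c := by
    calc ∑ i, (k i : ℝ) * f (z i) ≤ ∑ i, (N * w i) * c := by
          refine Finset.sum_le_sum fun i _ => ?_
          have h2 : (k i : ℝ) ≤ N * w i :=
            Nat.floor_le (mul_nonneg (Nat.cast_nonneg N) (hw i).le)
          exact mul_le_mul h2 (hzc i) (hf.nonneg hl.le _)
            (mul_nonneg (Nat.cast_nonneg N) (hw i).le)
      _ = N * c := by rw [← Finset.sum_mul, ← Finset.mul_sum, hw1, mul_one]
  have h2 : ‖∑ i, ((N : ℝ) * w i - k i) • z i‖ ≤ (d + 1) * (c / l) := by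
    calc ‖∑ i, ((N : ℝ) * w i - k i) • z i‖ ≤ ∑ i, ‖((N : ℝ) * w i - k i) • z i‖ :=
          norm_sum_le _ _
      _ ≤ ∑ _i : ι, c / l := by
          refine Finset.sum_le_sum fun i _ => ?_
          have h3 : (k i : ℝ) ≤ N * w i :=
            Nat.floor_le (mul_nonneg (Nat.cast_nonneg N) (hw i).le)
          have h4 : (N : ℝ) * w i < k i + 1 := Nat.lt_floor_add_one _
          rw [norm_smul, Real.norm_of_nonneg (by linarith)]
          calc _ ≤ 1 * ‖z i‖ := mul_le_mul_of_nonneg_right (by linarith) (norm_nonneg _)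
            _ ≤ c / l := by rw [one_mul]; exact hzn i
      _ = Fintype.card ι * (c / l) := by simp
      _ ≤ _ := mul_le_mul_of_nonneg_right hcard (by positivity)
  rw [hsplit]
  have h3 := hf.add_le (∑ i, k i • z i) (∑ i, ((N : ℝ) * w i - k i) • z i)
  have h4 := hf.sum_nsmul_le Finset.univ k z
  have h5 := hf.upper (∑ i, ((N : ℝ) * w i - k i) • z i)
  have h6 := mul_le_mul_of_nonneg_left h2 hL.le
  linarith

variable {mb : Space d → ℝ}
  (hmb : ∀ y, Tendsto (fun n : ℕ => f (n • y) / n) atTop (𝓝 (mb y)))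
include hmb

theorem limit_le_norm (y : Space d) : mb y ≤ L * ‖y‖ := by
  refine le_of_tendsto (hmb y) (eventually_atTop.2 ⟨1, fun n hn => ?_⟩)
  have hn : (0 : ℝ) < n := by exact_mod_cast hn
  rw [div_le_iff₀ hn]
  calc _ ≤ n * f y := hf.nsmul_le n y
    _ ≤ n * (L * ‖y‖) := mul_le_mul_of_nonneg_left (hf.upper y) hn.le
    _ = _ := mul_comm _ _

theorem limit_nonneg (hl : 0 ≤ l) (y : Space d) : 0 ≤ mb y :=
  ge_of_tendsto (hmb y) (Eventually.of_forall fun n =>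
    div_nonneg (hf.nonneg hl _) (Nat.cast_nonneg n))

theorem limit_le (y : Space d) : mb y ≤ f y := by
  refine le_of_tendsto (hmb y) (eventually_atTop.2 ⟨1, fun n hn => ?_⟩)
  have hn : (0 : ℝ) < n := by exact_mod_cast hn
  rw [div_le_iff₀ hn, mul_comm]
  exact hf.nsmul_le n y

omit hf in
theorem limit_nsmul {N : ℕ} (hN : 0 < N) (y : Space d) : mb (N • y) = N * mb y := by
  have h1 : Tendsto (fun n : ℕ => n * N) atTop atTop :=
    tendsto_id.atTop_mul_const' hN
  have h2 := ((hmb y).comp h1).const_mul (N : ℝ)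
  refine tendsto_nhds_unique (hmb (N • y)) (h2.congr' ?_)
  filter_upwards [eventually_gt_atTop 0] with n hn
  have hN' : (N : ℝ) ≠ 0 := by positivity
  have hn' : (n : ℝ) ≠ 0 := by positivity
  simp only [Function.comp, mul_nsmul']
  push_cast
  field_simp

/-- Convex-hull approximation: `y` is almost a convex combination of points where `f` is hardly
larger than `mb y`. -/
theorem mem_closure_convexHull {μ K A : ℝ} (hl : 0 < l) (hlL : l ≤ L) (hμ : 0 < μ) (hK : μ ≤ K)
    (hA : 0 ≤ A)
    (hcross : ∀ (q : Space d) (s β u : ℝ), 1 ≤ u → 0 < s → β ≤ L * u →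
      (∀ z, s ≤ inner ℝ q z → β ≤ f z) →
      ∀ z, 2 * s ≤ inner ℝ q z → 2 * β - A * fluctScale μ u ≤ f z)
    {y : Space d} (hy : 1 ≤ ‖y‖) :
    y ∈ closure (convexHull ℝ
      {z | f z ≤ mb y + (A / 2 * dyadicErr K + 1) * fluctScale μ ‖y‖}) := by
  have hL : 0 < L := hl.trans_le hlL
  have hK0 : 0 < K := hμ.trans_le hK
  have hκ := log_one_add_inv_pos hK0
  set e := fluctScale μ ‖y‖ with he
  have he0 : 0 < e := fluctScale_pos hμ (one_pos.trans_le hy)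
  have hdy0 : 0 ≤ dyadicErr K := tsum_nonneg fun j => by positivity
  -- The first term pays for the errors of all doublings; the summand `1` leaves the margin `e` that
  -- yields the contradiction.
  set c := mb y + (A / 2 * dyadicErr K + 1) * e with hc
  have hc0 : 0 ≤ c := add_nonneg (hf.limit_nonneg hmb hl.le y) (by positivity)
  by_contra hcon
  obtain ⟨φ, s₀, hφ, hs₀⟩ := geometric_hahn_banach_closed_point
    (convex_convexHull ℝ {z | f z ≤ c}).closure isClosed_closure hcon
  set q := (InnerProductSpace.toDual ℝ (Space d)).symm φ with hq
  have hφq : ∀ z, φ z = inner ℝ q z := fun z => by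
    rw [hq, InnerProductSpace.toDual_symm_apply]
  have hmemφ : ∀ z, f z ≤ c → φ z < s₀ := fun z hz =>
    hφ z (subset_closure (subset_convexHull ℝ _ hz))
  set s := φ y with hs
  have hs0 : 0 < s := by
    have := hmemφ 0 (by rw [hf.map_zero]; exact hc0)
    rw [_root_.map_zero] at this
    linarith
  let τ : ℕ → ℝ := fun j => (√2 / 2) ^ j * (1 + j / Real.log (1 + 1 / K))
  -- The separating functional gives `f > c` on the half-space `s ≤ ⟪q, z⟫`. Each application of
  -- `hcross` doubles the half-space and nearly doubles the bound, with an error of relative size `A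
  -- / 2 * e * τ k`.
  have hiter : ∀ k : ℕ, ∀ z, 2 ^ k * s ≤ inner ℝ q z →
      2 ^ k * (c - A / 2 * e * ∑ j ∈ Finset.range k, τ j) ≤ f z := by
    intro k
    induction k with
    | zero =>
      intro z hz
      simp only [pow_zero, one_mul, Finset.range_zero, Finset.sum_empty, mul_zero, sub_zero] at hz ⊢
      by_contra! hlt
      have := hmemφ z hlt.le
      rw [hφq] at this
      linarith
    | succ k ih =>
      intro z hz
      set β := 2 ^ k * (c - A / 2 * e * ∑ j ∈ Finset.range k, τ j) with hβ
      have hpow : (1 : ℝ) ≤ 2 ^ k := one_le_pow₀ one_le_two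
      have hβle : β ≤ L * (2 ^ k * ‖y‖) := by
        refine (ih ((2 : ℝ) ^ k • y) ?_).trans ((hf.upper _).trans_eq ?_)
        · rw [real_inner_smul_right, ← hφq]
        · rw [norm_smul, Real.norm_of_nonneg (by positivity)]
      have h1 := hcross q (2 ^ k * s) β (2 ^ k * ‖y‖) (one_le_mul_of_one_le_of_one_le hpow hy)
        (by positivity) hβle ih z (by rw [pow_succ] at hz; linarith)
      have h2 := mul_le_mul_of_nonneg_left (fluctScale_two_pow_le hμ hK hy k) hA
      have h3 : A * (√2 ^ k * (1 + k / Real.log (1 + 1 / K)) * fluctScale μ ‖y‖) =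
          2 ^ (k + 1) * (A / 2 * e * τ k) := by
        simp only [τ, div_pow]
        rw [← he]
        have : (2 : ℝ) ^ k ≠ 0 := by positivity
        field_simp
        rw [pow_succ]
        ring
      rw [Finset.sum_range_succ, pow_succ]
      have h4 : 2 ^ k * 2 * (c - A / 2 * e * (∑ j ∈ Finset.range k, τ j + τ k)) =
          2 * β - 2 ^ (k + 1) * (A / 2 * e * τ k) := by
        rw [hβ, pow_succ]; ring
      linarith
  -- Evaluation at `2 ^ k • y`, which lies on the boundary of the `k`-th half-space, followed by `k
  -- → ∞`.
  have hbound : mb y + e ≤ mb y := by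
    have hpowlim : Tendsto (fun k : ℕ => 2 ^ k) atTop (atTop : Filter ℕ) :=
      tendsto_pow_atTop_atTop_of_one_lt one_lt_two
    refine ge_of_tendsto ((hmb y).comp hpowlim) (Eventually.of_forall fun k => ?_)
    have h1 := hiter k ((2 ^ k : ℕ) • y) (by
      rw [← Nat.cast_smul_eq_nsmul ℝ, real_inner_smul_right, ← hφq]
      push_cast
      exact le_rfl)
    have h2 : ∑ j ∈ Finset.range k, τ j ≤ dyadicErr K :=
      (summable_dyadicErr K).sum_le_tsum _ fun j _ => by positivity
    have h3 : A / 2 * e * ∑ j ∈ Finset.range k, τ j ≤ A / 2 * e * dyadicErr K :=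
      mul_le_mul_of_nonneg_left h2 (by positivity)
    simp only [Function.comp]
    rw [le_div_iff₀ (by positivity)]
    push_cast
    have h4 : mb y + e ≤ c - A / 2 * e * ∑ j ∈ Finset.range k, τ j := by
      rw [hc]; linarith
    calc (mb y + e) * 2 ^ k ≤ (c - A / 2 * e * ∑ j ∈ Finset.range k, τ j) * 2 ^ k :=
          mul_le_mul_of_nonneg_right h4 (by positivity)
      _ = _ := mul_comm _ _
      _ ≤ _ := h1
  linarith

/-- The limit is homogeneous, so a point of the convex hull arbitrarily close to `y` can be
multiplied by `N`: the excess of `y` is paid `N` times and the rounding to integer weights once. -/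
theorem nsmul_sub_limit_le {μ K A : ℝ} (hl : 0 < l) (hlL : l ≤ L) (hμ : 0 < μ) (hK : μ ≤ K)
    (hA : 0 ≤ A)
    (hcross : ∀ (q : Space d) (s β u : ℝ), 1 ≤ u → 0 < s → β ≤ L * u →
      (∀ z, s ≤ inner ℝ q z → β ≤ f z) →
      ∀ z, 2 * s ≤ inner ℝ q z → 2 * β - A * fluctScale μ u ≤ f z)
    {y : Space d} (hy : 1 ≤ ‖y‖) {N : ℕ} (hN : 0 < N) :
    f (N • y) - mb (N • y) ≤ N * ((A / 2 * dyadicErr K + 1) * fluctScale μ ‖y‖) +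
      L * ((d + 1) * ((L * ‖y‖ + (A / 2 * dyadicErr K + 1) * fluctScale μ ‖y‖) / l)) := by
  have hL : 0 < L := hl.trans_le hlL
  have hκ := log_one_add_inv_pos (hμ.trans_le hK)
  have hdy0 : 0 ≤ dyadicErr K := tsum_nonneg fun j => by positivity
  have he0 := fluctScale_pos hμ (one_pos.trans_le hy)
  have hmem := hf.mem_closure_convexHull hmb hl hlL hμ hK hA hcross hy
  have hmb0 := hf.limit_nonneg hmb hl.le y
  have hmble := hf.limit_le_norm hmb y
  rw [limit_nsmul hmb hN]
  set E := (A / 2 * dyadicErr K + 1) * fluctScale μ ‖y‖ with hE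
  have hE0 : 0 ≤ E := by positivity
  have hN' : (0 : ℝ) < N := by exact_mod_cast hN
  refine le_of_forall_pos_le_add fun ε hε => ?_
  obtain ⟨x, hx, hxy⟩ := Metric.mem_closure_iff.1 hmem (ε / (L * N)) (by positivity)
  have h1 := hf.nsmul_le_of_mem_convexHull hl hlL (add_nonneg hmb0 hE0) hx N
  have h2 := hf.le_add_norm (N • y) (N • x)
  have h3 : L * ‖N • y - N • x‖ ≤ ε := by
    rw [← nsmul_sub, ← Nat.cast_smul_eq_nsmul ℝ, norm_smul, Real.norm_of_nonneg hN'.le,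
      ← dist_eq_norm]
    rw [lt_div_iff₀ (by positivity)] at hxy
    linarith
  have h4 : L * ((d + 1) * ((mb y + E) / l)) ≤ L * ((d + 1) * ((L * ‖y‖ + E) / l)) := by
    gcongr
  linarith

set_option maxHeartbeats 800000 in
/-- The non-random error: the mean exceeds its limit by at most the stated power of the
distance. -/
theorem sub_limit_le {μ K A M : ℝ} (hlL : l ≤ L) (hμ : 0 < μ) (hK : μ ≤ K) (hA : 0 ≤ A)
    (hM : 0 < M) (hlM : l = μ / M)
    (hcross : ∀ (q : Space d) (s β u : ℝ), 1 ≤ u → 0 < s → β ≤ L * u →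
      (∀ z, s ≤ inner ℝ q z → β ≤ f z) →
      ∀ z, 2 * s ≤ inner ℝ q z → 2 * β - A * fluctScale μ u ≤ f z)
    {y : Space d} (hy : 1 ≤ ‖y‖) :
    f y - mb y ≤ (L / √(Real.log (1 + 1 / K)) + (A / 2 * dyadicErr K + 1) +
        L * (d + 1) * M * (2 * L / √(Real.log (1 + 1 / K)) + 2 * (A / 2 * dyadicErr K + 1))) *
      ((‖y‖ ^ (1 / 2 : ℝ) / μ ^ (3 / 2 : ℝ) + ‖y‖ ^ (2 / 3 : ℝ) / μ) *
        Real.log (1 + ‖y‖ / μ) ^ (1 / 2 : ℝ)) := by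
  have hl : 0 < l := by rw [hlM]; positivity
  have hL : 0 < L := hl.trans_le hlL
  have hK0 : 0 < K := hμ.trans_le hK
  have hκ := log_one_add_inv_pos hK0
  have hκℓ := log_inv_le hμ hK hy
  have hdy0 : 0 ≤ dyadicErr K := tsum_nonneg fun j => by positivity
  set κ := Real.log (1 + 1 / K)
  set n := ‖y‖ with hn
  set ℓ := Real.log (1 + n / μ) with hℓ
  have hℓ0 : 0 < ℓ := hκ.trans_le hκℓ
  set B := A / 2 * dyadicErr K + 1 with hB
  have hB0 : 0 ≤ B := by positivity
  have hn0 : 0 < n := one_pos.trans_le hy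
  set c := n ^ (1 / 3 : ℝ) with hc
  have hc3 : c ^ 3 = n := by
    rw [hc, ← Real.rpow_natCast, ← Real.rpow_mul hn0.le]; norm_num
  have hc2 : n ^ (2 / 3 : ℝ) = c ^ 2 := by
    rw [hc, ← Real.rpow_natCast, ← Real.rpow_mul hn0.le]; norm_num
  have hc1 : 1 ≤ c := Real.one_le_rpow hy (by norm_num)
  have hc0 : 0 < c := one_pos.trans_le hc1
  have hμ3 : μ ^ (3 / 2 : ℝ) = √(μ ^ 3) := by
    rw [Real.sqrt_eq_rpow, ← Real.rpow_natCast, ← Real.rpow_mul hμ.le]; norm_num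
  rw [hc2, ← Real.sqrt_eq_rpow, ← Real.sqrt_eq_rpow, hμ3]
  set S := √ℓ with hS
  have hS0 : 0 < S := Real.sqrt_pos.2 hℓ0
  set k := √κ with hk
  have hk0 : 0 < k := Real.sqrt_pos.2 hκ
  have hkS : k ≤ S := Real.sqrt_le_sqrt hκℓ
  have hSk : 1 ≤ S / k := (one_le_div hk0).2 hkS
  -- For `‖y‖ < μ⁻³` the trivial bound `L * ‖y‖` is already below the term `‖y‖ ^ (1/2) / μ ^
  -- (3/2)`.
  rcases lt_or_ge (c * μ) 1 with hsmall | hbig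
  · have h1 : f y - mb y ≤ L * n := by linarith [hf.upper y, hf.limit_nonneg hmb hl.le y]
    have h2 : n ≤ √n / √(μ ^ 3) := by
      rw [le_div_iff₀ (Real.sqrt_pos.2 (by positivity))]
      have h3 : √n * √(μ ^ 3) ≤ 1 := by
        rw [← Real.sqrt_mul hn0.le, ← hc3, ← mul_pow]
        exact Real.sqrt_le_one.2 (pow_le_one₀ (by positivity) hsmall.le)
      calc n * √(μ ^ 3) = √n * (√n * √(μ ^ 3)) := by
            rw [← mul_assoc, Real.mul_self_sqrt hn0.le]
        _ ≤ √n * 1 := mul_le_mul_of_nonneg_left h3 (Real.sqrt_nonneg _)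
        _ = √n := mul_one _
    calc f y - mb y ≤ L * n := h1
      _ ≤ L * (√n / √(μ ^ 3)) := mul_le_mul_of_nonneg_left h2 hL.le
      _ ≤ L * (√n / √(μ ^ 3)) * (S / k) := le_mul_of_one_le_right (by positivity) hSk
      _ = L / k * (√n / √(μ ^ 3) * S) := by ring
      _ ≤ _ := by
        refine mul_le_mul ?_ ?_ (by positivity) (by positivity)
        · have : 0 ≤ L * (d + 1) * M * (2 * L / k + 2 * B) := by positivity
          linarith
        · refine mul_le_mul_of_nonneg_right ?_ hS0.le
          have : 0 ≤ c ^ 2 / μ := by positivity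
          linarith
  -- With `x = y / N`, the `N` excesses cost about `√(N * ‖y‖) / μ` and the rounding about `‖y‖ / (N
  -- * μ)`. These balance at `N ≈ ‖y‖ ^ (1/3)`, both being of order `‖y‖ ^ (2/3) / μ`.
  · set N := ⌊c⌋₊ with hNdef
    have hN1 : 1 ≤ N := Nat.le_floor (by simpa using hc1)
    have hN0 : (0 : ℝ) < N := by exact_mod_cast hN1
    have hNle : (N : ℝ) ≤ c := Nat.floor_le hc0.le
    have hN2 : c ≤ 2 * N := by
      have h1 : c < N + 1 := Nat.lt_floor_add_one c
      have h2 : (1 : ℝ) ≤ N := by exact_mod_cast hN1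
      linarith
    set x : Space d := (N : ℝ)⁻¹ • y with hx
    have hxy : N • x = y := by
      rw [hx, ← Nat.cast_smul_eq_nsmul ℝ, smul_inv_smul₀ hN0.ne']
    set v := ‖x‖ with hv
    have hvn : N * v = n := by
      rw [hn, ← hxy, ← Nat.cast_smul_eq_nsmul ℝ, norm_smul, Real.norm_of_nonneg hN0.le]
    have hv2 : v ≤ 2 * c ^ 2 := by
      have h1 : N * v ≤ N * (2 * c ^ 2) := by
        rw [hvn, ← hc3]; nlinarith [pow_pos hc0 2]
      exact le_of_mul_le_mul_left h1 hN0
    have hv1 : 1 ≤ v := by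
      have h1 : (N : ℝ) * 1 ≤ N * v := by
        rw [hvn, ← hc3, mul_one]
        nlinarith [pow_pos hc0 2, one_le_pow₀ hc1 (n := 2)]
      exact le_of_mul_le_mul_left h1 hN0
    have hvlen : v ≤ n := by
      have h2 : (1 : ℝ) ≤ N := by exact_mod_cast hN1
      nlinarith
    have hfl : fluctScale μ v ≤ √v * S / μ := by
      unfold fluctScale
      rw [Real.sqrt_mul (by linarith)]
      have hlog : Real.log (1 + v / μ) ≤ ℓ := by
        refine Real.log_le_log (by positivity) ?_
        gcongr
      have hlog' : √(Real.log (1 + v / μ)) ≤ S := Real.sqrt_le_sqrt hlog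
      gcongr
    have hNv : N * √v ≤ c ^ 2 := by
      refine le_of_sq_le_sq ?_ (by positivity)
      rw [mul_pow, Real.sq_sqrt (by linarith)]
      calc (N : ℝ) ^ 2 * v = N * n := by rw [← hvn]; ring
        _ ≤ c * n := by gcongr
        _ = (c ^ 2) ^ 2 := by rw [← hc3]; ring
    have hsv : √v ≤ 2 * c := by
      rw [Real.sqrt_le_left (by positivity)]
      have h1 : (2 * c) ^ 2 = 4 * c ^ 2 := by ring
      linarith [pow_pos hc0 2]
    have hmain := hf.nsmul_sub_limit_le hmb hl hlL hμ hK hA hcross hv1 hN1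
    rw [hxy, ← hB, ← hv] at hmain
    have e1 : N * (B * fluctScale μ v) ≤ B * (c ^ 2 / μ * S) := by
      calc N * (B * fluctScale μ v) ≤ N * (B * (√v * S / μ)) := by gcongr
        _ = B * (N * √v / μ * S) := by ring
        _ ≤ B * (c ^ 2 / μ * S) := by gcongr
    have e2 : L * v / l ≤ M * (2 * L / k) * (c ^ 2 / μ * S) := by
      calc L * v / l = M * L * v / μ := by rw [hlM]; field_simp
        _ ≤ M * L * (2 * c ^ 2) / μ := by gcongr
        _ ≤ M * L * (2 * c ^ 2) / μ * (S / k) := le_mul_of_one_le_right (by positivity) hSk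
        _ = _ := by ring
    -- Dividing by `l = μ / M` produces `c / μ ^ 2`; the case assumption `1 ≤ c * μ` trades one
    -- factor `1 / μ` for `c`.
    have e3 : B * fluctScale μ v / l ≤ M * (2 * B) * (c ^ 2 / μ * S) := by
      calc B * fluctScale μ v / l ≤ B * (√v * S / μ) / l := by gcongr
        _ ≤ B * ((2 * c) * S / μ) / l := by gcongr
        _ = M * (2 * B) * (c * 1 / μ ^ 2 * S) := by rw [hlM]; field_simp
        _ ≤ M * (2 * B) * (c * (c * μ) / μ ^ 2 * S) := by gcongr
        _ = _ := by field_simp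
    have e4 : L * ((d + 1) * ((L * v + B * fluctScale μ v) / l)) ≤
        L * (d + 1) * M * (2 * L / k + 2 * B) * (c ^ 2 / μ * S) := by
      rw [add_div]
      calc _ ≤ L * ((d + 1) * (M * (2 * L / k) * (c ^ 2 / μ * S) +
            M * (2 * B) * (c ^ 2 / μ * S))) := by gcongr
        _ = _ := by ring
    calc f y - mb y ≤ B * (c ^ 2 / μ * S) +
          L * (d + 1) * M * (2 * L / k + 2 * B) * (c ^ 2 / μ * S) := by linarith
      _ = (B + L * (d + 1) * M * (2 * L / k + 2 * B)) * (c ^ 2 / μ * S) := by ring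
      _ ≤ _ := by
        refine mul_le_mul ?_ ?_ (by positivity) (by positivity)
        · have : 0 ≤ L / k := by positivity
          linarith
        · refine mul_le_mul_of_nonneg_right ?_ hS0.le
          have : 0 ≤ √n / √(μ ^ 3) := by positivity
          linarith

end IsSubadditiveNormLike

end Bias

/-! ### Translation of chains -/

section Translation

variable {E : Type*} [NormedAddCommGroup E] [InnerProductSpace ℝ E] {C : E → Set E}

theorem SegLt.translate {x y : E} {b : ℝ} (h : SegLt C x y b) (a : E) :
    SegLt (fun u => C (u + a)) (x - a) (y - a) b := by
  intro u hu p hp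
  have hu' : u + a ∈ segment ℝ x y := by
    have := (mem_segment_translate ℝ a (x := u) (b := x - a) (c := y - a)).2 hu
    simpa [add_comm a] using this
  simpa using h (u + a) hu' p hp

theorem Reach.translate {x z : E} {b : ℝ} (h : Reach C Set.univ x z b) (a : E) :
    Reach (fun u => C (u + a)) Set.univ (x - a) (z - a) b := by
  induction h with
  | refl _ hb => exact .refl (Set.mem_univ _) hb
  | step _ _ hs ih => exact .step ih (Set.subset_univ _) (hs.translate a)

theorem chainDist_translate (C : E → Set E) (x z a : E) :
    chainDist (fun u => C (u + a)) (x - a) (z - a) = chainDist C x z := by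
  unfold chainDist
  congr 1
  ext b
  refine ⟨fun h => ?_, fun h => Reach.translate h a⟩
  have := Reach.translate h (-a)
  simpa using this

end Translation

/-! ### The mean passage cost is almost superadditive across hyperplanes -/

section Crossing

variable {d : ℕ}

/-- The net consists of integer points: taking integer parts of the coordinates moves a point by at
most the diameter `√d` of the unit cube. -/
theorem exists_lattice_net (d : ℕ) {ρ : ℝ} (hρ : 0 ≤ ρ) :
    ∃ J : Finset (Space d), (∀ u, ‖u‖ ≤ ρ → ∃ x ∈ J, ‖u - x‖ ≤ √d) ∧
      (∀ x ∈ J, ‖x‖ ≤ ρ + √d) ∧ (J.card : ℝ) ≤ (2 * ρ + 3) ^ d := by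
  classical
  let m : ℤ := ⌈ρ⌉
  have hm : 0 ≤ m := Int.ceil_nonneg hρ
  let J₀ : Finset (Space d) := (Fintype.piFinset fun _ : Fin d => Finset.Icc (-m) m).image
    fun k => WithLp.toLp 2 fun i => (k i : ℝ)
  refine ⟨J₀.filter fun x => ‖x‖ ≤ ρ + √d, fun u hu => ?_, fun x hx => (Finset.mem_filter.1 hx).2,
    ?_⟩
  · set x : Space d := WithLp.toLp 2 fun i => (⌊u i⌋ : ℝ) with hx
    have hux : ‖u - x‖ ≤ √d := by
      rw [EuclideanSpace.norm_eq]
      refine Real.sqrt_le_sqrt ?_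
      calc ∑ i, ‖(u - x) i‖ ^ 2 ≤ ∑ _i : Fin d, (1 : ℝ) := by
            refine Finset.sum_le_sum fun i _ => ?_
            have h1 : (u - x) i = Int.fract (u i) := by
              simp only [hx, PiLp.sub_apply]
              exact Int.self_sub_floor (u i)
            rw [h1, Real.norm_of_nonneg (Int.fract_nonneg _)]
            exact pow_le_one₀ (Int.fract_nonneg _) (Int.fract_lt_one _).le
        _ = d := by simp
    refine ⟨x, Finset.mem_filter.2 ⟨Finset.mem_image.2 ⟨fun i => ⌊u i⌋, ?_, rfl⟩, ?_⟩, hux⟩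
    · rw [Fintype.mem_piFinset]
      intro i
      have h1 : |u i| ≤ ρ := by
        have := PiLp.norm_apply_le u i
        rw [Real.norm_eq_abs] at this
        exact this.trans hu
      rw [abs_le] at h1
      rw [Finset.mem_Icc]
      constructor
      · rw [Int.le_floor]
        push_cast
        linarith [Int.le_ceil ρ]
      · exact (Int.floor_le_floor h1.2).trans (Int.floor_le_ceil ρ)
    · have := norm_sub_norm_le x u
      rw [norm_sub_rev] at this
      linarith
  · calc (((J₀.filter fun x => ‖x‖ ≤ ρ + √d).card : ℕ) : ℝ) ≤ (2 * m + 1 : ℝ) ^ d := by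
          have h1 : (J₀.filter fun x => ‖x‖ ≤ ρ + √d).card ≤ (2 * m + 1).toNat ^ d := by
            refine (Finset.card_filter_le _ _).trans (Finset.card_image_le.trans ?_)
            rw [Fintype.card_piFinset]
            simp only [Int.card_Icc, Finset.prod_const, Finset.card_univ, Fintype.card_fin]
            refine Nat.pow_le_pow_left (Int.toNat_le_toNat ?_) d
            linarith
          have h2 : (((2 * m + 1).toNat : ℕ) : ℝ) = 2 * m + 1 := by
            have : (((2 * m + 1).toNat : ℕ) : ℤ) = 2 * m + 1 := Int.toNat_of_nonneg (by omega)
            exact_mod_cast this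
          rw [← h2]
          exact_mod_cast h1
      _ ≤ (2 * ρ + 3) ^ d := by
          have h1 : (m : ℝ) < ρ + 1 := Int.ceil_lt_add_one ρ
          have h2 : (0 : ℝ) ≤ m := by exact_mod_cast hm
          exact pow_le_pow_left₀ (by linarith) (by linarith) d

variable {Ω : Type*} [MeasurableSpace Ω] {P : Measure Ω} [IsProbabilityMeasure P]
  {τ : Space d → Ω → Ω} {H : Space d → Space d → Ω → ℝ} {μ l L : ℝ}

omit [IsProbabilityMeasure P] in
theorem StandingAssumptions.measurable_apply (hH : StandingAssumptions P τ H) (p x : Space d) :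
    Measurable (H p x) :=
  hH.measurable.comp (measurable_const.prodMk (measurable_const.prodMk measurable_id))

omit [IsProbabilityMeasure P] in
-- Joint continuity is contained in the precompactness hypothesis, whose functions are elements of
-- `C(B_R × ℝ^d)`; the balls are open, so continuity passes to the whole space.
theorem StandingAssumptions.continuous (hH : StandingAssumptions P τ H) (ω : Ω) :
    Continuous fun z : Space d × Space d => H z.1 z.2 ω := by
  rw [continuous_iff_continuousAt]
  rintro ⟨p, y⟩
  obtain ⟨f, hf, -⟩ := hH.precompact (‖p‖ + 1) (by positivity)
  have hp : p ∈ Metric.ball (0 : Space d) (‖p‖ + 1) := by simp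
  have hemb := (Metric.isOpen_ball (x := (0 : Space d))
    (ε := ‖p‖ + 1)).isOpenEmbedding_subtypeVal.prodMap (IsOpenEmbedding.id (X := Space d))
  have h1 := hemb.continuousAt_iff (g := fun z : Space d × Space d => H z.1 z.2 ω)
    (x := (⟨p, hp⟩, y))
  refine h1.1 ?_
  have h2 : (fun z : Space d × Space d => H z.1 z.2 ω) ∘
      Prod.map (Subtype.val : Metric.ball (0 : Space d) (‖p‖ + 1) → Space d) id = f ω := by
    funext z
    exact (hf ω z).symm
  rw [h2]
  exact (f ω).continuous.continuousAt

/-- The expected passage cost from the origin. -/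
noncomputable def meanDist (P : Measure Ω) (H : Space d → Space d → Ω → ℝ) (μ l L : ℝ)
    (z : Space d) : ℝ :=
  ∫ ω, chainDist (costField H μ l L Set.univ ω) 0 z ∂P

variable (hH : StandingAssumptions P τ H) (hl : 0 < l) (hlL : l ≤ L)
include hH

omit [IsProbabilityMeasure P] in
theorem StandingAssumptions.chainDist_comp (x z : Space d) (ω : Ω) :
    chainDist (costField H μ l L Set.univ (τ x ω)) 0 (z - x) =
      chainDist (costField H μ l L Set.univ ω) x z := by
  rw [← chainDist_translate (costField H μ l L Set.univ ω) x z x, sub_self]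
  congr 1
  funext u
  simp only [costField, hH.stationary, Set.mem_univ]

include hl hlL

omit [IsProbabilityMeasure P] in
theorem StandingAssumptions.isCostField (ω : Ω) :
    IsCostField (costField H μ l L Set.univ ω) L :=
  isCostField_costField hH.continuous hl.le hlL isClosed_univ ω

omit [IsProbabilityMeasure P] in
theorem StandingAssumptions.measurable_chainDist (x z : Space d) :
    Measurable fun ω => chainDist (costField H μ l L Set.univ ω) x z :=
  (HJ.measurable_chainDist hH.continuous hl.le hlL x z).mono (sigmaAlg_le hH.measurable_apply _)
    le_rfl

theorem StandingAssumptions.integrable_chainDist (x z : Space d) :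
    Integrable (fun ω => chainDist (costField H μ l L Set.univ ω) x z) P :=
  Integrable.of_bound (C := L * ‖z - x‖)
    (hH.measurable_chainDist hl hlL x z).aestronglyMeasurable
    (Eventually.of_forall fun ω => by
      rw [Real.norm_of_nonneg ((hH.isCostField hl hlL ω).chainDist_nonneg x z)]
      exact (hH.isCostField hl hlL ω).chainDist_le_norm x z)

omit [IsProbabilityMeasure P] in
theorem StandingAssumptions.integral_chainDist (x z : Space d) :
    ∫ ω, chainDist (costField H μ l L Set.univ ω) x z ∂P = meanDist P H μ l L (z - x) := by
  have hτ := hH.measurePreserving x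
  unfold meanDist
  conv_rhs => rw [← hτ.map_eq]
  rw [integral_map hτ.measurable.aemeasurable
    (hH.measurable_chainDist hl hlL 0 (z - x)).aestronglyMeasurable]
  simp only [hH.chainDist_comp]

theorem StandingAssumptions.isSubadditiveNormLike :
    IsSubadditiveNormLike (meanDist P H μ l L) l L where
  add_le x y := by
    have h1 := hH.integral_chainDist (μ := μ) hl hlL x (x + y)
    rw [add_sub_cancel_left] at h1
    rw [← h1]
    unfold meanDist
    rw [← integral_add (hH.integrable_chainDist hl hlL 0 x)
      (hH.integrable_chainDist hl hlL x (x + y))]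
    exact integral_mono (hH.integrable_chainDist hl hlL 0 (x + y))
      ((hH.integrable_chainDist hl hlL 0 x).add (hH.integrable_chainDist hl hlL x (x + y)))
      fun ω => (hH.isCostField hl hlL ω).chainDist_triangle 0 x (x + y)
  lower x := by
    have h := integral_mono (integrable_const (l * ‖x‖)) (hH.integrable_chainDist (μ := μ) hl hlL 0 x)
      fun ω => by
        simpa using (hH.isCostField hl hlL ω).norm_le_chainDist hl.le
          (mem_costField_of_norm_le ω) 0 x
    simpa [meanDist] using h
  upper x := by
    have h := integral_mono (hH.integrable_chainDist (μ := μ) hl hlL 0 x) (integrable_const (L * ‖x‖))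
      fun ω => by simpa using (hH.isCostField hl hlL ω).chainDist_le_norm 0 x
    simpa [meanDist] using h

theorem StandingAssumptions.concentration {y : Space d} {R : ℝ} (hR : 1 ≤ R) (hy : ‖y‖ ≤ R)
    {r : ℝ} (hr : 0 ≤ r) :
    P.real {ω | r ≤ chainDist (costField H μ l L Set.univ ω) 0 y - meanDist P H μ l L y} ≤
      Real.exp (-(l * r ^ 2 / (1568 * L ^ 3 * R))) ∧
    P.real {ω | chainDist (costField H μ l L Set.univ ω) 0 y - meanDist P H μ l L y ≤ -r} ≤
      Real.exp (-(l * r ^ 2 / (1568 * L ^ 3 * R))) :=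
  chainDist_concentration hH.measurable_apply hH.continuous hH.finiteRange hl hlL hR hy hr

theorem StandingAssumptions.lower_tail {x z : Space d} {R : ℝ} (hR : 1 ≤ R) (hz : ‖z - x‖ ≤ R)
    {r : ℝ} (hr : 0 ≤ r) :
    P.real {ω | chainDist (costField H μ l L Set.univ ω) x z - meanDist P H μ l L (z - x) ≤ -r} ≤
      Real.exp (-(l * r ^ 2 / (1568 * L ^ 3 * R))) := by
  have hτ := hH.measurePreserving x
  have hm : MeasurableSet {ω | chainDist (costField H μ l L Set.univ ω) 0 (z - x) -
      meanDist P H μ l L (z - x) ≤ -r} :=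
    measurableSet_le ((hH.measurable_chainDist hl hlL 0 (z - x)).sub_const _) measurable_const
  have h1 := hτ.measure_preimage hm.nullMeasurableSet
  simp only [Set.preimage_ofPred_eq, hH.chainDist_comp] at h1
  rw [Measure.real, h1]
  exact (hH.concentration hl hlL hR hz hr).2

/-- Superadditivity across a hyperplane, up to the fluctuations. -/
theorem StandingAssumptions.crossing {q z : Space d} {s β r ρ δ R : ℝ} (hs : 0 < s)
    (hβ : ∀ z, s ≤ inner ℝ q z → β ≤ meanDist P H μ l L z) (hz : 2 * s ≤ inner ℝ q z)
    (hr : 0 < r) (hR : 1 ≤ R) {J : Finset (Space d)}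
    (hJ : ∀ u, ‖u‖ ≤ ρ → ∃ x ∈ J, ‖u - x‖ ≤ δ) (hJR : ∀ x ∈ J, ‖x‖ ≤ R)
    (hJz : ∀ x ∈ J, ‖z - x‖ ≤ R) (hzR : ‖z‖ ≤ R)
    (hρ : meanDist P H μ l L z + r + 1 ≤ l * ρ)
    (hprob : (1 + 2 * (J.card : ℝ)) * Real.exp (-(l * r ^ 2 / (1568 * L ^ 3 * R))) < 1) :
    2 * β - 3 * r - 4 * L * δ - 1 ≤ meanDist P H μ l L z := by
  set f := meanDist P H μ l L
  have hf : IsSubadditiveNormLike f l L := hH.isSubadditiveNormLike hl hlL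
  have hL : 0 < L := hl.trans_le hlL
  set ε := Real.exp (-(l * r ^ 2 / (1568 * L ^ 3 * R)))
  set D : Ω → Space d → Space d → ℝ := fun ω => chainDist (costField H μ l L Set.univ ω)
  -- A single good environment suffices, since the conclusion is deterministic. It exists because
  -- the `1 + 2 * J.card` bad events do not cover the whole space.
  obtain ⟨ω, hω0, hω1, hω2⟩ : ∃ ω, D ω 0 z - f z < r ∧ (∀ x ∈ J, -r < D ω 0 x - f x) ∧
      ∀ x ∈ J, -r < D ω x z - f (z - x) := by
    by_contra! hcon
    have hcover : Set.univ ⊆ {ω | r ≤ D ω 0 z - f z} ∪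
        ((⋃ x ∈ J, {ω | D ω 0 x - f x ≤ -r}) ∪ ⋃ x ∈ J, {ω | D ω x z - f (z - x) ≤ -r}) := by
      intro ω _
      by_cases h0 : D ω 0 z - f z < r
      · by_cases h1 : ∀ x ∈ J, -r < D ω 0 x - f x
        · obtain ⟨x, hx, hx'⟩ := hcon ω h0 h1
          exact Or.inr (Or.inr (Set.mem_biUnion hx hx'))
        · push Not at h1
          obtain ⟨x, hx, hx'⟩ := h1
          exact Or.inr (Or.inl (Set.mem_biUnion hx hx'))
      · exact Or.inl (not_lt.1 h0)
    have h1 : P.real (⋃ x ∈ J, {ω | D ω 0 x - f x ≤ -r}) ≤ J.card * ε := by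
      refine (measureReal_biUnion_finset_le _ _).trans ?_
      rw [← nsmul_eq_mul]
      exact Finset.sum_le_card_nsmul _ _ _ fun x hx =>
        (hH.concentration hl hlL hR (hJR x hx) hr.le).2
    have h2 : P.real (⋃ x ∈ J, {ω | D ω x z - f (z - x) ≤ -r}) ≤ J.card * ε := by
      refine (measureReal_biUnion_finset_le _ _).trans ?_
      rw [← nsmul_eq_mul]
      exact Finset.sum_le_card_nsmul _ _ _ fun x hx => hH.lower_tail hl hlL hR (hJz x hx) hr.le
    have h0 := (hH.concentration (μ := μ) hl hlL hR hzR hr.le).1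
    have h3 : (1 : ℝ) ≤ ε + (J.card * ε + J.card * ε) := by
      calc (1 : ℝ) = P.real Set.univ := by simp
        _ ≤ _ := measureReal_mono hcover
        _ ≤ _ := (measureReal_union_le _ _).trans
            (add_le_add h0 ((measureReal_union_le _ _).trans (add_le_add h1 h2)))
    linarith
  have hC := hH.isCostField (μ := μ) hl hlL ω
  have hreach := hC.reach_of_chainDist_lt (show D ω 0 z < f z + r by linarith)
  have hcontq : Continuous fun u : Space d => inner ℝ q u := by fun_prop
  have hF : IsClosed {u : Space d | inner ℝ q u ≤ s} := isClosed_le hcontq continuous_const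
  -- The chain crosses the hyperplane `⟪q, u⟫ = s`, and both `u` and `z - u` lie in the half-space
  -- where `f ≥ β`. Replacing `u` by a net point `x` costs `4 * L * δ`: twice in the metric and
  -- twice in `f`.
  obtain ⟨u, hu, huc, a₁, a₂, hab, h1, h2⟩ := hreach.lastExit hF
    (show inner ℝ q (0 : Space d) ≤ s by rw [inner_zero_right]; exact hs.le)
    (show ¬ inner ℝ q z ≤ s by linarith) one_pos
  have hus : s ≤ inner ℝ q u := by
    have hsub : closure {u : Space d | inner ℝ q u ≤ s}ᶜ ⊆ {u | s ≤ inner ℝ q u} :=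
      closure_minimal (fun u hu => (lt_of_not_ge (show ¬ inner ℝ q u ≤ s from hu)).le)
        (isClosed_le continuous_const hcontq)
    exact hsub huc
  have hus' : inner ℝ q u ≤ s := hu
  have ha1 := h1.norm_lt hl.le (mem_costField_of_norm_le ω)
  have ha2 := h2.pos hC.zero_mem
  rw [sub_zero] at ha1
  have hunorm : ‖u‖ ≤ ρ := le_of_mul_le_mul_left (by linarith) hl
  obtain ⟨x, hx, hux⟩ := hJ u hunorm
  have hLux : L * ‖u - x‖ ≤ L * δ := mul_le_mul_of_nonneg_left hux hL.le
  have hLxu : L * ‖x - u‖ ≤ L * δ := by rwa [norm_sub_rev]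
  have hd1 : D ω 0 u ≤ a₁ := hC.chainDist_le h1
  have hd2 : D ω u z ≤ a₂ := hC.chainDist_le (h2.mono_set (Set.subset_univ _))
  have e1 : D ω 0 x ≤ D ω 0 u + D ω u x := hC.chainDist_triangle 0 u x
  have e2 : D ω x z ≤ D ω x u + D ω u z := hC.chainDist_triangle x u z
  have e3 : D ω u x ≤ L * ‖x - u‖ := hC.chainDist_le_norm u x
  have e4 : D ω x u ≤ L * ‖u - x‖ := hC.chainDist_le_norm x u
  have e5 := hf.le_add_norm u x
  have e6 := hf.le_add_norm (z - u) (z - x)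
  rw [sub_sub_sub_cancel_left] at e6
  have e7 := hβ u hus
  have e8 := hβ (z - u) (by rw [inner_sub_right]; linarith)
  have e9 := hω1 x hx
  have e10 := hω2 x hx
  linarith

set_option maxHeartbeats 800000 in
/-- The crossing estimate with the error expressed through the fluctuation scale. -/
theorem StandingAssumptions.crossing_fluctScale {K M : ℝ} (hL1 : 1 ≤ L) (hμ : 0 < μ) (hK : μ ≤ K)
    (hM : 1 ≤ M) (hlM : l = μ / M) {w A₁ CR CJ : ℝ}
    (hCR : CR = M * (3 * L + 1) + √d * K + 2 * L * M)
    (hCJ : CJ = 2 * M * (3 * L + 1) + 3 * K)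
    (hw : w = Real.log (4 * (CJ + 1) ^ d) / Real.log (1 + 1 / K) + d)
    (hA₁ : A₁ = √((w + 1) * (1568 * L ^ 3 * M * CR)))
    (q : Space d) (s β u : ℝ) (hu : 1 ≤ u) (hs : 0 < s) (hβu : β ≤ L * u)
    (hβ : ∀ z, s ≤ inner ℝ q z → β ≤ meanDist P H μ l L z) (z : Space d)
    (hz : 2 * s ≤ inner ℝ q z) :
    2 * β - (3 * A₁ + (4 * L * √d + 1) * (K / √(Real.log (1 + 1 / K)))) * fluctScale μ u ≤
      meanDist P H μ l L z := by
  have hf := hH.isSubadditiveNormLike (μ := μ) hl hlL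
  have hL : 0 < L := hl.trans_le hlL
  have hK0 : 0 < K := hμ.trans_le hK
  have hM0 : 0 < M := one_pos.trans_le hM
  have hu0 : 0 < u := one_pos.trans_le hu
  have hκ := log_one_add_inv_pos hK0
  have hκℓ := log_inv_le hμ hK hu
  have he0 := fluctScale_pos hμ hu0
  have hCR0 : 0 < CR := by rw [hCR]; positivity
  have hCJ0 : 0 < CJ := by rw [hCJ]; positivity
  have hlog4 : 0 ≤ Real.log (4 * (CJ + 1) ^ d) := by
    refine Real.log_nonneg ?_
    have : 1 ≤ (CJ + 1) ^ d := one_le_pow₀ (by linarith)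
    linarith
  have hw0 : 0 ≤ w := by rw [hw]; positivity
  have hA0 : 0 < A₁ := by rw [hA₁]; positivity
  set κ := Real.log (1 + 1 / K) with hκdef
  set ℓ := Real.log (1 + u / μ) with hℓdef
  have hℓ0 : 0 < ℓ := hκ.trans_le hκℓ
  have hB0 : 0 ≤ (4 * L * √d + 1) * (K / √κ) := by positivity
  have hBe : 4 * L * √d + 1 ≤ (4 * L * √d + 1) * (K / √κ) * fluctScale μ u := by
    have h1 : 1 ≤ K / √κ * fluctScale μ u := by
      unfold fluctScale
      rw [div_mul_div_comm, one_le_div (by positivity)]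
      have h2 : √κ ≤ √(u * ℓ) :=
        Real.sqrt_le_sqrt (hκℓ.trans (le_mul_of_one_le_left hℓ0.le hu))
      calc √κ * μ ≤ √(u * ℓ) * K := mul_le_mul h2 hK hμ.le (Real.sqrt_nonneg _)
        _ = _ := mul_comm _ _
    have h3 := le_mul_of_one_le_right (show 0 ≤ 4 * L * √d + 1 by positivity) h1
    rwa [← mul_assoc] at h3
  set r := A₁ * fluctScale μ u with hr
  have hr0 : 0 < r := mul_pos hA0 he0
  have hexpand : (3 * A₁ + (4 * L * √d + 1) * (K / √κ)) * fluctScale μ u =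
      3 * r + (4 * L * √d + 1) * (K / √κ) * fluctScale μ u := by rw [hr]; ring
  rw [hexpand]
  -- After two trivial cases one may assume `f z < 2 * β ≤ 2 * L * u` and `r ≤ L * u`. This bounds
  -- `z` and makes `ρ = (3 * L * u + 1) / l` large enough for the crossing point.
  rcases le_or_gt (2 * β) (meanDist P H μ l L z) with hle | hlt
  · linarith [mul_nonneg hB0 he0.le]
  rcases lt_or_ge (L * u) r with hrbig | hrle
  · linarith [mul_nonneg hB0 he0.le, hf.nonneg hl.le z]
  set ρ := (3 * L * u + 1) / l with hρ
  have hρ0 : 0 ≤ ρ := by positivity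
  obtain ⟨J, hJ, hJn, hJc⟩ := exists_lattice_net d hρ0
  set R := ρ + √d + 2 * L * u / l with hR
  have hznorm : ‖z‖ ≤ 2 * L * u / l := by
    rw [le_div_iff₀' hl]
    linarith [hf.lower z]
  have hρle : ρ ≤ M * (3 * L + 1) * (u / μ) := by
    rw [hρ, hlM, div_div_eq_mul_div]
    rw [mul_div_assoc']
    refine div_le_div_of_nonneg_right ?_ hμ.le
    have h1 : 3 * L * u + 1 ≤ (3 * L + 1) * u := by linarith
    calc (3 * L * u + 1) * M ≤ (3 * L + 1) * u * M := mul_le_mul_of_nonneg_right h1 hM0.le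
      _ = _ := by ring
  have hone : 1 ≤ K * (u / μ) := by
    rw [mul_div_assoc', one_le_div hμ]
    exact hK.trans (le_mul_of_one_le_right hK0.le hu)
  have hRle : R ≤ CR * (u / μ) := by
    have h1 : √d ≤ √d * K * (u / μ) := by
      rw [mul_assoc]
      exact le_mul_of_one_le_right (Real.sqrt_nonneg _) hone
    have h2 : 2 * L * u / l = 2 * L * M * (u / μ) := by rw [hlM]; field_simp
    rw [hR, hCR, h2, add_mul, add_mul]
    linarith
  have hR1 : 1 ≤ R := by
    have h1 : 1 ≤ ρ := by
      rw [hρ, one_le_div hl]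
      have h2 : L * 1 ≤ L * u := mul_le_mul_of_nonneg_left hu hL.le
      linarith
    have h2 : 0 ≤ 2 * L * u / l := by positivity
    linarith [Real.sqrt_nonneg (d : ℝ)]
  -- The net has at most a power of `1 + u / μ` many points. The exponent `w` is chosen so that
  -- their number is below `exp ((w + 1) * ℓ)`, and `A₁` so that the Gaussian exponent is at least
  -- `(w + 1) * ℓ`.
  have hprob : (1 + 2 * (J.card : ℝ)) * Real.exp (-(l * r ^ 2 / (1568 * L ^ 3 * R))) < 1 := by
    have hexp : (w + 1) * ℓ ≤ l * r ^ 2 / (1568 * L ^ 3 * R) := by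
      rw [le_div_iff₀ (by positivity)]
      have h1 : l * r ^ 2 = (w + 1) * ℓ * (1568 * L ^ 3 * (CR * (u / μ))) := by
        have hfs : fluctScale μ u = √(u * ℓ) / μ := rfl
        rw [hr, hA₁, hlM, hfs, mul_pow, Real.sq_sqrt (by positivity), div_pow,
          Real.sq_sqrt (by positivity)]
        field_simp
      rw [h1]
      refine mul_le_mul_of_nonneg_left ?_ (by positivity)
      exact mul_le_mul_of_nonneg_left hRle (by positivity)
    have hcard : 1 + 2 * (J.card : ℝ) < Real.exp ((w + 1) * ℓ) := by
      have h1 : 2 * ρ + 3 ≤ CJ * (1 + u / μ) := by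
        have h7 : 2 * ρ + 3 ≤ CJ * (u / μ) := by
          have : CJ * (u / μ) = 2 * (M * (3 * L + 1) * (u / μ)) + 3 * (K * (u / μ)) := by
            rw [hCJ]; ring
          linarith
        refine h7.trans (mul_le_mul_of_nonneg_left ?_ hCJ0.le)
        linarith
      have hv1 : 1 ≤ 1 + u / μ := by linarith [div_pos hu0 hμ]
      have h2 : (J.card : ℝ) ≤ (CJ + 1) ^ d * (1 + u / μ) ^ d := by
        rw [← mul_pow]
        refine hJc.trans (pow_le_pow_left₀ (by positivity) (h1.trans ?_) d)
        exact mul_le_mul_of_nonneg_right (by linarith) (by linarith)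
      have h3 : 1 ≤ (CJ + 1) ^ d * (1 + u / μ) ^ d :=
        one_le_mul_of_one_le_of_one_le (one_le_pow₀ (by linarith)) (one_le_pow₀ hv1)
      have h4 : 4 * (CJ + 1) ^ d * (1 + u / μ) ^ d ≤ Real.exp (w * ℓ) := by
        rw [← Real.log_le_iff_le_exp (by positivity), Real.log_mul (by positivity)
          (by positivity), Real.log_pow, hw, add_mul]
        have h5 : Real.log (4 * (CJ + 1) ^ d) ≤ Real.log (4 * (CJ + 1) ^ d) / κ * ℓ := by
          rw [div_mul_eq_mul_div, le_div_iff₀ hκ]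
          exact mul_le_mul_of_nonneg_left hκℓ hlog4
        linarith
      have h6 : Real.exp (w * ℓ) ≤ Real.exp ((w + 1) * ℓ) :=
        Real.exp_le_exp.2 (by linarith)
      rw [mul_assoc] at h4
      linarith
    calc (1 + 2 * (J.card : ℝ)) * Real.exp (-(l * r ^ 2 / (1568 * L ^ 3 * R)))
        ≤ (1 + 2 * (J.card : ℝ)) * Real.exp (-((w + 1) * ℓ)) := by gcongr
      _ < Real.exp ((w + 1) * ℓ) * Real.exp (-((w + 1) * ℓ)) :=
          mul_lt_mul_of_pos_right hcard (Real.exp_pos _)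
      _ = 1 := by rw [← Real.exp_add, add_neg_cancel, Real.exp_zero]
  have hlρ : l * ρ = 3 * L * u + 1 := by rw [hρ]; field_simp
  have h := hH.crossing hl hlL (R := R) hs hβ hz hr0 hR1 hJ
    (fun x hx => (hJn x hx).trans (by
      have : 0 ≤ 2 * L * u / l := by positivity
      linarith))
    (fun x hx => (norm_sub_le z x).trans (by linarith [hJn x hx]))
    (by linarith [Real.sqrt_nonneg (d : ℝ)]) (by rw [hlρ]; linarith) hprob
  linarith

end Crossing

/-- Given a parameter `t` on a segment, take the nearest parameters `a ≤ t ≤ b` that belong to the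
closed set. Their midpoint belongs to it too, which forces one of them to equal `t`. -/
theorem convex_of_isClosed_of_midpoint {E : Type*} [NormedAddCommGroup E] [NormedSpace ℝ E]
    {A : Set E} (hA : IsClosed A) (hmid : ∀ p ∈ A, ∀ q ∈ A, (1 / 2 : ℝ) • (p + q) ∈ A) :
    Convex ℝ A := by
  rw [convex_iff_segment_subset]
  intro x hx y hy
  rw [segment_eq_image_lineMap]
  rintro _ ⟨t, ht, rfl⟩
  have hcont : Continuous fun s : ℝ => (AffineMap.lineMap x y s : E) :=
    AffineMap.lineMap_continuous
  have hT : IsClosed ((fun s : ℝ => (AffineMap.lineMap x y s : E)) ⁻¹' A) := hA.preimage hcont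
  set T := (fun s : ℝ => (AffineMap.lineMap x y s : E)) ⁻¹' A with hTdef
  obtain ⟨a, ⟨ha, haT⟩, hmax⟩ := (isCompact_Icc.inter_right hT).exists_isGreatest
    ⟨0, ⟨le_rfl, ht.1⟩, by simpa [hTdef] using hx⟩
  obtain ⟨b, ⟨hb, hbT⟩, hmin⟩ := (isCompact_Icc.inter_right hT).exists_isLeast
    ⟨1, ⟨ht.2, le_rfl⟩, by simpa [hTdef] using hy⟩
  have hm : (a + b) / 2 ∈ T := by
    have h1 := hmid _ haT _ hbT
    have h2 : (1 / 2 : ℝ) • ((AffineMap.lineMap x y a : E) + AffineMap.lineMap x y b) =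
        AffineMap.lineMap x y ((a + b) / 2) := by
      simp only [AffineMap.lineMap_apply, vsub_eq_sub, vadd_eq_add]
      module
    rw [h2] at h1
    exact h1
  rcases le_total ((a + b) / 2) t with h | h
  · have := hmax ⟨⟨by linarith [ha.1, ha.2, hb.1], h⟩, hm⟩
    have e : a = t := by linarith [ha.2, hb.1]
    rw [← e]; exact haT
  · have := hmin ⟨⟨h, by linarith [ha.2, hb.1, hb.2]⟩, hm⟩
    have e : b = t := by linarith [ha.2, hb.1]
    rw [← e]; exact hbT

/-! ### Reduction to the truncated field, and the almost sure limit -/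

section AlmostSure

variable {d : ℕ} {Ω : Type*} [MeasurableSpace Ω] {P : Measure Ω} [IsProbabilityMeasure P]
  {τ : Space d → Ω → Ω} {H : Space d → Space d → Ω → ℝ}

namespace StandingAssumptions

variable (hH : StandingAssumptions P τ H)
include hH

omit [IsProbabilityMeasure P] in
theorem exists_abs_le (p : Space d) : ∃ M : ℝ, ∀ x ω, |H p x ω| ≤ M := by
  obtain ⟨M, hM⟩ := hH.lipschitz (‖p‖ + 1) (by positivity)
  exact ⟨M, fun x ω => (hM x ω).1 p (by simp)⟩

omit [IsProbabilityMeasure P] in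
/-- An almost sure closed condition at the origin holds almost surely at every point. -/
theorem ae_forall_of_ae_zero {p : Space d} {S : Set ℝ} (hS : IsClosed S)
    (h : ∀ᵐ ω ∂P, H p 0 ω ∈ S) : ∀ᵐ ω ∂P, ∀ y, H p y ω ∈ S := by
  have h1 : ∀ y, ∀ᵐ ω ∂P, H p y ω ∈ S := fun y => by
    have h2 := (hH.measurePreserving y).quasiMeasurePreserving.ae h
    filter_upwards [h2] with ω hω
    rwa [hH.stationary, zero_add] at hω
  obtain ⟨D, hDc, hD⟩ := TopologicalSpace.exists_countable_dense (Space d)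
  filter_upwards [(ae_ball_iff hDc).2 fun y _ => h1 y] with ω hω y
  have hcont : Continuous fun y => H p y ω :=
    (hH.continuous ω).comp (continuous_const.prodMk continuous_id)
  have hsub : closure D ⊆ {y | H p y ω ∈ S} :=
    closure_minimal (fun y hy => hω y hy) (hS.preimage hcont)
  exact hsub (hD y)

omit [IsProbabilityMeasure P] in
theorem ae_zero_nonpos : ∀ᵐ ω ∂P, ∀ y, H 0 y ω ≤ 0 := by
  obtain ⟨M, hM⟩ := hH.exists_abs_le 0
  have hb : IsBoundedUnder (· ≤ ·) (ae P) (H 0 0) :=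
    ⟨M, eventually_map.2 (Eventually.of_forall fun ω => (abs_le.1 (hM 0 ω)).2)⟩
  have h := ae_le_essSup hb
  rw [hH.essSup_zero] at h
  exact hH.ae_forall_of_ae_zero isClosed_Iic h

omit [IsProbabilityMeasure P] in
-- Coercivity in the mean of `essInf` has an exceptional null set for each `p`; a countable dense
-- set of momenta and continuity give a common one. The closed bound `K + 1` survives the limit and
-- implies the strict bound `K`.
theorem exists_ae_coercive (K : ℝ) :
    ∃ L : ℝ, 1 ≤ L ∧ ∀ᵐ ω ∂P, ∀ p y, L < ‖p‖ → K < H p y ω := by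
  have h1 := hH.coercive.eventually_ge_atTop (K + 1)
  rw [Filter.Eventually, Filter.mem_cocompact] at h1
  obtain ⟨T, hT, hTsub⟩ := h1
  obtain ⟨r, hr⟩ := hT.isBounded.subset_closedBall 0
  refine ⟨max r 1, le_max_right _ _, ?_⟩
  set L := max r 1
  have hp : ∀ p : Space d, L < ‖p‖ → ∀ᵐ ω ∂P, ∀ y, K + 1 ≤ H p y ω := by
    intro p hp
    have hpT : p ∈ Tᶜ := fun hmem => by
      have := hr hmem
      rw [mem_closedBall_zero_iff] at this
      linarith [le_max_left r 1]
    have h2 : K + 1 ≤ essInf (H p 0) P := hTsub hpT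
    obtain ⟨M, hM⟩ := hH.exists_abs_le p
    have hb : IsBoundedUnder (· ≥ ·) (ae P) (H p 0) :=
      ⟨-M, eventually_map.2 (Eventually.of_forall fun ω => (abs_le.1 (hM 0 ω)).1)⟩
    refine hH.ae_forall_of_ae_zero isClosed_Ici ?_
    filter_upwards [ae_essInf_le hb] with ω hω using h2.trans hω
  obtain ⟨D, hDc, hD⟩ := TopologicalSpace.exists_countable_dense (Space d)
  filter_upwards [(ae_ball_iff (hDc.mono (Set.inter_subset_left (t := {p | L < ‖p‖})))).2
    fun p hpD => hp p hpD.2] with ω hω p y hpL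
  have hopen : IsOpen {p : Space d | L < ‖p‖} := isOpen_lt continuous_const continuous_norm
  have hcont : Continuous fun p => H p y ω :=
    (hH.continuous ω).comp (continuous_id.prodMk continuous_const)
  have hsub : closure ({p : Space d | L < ‖p‖} ∩ D) ⊆ {p | K + 1 ≤ H p y ω} :=
    closure_minimal (fun q hq => hω q ⟨hq.2, hq.1⟩ y) (isClosed_le continuous_const hcont)
  have h3 : K + 1 ≤ H p y ω := hsub (hD.open_subset_closure_inter hopen hpL)
  linarith

omit [IsProbabilityMeasure P] in
/-- For levels up to `K`, almost surely the metric solution is the chain metric of a field whose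
sets lie between balls of radius `μ / M` and `L`. -/
theorem exists_metricSol_eq {K : ℝ} (hK : 0 < K) : ∃ M L : ℝ, 1 ≤ M ∧ 1 ≤ L ∧
    ∀ μ, 0 < μ → μ ≤ K → μ / M ≤ L ∧ ∀ᵐ ω ∂P, ∀ x z,
      metricSol H μ z x ω = chainDist (costField H μ (μ / M) L Set.univ ω) x z := by
  obtain ⟨L, hL1, hL⟩ := hH.exists_ae_coercive K
  obtain ⟨M₀, hM₀⟩ := hH.lipschitz 1 one_pos
  have hM0 : (0 : ℝ) ≤ M₀ := M₀.2
  -- The Lipschitz constant `M₀` in the unit ball gives `H ≤ μ` for `‖p‖ ≤ μ / M`, and the added `2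
  -- * K + 1` guarantees that this radius is below `1`.
  refine ⟨M₀ + 2 * K + 1, L, by linarith, hL1, fun μ hμ hμK => ?_⟩
  set M := (M₀ : ℝ) + 2 * K + 1 with hM
  have hMpos : 0 < M := by positivity
  have hl1 : μ / M < 1 := by rw [div_lt_one hMpos]; linarith
  have hl0 : 0 < μ / M := by positivity
  refine ⟨hl1.le.trans hL1, ?_⟩
  filter_upwards [hL, hH.ae_zero_nonpos] with ω hω h0 x z
  -- Almost surely the truncation changes nothing: small momenta are admissible because `H 0 u ω ≤
  -- 0`, and momenta beyond `L` are excluded by coercivity.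
  have hmem : ∀ u p, p ∈ costField H μ (μ / M) L Set.univ ω u ↔ H p u ω ≤ μ := by
    intro u p
    constructor
    · rintro (rfl | ⟨_, hp | hp⟩)
      · exact (h0 u).trans hμ.le
      · have hp1 : p ∈ Metric.ball (0 : Space d) 1 := by
          rw [mem_ball_zero_iff]; exact hp.trans_lt hl1
        have h2 := (hM₀ u ω).2.dist_le_mul p hp1 0 (Metric.mem_ball_self one_pos)
        rw [Real.dist_eq, dist_zero_right] at h2
        have h3 : M₀ * ‖p‖ ≤ μ := by
          calc (M₀ : ℝ) * ‖p‖ ≤ M * (μ / M) :=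
                mul_le_mul (by linarith) hp (norm_nonneg _) hMpos.le
            _ = μ := by field_simp
        linarith [le_abs_self (H p u ω - H 0 u ω), h0 u]
      · exact hp.2
    · intro hp
      refine Or.inr ⟨Set.mem_univ u, Or.inr ⟨?_, hp⟩⟩
      by_contra! hlt
      linarith [hω p u hlt]
  have hconv : ∀ u, Convex ℝ (costField H μ (μ / M) L Set.univ ω u) := by
    intro u
    have e : costField H μ (μ / M) L Set.univ ω u = {p | H p u ω ≤ μ} := by
      ext p; exact hmem u p
    rw [e]
    have hcont : Continuous fun p => H p u ω :=
      (hH.continuous ω).comp (continuous_id.prodMk continuous_const)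
    refine convex_of_isClosed_of_midpoint (isClosed_le hcont continuous_const) fun p hp q hq => ?_
    obtain ⟨Λ, -, -, hΛ, -, hconvΛ⟩ := hH.levelSetConvex
    exact (hconvΛ p q u ω).trans ((hΛ _ _).trans (max_le hp hq))
  exact sSup_subsolution_eq (hH.isCostField hl0 (hl1.le.trans hL1) ω) hconv hmem x z

variable {μ l L : ℝ} (hl : 0 < l) (hlL : l ≤ L)
include hl hlL

theorem exists_tendsto_meanDist (y : Space d) :
    ∃ c, Tendsto (fun n : ℕ => meanDist P H μ l L (n • y) / n) atTop (𝓝 c) := by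
  have hf := hH.isSubadditiveNormLike (μ := μ) hl hlL
  have hsub : Subadditive fun n : ℕ => meanDist P H μ l L (n • y) := fun m n => by
    simp only [add_nsmul]; exact hf.add_le _ _
  refine ⟨hsub.lim, hsub.tendsto_lim ⟨0, ?_⟩⟩
  rintro _ ⟨n, rfl⟩
  exact div_nonneg (hf.nonneg hl.le _) (Nat.cast_nonneg n)

/-- At distance of order `n` a deviation `ε * n` has probability exponentially small in `n`, so
Borel–Cantelli applies. -/
theorem ae_eventually_abs_lt (y : Space d) {ε : ℝ} (hε : 0 < ε) :
    ∀ᵐ ω ∂P, ∀ᶠ n : ℕ in atTop, |chainDist (costField H μ l L Set.univ ω) 0 (n • y) -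
      meanDist P H μ l L (n • y)| < ε * n := by
  have hL : 0 < L := hl.trans_le hlL
  set B := max 1 ‖y‖ with hB
  have hB1 : 1 ≤ B := le_max_left _ _
  set c := l * ε ^ 2 / (1568 * L ^ 3 * B) with hc
  have hc0 : 0 < c := by positivity
  have hbound : ∀ n : ℕ, P {ω | ε * n ≤ |chainDist (costField H μ l L Set.univ ω) 0 (n • y) -
      meanDist P H μ l L (n • y)|} ≤ ENNReal.ofReal (2 * Real.exp (n * -c)) := by
    intro n
    rcases Nat.eq_zero_or_pos n with rfl | hn
    · refine prob_le_one.trans ?_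
      simp
    have hn1 : (1 : ℝ) ≤ n := by exact_mod_cast hn
    have hR : 1 ≤ n * B := one_le_mul_of_one_le_of_one_le hn1 hB1
    have hy : ‖n • y‖ ≤ n * B := by
      rw [← Nat.cast_smul_eq_nsmul ℝ, norm_smul, Real.norm_of_nonneg (by linarith)]
      exact mul_le_mul_of_nonneg_left (le_max_right _ _) (by linarith)
    have h := hH.concentration (μ := μ) hl hlL hR hy (show 0 ≤ ε * n by positivity)
    have e : -(l * (ε * n) ^ 2 / (1568 * L ^ 3 * (n * B))) = n * -c := by
      rw [hc]; field_simp
    rw [e] at h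
    rw [← ofReal_measureReal]
    refine ENNReal.ofReal_le_ofReal ?_
    refine (measureReal_mono (s₂ := {ω | ε * n ≤ chainDist (costField H μ l L Set.univ ω) 0 (n • y) -
      meanDist P H μ l L (n • y)} ∪ {ω | chainDist (costField H μ l L Set.univ ω) 0 (n • y) -
      meanDist P H μ l L (n • y) ≤ -(ε * n)}) ?_).trans ((measureReal_union_le _ _).trans ?_)
    · intro ω hω
      rcases le_abs.1 (show ε * n ≤ _ from hω) with h | h
      · exact Or.inl h
      · exact Or.inr (show _ ≤ -(ε * n) by linarith)
    · linarith [h.1, h.2]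
  have hsum : Summable fun n : ℕ => 2 * Real.exp (n * -c) :=
    (Real.summable_exp_nat_mul_iff.2 (by linarith)).mul_left 2
  have hne : ∑' n : ℕ, P {ω | ε * n ≤ |chainDist (costField H μ l L Set.univ ω) 0 (n • y) -
      meanDist P H μ l L (n • y)|} ≠ ⊤ :=
    ne_top_of_le_ne_top hsum.tsum_ofReal_ne_top (ENNReal.tsum_le_tsum hbound)
  filter_upwards [ae_eventually_notMem hne] with ω hω
  filter_upwards [hω] with n hn
  exact not_le.1 hn

/-- The passage costs along a ray grow linearly at the rate of their means. -/
theorem ae_tendsto_chainDist {y : Space d} {c : ℝ}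
    (hc : Tendsto (fun n : ℕ => meanDist P H μ l L (n • y) / n) atTop (𝓝 c)) :
    ∀ᵐ ω ∂P, Tendsto (fun t : ℝ => t⁻¹ * chainDist (costField H μ l L Set.univ ω) 0 (t • y))
      atTop (𝓝 c) := by
  have hL : 0 < L := hl.trans_le hlL
  have h1 : ∀ᵐ ω ∂P, ∀ j : ℕ, ∀ᶠ n : ℕ in atTop,
      |chainDist (costField H μ l L Set.univ ω) 0 (n • y) - meanDist P H μ l L (n • y)| <
        1 / ((j : ℝ) + 1) * n :=
    ae_all_iff.2 fun j => hH.ae_eventually_abs_lt hl hlL y (by positivity)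
  filter_upwards [h1] with ω hω
  have hC := hH.isCostField (μ := μ) hl hlL ω
  set D := chainDist (costField H μ l L Set.univ ω) 0
  have hdiff : Tendsto (fun n : ℕ => (D (n • y) - meanDist P H μ l L (n • y)) / n) atTop
      (𝓝 0) := by
    rw [Metric.tendsto_nhds]
    intro ε hε
    obtain ⟨j, hj⟩ := exists_nat_one_div_lt hε
    filter_upwards [hω j, eventually_gt_atTop 0] with n hn hn0
    have hn0 : (0 : ℝ) < n := by exact_mod_cast hn0
    rw [Real.dist_eq, sub_zero, abs_div, abs_of_pos hn0, div_lt_iff₀ hn0]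
    exact hn.trans (mul_lt_mul_of_pos_right hj hn0)
  have hnat : Tendsto (fun n : ℕ => D (n • y) / n) atTop (𝓝 c) := by
    have := hdiff.add hc
    rw [zero_add] at this
    refine this.congr fun n => ?_
    rw [← add_div, sub_add_cancel]
  have hfloor : Tendsto (fun t : ℝ => ⌊t⌋₊) atTop atTop := tendsto_nat_floor_atTop
  have h2 : Tendsto (fun t : ℝ => ((⌊t⌋₊ : ℕ) : ℝ) / t * (D (⌊t⌋₊ • y) / (⌊t⌋₊ : ℕ))) atTop
      (𝓝 (1 * c)) := (tendsto_nat_floor_div_atTop (R := ℝ)).mul (hnat.comp hfloor)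
  rw [one_mul] at h2
  -- Real times are compared with their integer parts through the Lipschitz bound.
  have h3 : Tendsto (fun t : ℝ => t⁻¹ * (D (t • y) - D (⌊t⌋₊ • y))) atTop (𝓝 0) := by
    have h4 : Tendsto (fun t : ℝ => t⁻¹ * (L * ‖y‖)) atTop (𝓝 0) := by
      simpa using tendsto_inv_atTop_zero.mul_const (L * ‖y‖)
    refine squeeze_zero_norm' ?_ h4
    filter_upwards [eventually_gt_atTop 0] with t ht
    rw [norm_mul, Real.norm_of_nonneg (inv_nonneg.2 ht.le)]
    refine mul_le_mul_of_nonneg_left ?_ (inv_nonneg.2 ht.le)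
    have h5 := (hC.lipschitz_chainDist 0).dist_le_mul (t • y) (⌊t⌋₊ • y)
    rw [Real.coe_toNNReal _ hL.le, Real.dist_eq, dist_eq_norm, ← Nat.cast_smul_eq_nsmul ℝ ⌊t⌋₊ y,
      ← sub_smul, norm_smul] at h5
    rw [← Nat.cast_smul_eq_nsmul ℝ ⌊t⌋₊ y]
    refine h5.trans (mul_le_mul_of_nonneg_left ?_ hL.le)
    refine mul_le_of_le_one_left (norm_nonneg _) ?_
    rw [Real.norm_of_nonneg (sub_nonneg.2 (Nat.floor_le ht.le))]
    linarith [Nat.lt_floor_add_one t]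
  have h6 := h2.add h3
  rw [add_zero] at h6
  refine h6.congr' ?_
  filter_upwards [eventually_ge_atTop 1] with t ht
  have hft : (0 : ℝ) < (⌊t⌋₊ : ℕ) := by exact_mod_cast Nat.floor_pos.2 ht
  have ht0 : t ≠ 0 := by linarith
  field_simp
  ring

end StandingAssumptions

/-- The limit of the normalized means of the metric solution. -/
noncomputable def effectiveMetric (P : Measure Ω) (H : Space d → Space d → Ω → ℝ) (μ : ℝ)
    (y : Space d) : ℝ :=
  limUnder atTop fun n : ℕ => (∫ ω, metricSol H μ (n • y) 0 ω ∂P) / n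

/-- The radii of the truncation depend on the level bound `K`, while the limit must not. It is
therefore defined through `metricSol` and identified here with the limit for any admissible
truncation. -/
theorem StandingAssumptions.tendsto_effectiveMetric (hH : StandingAssumptions P τ H)
    {μ l L : ℝ} (hl : 0 < l) (hlL : l ≤ L) (heq : ∀ᵐ ω ∂P, ∀ x z,
      metricSol H μ z x ω = chainDist (costField H μ l L Set.univ ω) x z) (y : Space d) :
    Tendsto (fun n : ℕ => meanDist P H μ l L (n • y) / n) atTop
      (𝓝 (effectiveMetric P H μ y)) := by
  have h : (fun n : ℕ => (∫ ω, metricSol H μ (n • y) 0 ω ∂P) / n) =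
      fun n : ℕ => meanDist P H μ l L (n • y) / n := by
    funext n
    rw [meanDist, integral_congr_ae (heq.mono fun ω hω => hω 0 (n • y))]
  rw [effectiveMetric, h]
  exact tendsto_nhds_limUnder (hH.exists_tendsto_meanDist hl hlL y)

end AlmostSure

end HJ

/-! ### Assembly of the concentration and bias estimates -/

theorem theorem2p1 {d : ℕ} {Ω : Type*} [MeasurableSpace Ω] (P : Measure Ω)
    [IsProbabilityMeasure P] (τ : HJ.Space d → Ω → Ω) (H : HJ.Space d → HJ.Space d → Ω → ℝ)
    (hH : HJ.StandingAssumptions P τ H) :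
    ∃ mbar : ℝ → HJ.Space d → ℝ,
      (∀ μ : ℝ, 0 < μ → HJ.IsEffectiveMetric P H μ (mbar μ)) ∧
      ∀ K : ℝ, 0 < K → ∃ C : ℝ, 0 < C ∧
        ∀ (μ lam : ℝ) (y : HJ.Space d), 0 < μ → μ ≤ K → 0 < lam → 1 < ‖y‖ →
          P.real {ω | HJ.metricSol H μ y 0 ω - mbar μ y ≤ -lam}
              ≤ Real.exp (-(μ * lam ^ 2 / (C * ‖y‖))) ∧
          (C * (‖y‖ ^ (1 / 2 : ℝ) / μ ^ (3 / 2 : ℝ) + ‖y‖ ^ (2 / 3 : ℝ) / μ)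
              * Real.log (1 + ‖y‖ / μ) ^ (1 / 2 : ℝ) ≤ lam →
            P.real {ω | lam ≤ HJ.metricSol H μ y 0 ω - mbar μ y}
              ≤ Real.exp (-(μ * lam ^ 2 / (C * ‖y‖)))) := by
  refine ⟨HJ.effectiveMetric P H, fun μ hμ y => ?_, fun K hK => ?_⟩
  · obtain ⟨M, L, hM, hL, h⟩ := hH.exists_metricSol_eq hμ
    obtain ⟨hlL, heq⟩ := h μ hμ le_rfl
    have hl : 0 < μ / M := by positivity
    filter_upwards [heq, hH.ae_tendsto_chainDist hl hlL
      (hH.tendsto_effectiveMetric hl hlL heq y)] with ω h1 h2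
    simpa only [h1] using h2
  obtain ⟨M, L, hM, hL, h⟩ := hH.exists_metricSol_eq hK
  have hM0 : 0 < M := one_pos.trans_le hM
  have hL0 : 0 < L := one_pos.trans_le hL
  set CR := M * (3 * L + 1) + √d * K + 2 * L * M with hCR
  set CJ := 2 * M * (3 * L + 1) + 3 * K with hCJ
  set w := Real.log (4 * (CJ + 1) ^ d) / Real.log (1 + 1 / K) + d with hw
  set A₁ := √((w + 1) * (1568 * L ^ 3 * M * CR)) with hA₁
  set A := 3 * A₁ + (4 * L * √d + 1) * (K / √(Real.log (1 + 1 / K))) with hA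
  have hA0 : 0 ≤ A := by positivity
  have hκ := HJ.log_one_add_inv_pos hK
  have hdy0 : 0 ≤ HJ.dyadicErr K := tsum_nonneg fun j => by positivity
  set Cb := L / √(Real.log (1 + 1 / K)) + (A / 2 * HJ.dyadicErr K + 1) +
    L * (d + 1) * M * (2 * L / √(Real.log (1 + 1 / K)) + 2 * (A / 2 * HJ.dyadicErr K + 1))
  have hCb0 : 0 ≤ Cb := by positivity
  -- The part `2 * Cb` makes the bias at most `λ / 2` in the upper tail; `6272 = 4 * 1568`
  -- compensates for using the concentration bound at `λ / 2`.
  refine ⟨2 * Cb + 6272 * M * L ^ 3, by positivity, fun μ lam y hμ hμK hlam hy => ?_⟩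
  obtain ⟨hlL, heq⟩ := h μ hμ hμK
  have hl : 0 < μ / M := by positivity
  have hmb := hH.tendsto_effectiveMetric hl hlL heq
  have hf := hH.isSubadditiveNormLike (μ := μ) hl hlL
  have hy0 : 0 < ‖y‖ := one_pos.trans hy
  set C := 2 * Cb + 6272 * M * L ^ 3 with hC
  have hexp : ∀ r, lam ^ 2 ≤ 4 * r ^ 2 →
      Real.exp (-(μ / M * r ^ 2 / (1568 * L ^ 3 * ‖y‖))) ≤
        Real.exp (-(μ * lam ^ 2 / (C * ‖y‖))) := by
    intro r hr
    rw [Real.exp_le_exp, neg_le_neg_iff]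
    calc μ * lam ^ 2 / (C * ‖y‖) ≤ μ * lam ^ 2 / (6272 * M * L ^ 3 * ‖y‖) := by
          gcongr
          linarith
      _ ≤ μ * (4 * r ^ 2) / (6272 * M * L ^ 3 * ‖y‖) := by gcongr
      _ = μ / M * r ^ 2 / (1568 * L ^ 3 * ‖y‖) := by field_simp; ring
  -- Comparison of outer measures, so the events about `metricSol`, which agrees with the chain
  -- metric only almost surely, need not be measurable.
  have hmono : ∀ {S S' : Set Ω}, (∀ᵐ ω ∂P, ω ∈ S → ω ∈ S') → P.real S ≤ P.real S' :=
    fun hSS' => ENNReal.toReal_mono (measure_ne_top _ _) (measure_mono_ae hSS')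
  constructor
  -- The limit lies below the mean by subadditivity, so a deviation below the limit is at least as
  -- large a deviation below the mean.
  · refine le_trans (hmono ?_) ((hH.concentration (μ := μ) hl hlL hy.le le_rfl hlam.le).2.trans
      (hexp lam (by nlinarith [sq_nonneg lam])))
    filter_upwards [heq] with ω hω hmem
    have h1 : HJ.metricSol H μ y 0 ω - HJ.effectiveMetric P H μ y ≤ -lam := hmem
    rw [hω] at h1
    change _ ≤ -lam
    linarith [hf.limit_le hmb y]
  · intro hbig
    have hbias := hf.sub_limit_le hmb hlL hμ hμK hA0 hM0 rfl
      (hH.crossing_fluctScale hl hlL hL hμ hμK hM rfl hCR hCJ hw hA₁) hy.le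
    have hT : 0 ≤ (‖y‖ ^ (1 / 2 : ℝ) / μ ^ (3 / 2 : ℝ) + ‖y‖ ^ (2 / 3 : ℝ) / μ) *
        Real.log (1 + ‖y‖ / μ) ^ (1 / 2 : ℝ) := by
      have : 0 ≤ Real.log (1 + ‖y‖ / μ) := Real.log_nonneg (by linarith [div_pos hy0 hμ])
      positivity
    have hCC : 2 * Cb ≤ C := by
      have : 0 ≤ 6272 * M * L ^ 3 := by positivity
      linarith
    rw [mul_assoc] at hbig
    have hhalf := (mul_le_mul_of_nonneg_right hCC hT).trans hbig
    refine le_trans (hmono ?_) ((hH.concentration (μ := μ) hl hlL hy.le le_rfl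
      (show 0 ≤ lam / 2 by positivity)).1.trans (hexp (lam / 2) (by linarith [sq_nonneg lam])))
    filter_upwards [heq] with ω hω hmem
    have h1 : lam ≤ HJ.metricSol H μ y 0 ω - HJ.effectiveMetric P H μ y := hmem
    rw [hω] at h1
    change lam / 2 ≤ _
    change _ ≤ Cb * _ at hbias
    rw [mul_assoc] at hhalf
    linarith
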